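/- Let $G$ be a finite simple connected graph with $n$ vertices and $m\ge 1$ edges, given by $n$, $m$ and the list of its edges (in any order). For a set $A\subseteq V(G)$, the size of the cut $(A,V(G)\setminus A)$ is the number of edges of $G$ with exactly one endpoint in $A$, and $mc(G)$ is the maximum size of a cut of $G$. There is a deterministic combinatorial algorithm (a single program for a word RAM with words of $O(\log(n+m))$ bits, whose unit-cost operations are addition, subtraction, comparison and array access, without any other numerical operations) which, for every such $G$, runs in $O(nm)$ time and outputs a cut of $G$ whose size is at least $$\min\Bigl\{1,\ \frac12+\frac{n}{2m}\Bigr\}\cdot mc(G).$$ In other words, it is an $O(nm)$-time $\bigl(\frac12+\frac{n}{2m}\bigr)$-approximation algorithm for Max-Cut when $m\ge n$, and it finds a maximum cut when $G$ is a tree. -/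

import Mathlib

/-! ### A word RAM with unit-cost steps

The machine has registers and arrays, both named by numerals that occur literally in the program, so
that a program uses only finitely many of them. All entries are natural numbers below a bound `W`
(machine words of `log₂ W` bits). The only operations are copying, constants, addition, truncated
subtraction, the comparisons `<` and `=`, indexed array access, branching and looping. -/

namespace RAM

/-- The contents of the registers and of the arrays. -/
structure State where
  reg : ℕ → ℕ
  arr : ℕ → ℕ → ℕ

/-- Expressions. `get a e` is the entry of array `a` at the index given by `e`; comparisons have
the value `1` (true) or `0` (false). -/
inductive Expr where
  | const (c : ℕ)
  | reg (x : ℕ)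
  | get (a : ℕ) (e : Expr)
  | add (e f : Expr)
  | sub (e f : Expr)
  | lt (e f : Expr)
  | eq (e f : Expr)

/-- The value of an expression. -/
def Expr.eval (s : State) : Expr → ℕ
  | .const c => c
  | .reg x => s.reg x
  | .get a e => s.arr a (e.eval s)
  | .add e f => e.eval s + f.eval s
  | .sub e f => e.eval s - f.eval s
  | .lt e f => if e.eval s < f.eval s then 1 else 0
  | .eq e f => if e.eval s = f.eval s then 1 else 0

/-- The number of steps that the evaluation of an expression takes: one for each of its nodes. -/
def Expr.cost : Expr → ℕ
  | .const _ => 1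
  | .reg _ => 1
  | .get _ e => e.cost + 1
  | .add e f => e.cost + f.cost + 1
  | .sub e f => e.cost + f.cost + 1
  | .lt e f => e.cost + f.cost + 1
  | .eq e f => e.cost + f.cost + 1

/-- The values of the expression and of all its subexpressions, array indices included, fit into a
machine word. -/
def Expr.Fits (W : ℕ) (s : State) : Expr → Prop
  | .const c => c < W
  | .reg x => s.reg x < W
  | .get a e => e.Fits W s ∧ s.arr a (e.eval s) < W
  | .add e f => e.Fits W s ∧ f.Fits W s ∧ e.eval s + f.eval s < W
  | .sub e f => e.Fits W s ∧ f.Fits W s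
  | .lt e f => e.Fits W s ∧ f.Fits W s ∧ 1 < W
  | .eq e f => e.Fits W s ∧ f.Fits W s ∧ 1 < W

/-- Programs. -/
inductive Prog where
  | skip
  /-- `assign x e`: register `x` becomes `e`. -/
  | assign (x : ℕ) (e : Expr)
  /-- `store a i e`: the entry of array `a` at index `i` becomes `e`. -/
  | store (a : ℕ) (i e : Expr)
  | seq (p q : Prog)
  /-- `branch b p q`: if `b ≠ 0` then `p` else `q`. -/
  | branch (b : Expr) (p q : Prog)
  /-- `loop b p`: while `b ≠ 0` do `p`. -/
  | loop (b : Expr) (p : Prog)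

/-- The state with register `x` overwritten by `v`. -/
def State.setReg (s : State) (x v : ℕ) : State where
  reg := fun y => if y = x then v else s.reg y
  arr := s.arr

/-- The state with the entry of array `a` at index `i` overwritten by `v`. -/
def State.setArr (s : State) (a i v : ℕ) : State where
  reg := s.reg
  arr := fun b j => if b = a ∧ j = i then v else s.arr b j

/-- `Exec W p s s' t`: on words below `W`, program `p` started in state `s` halts in state `s'` after
exactly `t` steps. A program that produces a value that does not fit into a word does not halt
in any state. -/
inductive Exec (W : ℕ) : Prog → State → State → ℕ → Prop
  | skip (s : State) : Exec W .skip s s 1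
  | assign (s : State) (x : ℕ) (e : Expr) (he : e.Fits W s) :
      Exec W (.assign x e) s (s.setReg x (e.eval s)) (e.cost + 1)
  | store (s : State) (a : ℕ) (i e : Expr) (hi : i.Fits W s) (he : e.Fits W s) :
      Exec W (.store a i e) s (s.setArr a (i.eval s) (e.eval s)) (i.cost + e.cost + 1)
  | seq {p q : Prog} {s s₁ s₂ : State} {t₁ t₂ : ℕ}
      (hp : Exec W p s s₁ t₁) (hq : Exec W q s₁ s₂ t₂) : Exec W (.seq p q) s s₂ (t₁ + t₂)
  | branch_true {b : Expr} {p q : Prog} {s s₁ : State} {t : ℕ}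
      (hb : b.Fits W s) (h : b.eval s ≠ 0) (hp : Exec W p s s₁ t) :
      Exec W (.branch b p q) s s₁ (b.cost + 1 + t)
  | branch_false {b : Expr} {p q : Prog} {s s₁ : State} {t : ℕ}
      (hb : b.Fits W s) (h : b.eval s = 0) (hq : Exec W q s s₁ t) :
      Exec W (.branch b p q) s s₁ (b.cost + 1 + t)
  | loop_false {b : Expr} {p : Prog} {s : State}
      (hb : b.Fits W s) (h : b.eval s = 0) : Exec W (.loop b p) s s (b.cost + 1)
  | loop_true {b : Expr} {p : Prog} {s s₁ s₂ : State} {t₁ t₂ : ℕ}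
      (hb : b.Fits W s) (h : b.eval s ≠ 0)
      (hp : Exec W p s s₁ t₁) (hl : Exec W (.loop b p) s₁ s₂ t₂) :
      Exec W (.loop b p) s s₂ (b.cost + 1 + t₁ + t₂)

/-- The machine is deterministic: the final state and the number of steps are unique. -/
theorem Exec.deterministic {W : ℕ} {p : Prog} {s s₁ s₂ : State} {t₁ t₂ : ℕ}
    (h₁ : Exec W p s s₁ t₁) (h₂ : Exec W p s s₂ t₂) : s₁ = s₂ ∧ t₁ = t₂ := by
  induction h₁ generalizing s₂ t₂ with
  | skip s => cases h₂; exact ⟨rfl, rfl⟩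
  | assign s x e he => cases h₂; exact ⟨rfl, rfl⟩
  | store s a i e hi he => cases h₂; exact ⟨rfl, rfl⟩
  | seq hp hq ihp ihq =>
    cases h₂ with
    | seq hp' hq' =>
      obtain ⟨rfl, rfl⟩ := ihp hp'
      obtain ⟨rfl, rfl⟩ := ihq hq'
      exact ⟨rfl, rfl⟩
  | branch_true hb h hp ih =>
    cases h₂ with
    | branch_true hb' h' hp' => obtain ⟨rfl, rfl⟩ := ih hp'; exact ⟨rfl, rfl⟩
    | branch_false hb' h' hq' => exact absurd h' h
  | branch_false hb h hq ih =>
    cases h₂ with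
    | branch_true hb' h' hp' => exact absurd h h'
    | branch_false hb' h' hq' => obtain ⟨rfl, rfl⟩ := ih hq'; exact ⟨rfl, rfl⟩
  | loop_false hb h =>
    cases h₂ with
    | loop_false hb' h' => exact ⟨rfl, rfl⟩
    | loop_true hb' h' hp' hl' => exact absurd h h'
  | loop_true hb h hp hl ihp ihl =>
    cases h₂ with
    | loop_false hb' h' => exact absurd h' h
    | loop_true hb' h' hp' hl' =>
      obtain ⟨rfl, rfl⟩ := ihp hp'
      obtain ⟨rfl, rfl⟩ := ihl hl'
      exact ⟨rfl, rfl⟩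

end RAM

/-! ### Cuts -/

namespace MaxCut

/-- The edges of `G` with one endpoint in `A` and one in `B`. -/
def edgesBetween {V : Type*} (G : SimpleGraph V) (A B : Set V) : Set (Sym2 V) :=
  {e | ∃ u ∈ A, ∃ v ∈ B, G.Adj u v ∧ e = s(u, v)}

/-- The size of the cut given by the partition of the vertex set into `A` and its complement. -/
noncomputable def cutSize {V : Type*} (G : SimpleGraph V) (A : Set V) : ℕ :=
  (edgesBetween G A Aᶜ).ncard

/-- The size of a maximum cut of a finite graph. -/
noncomputable def maxCut {V : Type*} [Fintype V] (G : SimpleGraph V) : ℕ :=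
  Finset.univ.sup fun A : Finset V => cutSize G (A : Set V)

/-- `e` lists the edges of `G`, each exactly once, in any order and with the two endpoints of each
edge in any order. -/
def IsEdgeList {n m : ℕ} (G : SimpleGraph (Fin n)) (e : Fin m → Fin n × Fin n) : Prop :=
  Function.Injective (fun i => s((e i).1, (e i).2)) ∧
    Set.range (fun i => s((e i).1, (e i).2)) = G.edgeSet

/-- The initial state: registers `0` and `1` hold the numbers of vertices and of edges, arrays `0`
and `1` hold the first and the second endpoints of the edges, and all other entries are `0`. -/
def inputState {n m : ℕ} (e : Fin m → Fin n × Fin n) : RAM.State where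
  reg := fun x => if x = 0 then n else if x = 1 then m else 0
  arr := fun a i =>
    if h : i < m then
      if a = 0 then ((e ⟨i, h⟩).1 : ℕ) else if a = 1 then ((e ⟨i, h⟩).2 : ℕ) else 0
    else 0

/-- The output: the set of vertices `v` whose entry in array `2` is nonzero, which is one side of
a cut. -/
def outputSide (n : ℕ) (s : RAM.State) : Set (Fin n) :=
  {v | s.arr 2 v ≠ 0}

end MaxCut

/-!
The algorithm rests on a lower bound for cuts in a connected signed multigraph with `r` vertices,
where an edge `xy` with sign `z` is satisfied by a `0`-`1`-colouring `c` if `c x + c y + z` is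
even. If `β` edges are violated by some colouring `κ`, then one finds in linear time a colouring
for which the satisfied edges exceed the violated ones (loops excluded) by at least `r - 1 - β`.
To this end take a depth-first tree and the colouring `tau` that satisfies its edges. The violated
edges join a vertex to one of its ancestors. Going from the leaves to the root, cut the link from
`k` to its parent `p` if a violated edge leads to `p` from the part below `k` that is still
connected to `k`. The cut links are at most `β` in number, because the component below a cut link,
together with this link, supports an odd cycle, and these sets of edges are disjoint
(`CutForest.card_cut_le`). In every component that remains `tau` satisfies all edges. Now go from
the root to the leaves and flip a component if this satisfies more of the edges that lead upwards
from it. At least half of the edges between components become satisfied, and all of the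
`r - 1 - #cut` remaining links are (`CutForest.card_nonroot_le`).

For a plain graph this gives `2 |F| ≥ m + n - 1 - β`, where `F` is the cut found and
`β = m - mc(G)`. The ratio of the theorem follows if `n β ≥ m`. It also follows if `m ≤ n`, because then
`n β < m` forces `β = 0`. In the remaining case `2 |F| ≥ m + n - β` is needed, one unit more. Let `S`
be a set of `n` edges that one maximum cut cuts all. Colour the components of `S` by spanning
trees and contract them. Edges inside of components become loops, and the bound for the contracted
graph, combined with the loops of `S`, which are all cut, yields `2 |F| ≥ m + |S| + r - 1 - β`
with `r ≥ 1` (`card_le_of_contract`). Such a set `S` is found by trial: if fewer than `m / n`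
edges are bad, then one of the disjoint windows of `n` consecutive edges of the list, or the last
`n + 1` edges without one of them, contains no bad edge (`exists_window`). These are `O(n)` sets,
since `m ≤ n²`, and each trial takes time `O(n + m)`.

The program keeps all entries at most `M = 2 (n + m + 2)`, and its expressions are small, so that
words below `(n + m + 2) ^ 4` suffice. Correctness and running time of a program are treated
together by `RAM.Runs`.

Conventions used throughout: vertices, edges and preorder numbers are natural numbers, families
indexed by them are functions `ℕ → ℕ` whose values beyond the range of the index are irrelevant,
and a pointer to `k` is stored as `k + 1`, with `0` as the null pointer.
-/

/-! ### Straight-line programs and loops on the word RAM -/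

namespace RAM

@[simp] theorem State.setReg_reg (s : State) (x v y : ℕ) :
    (s.setReg x v).reg y = if y = x then v else s.reg y := rfl

@[simp] theorem State.setReg_arr (s : State) (x v : ℕ) : (s.setReg x v).arr = s.arr := rfl

@[simp] theorem State.setArr_reg (s : State) (a i v : ℕ) : (s.setArr a i v).reg = s.reg := rfl

@[simp] theorem State.setArr_arr (s : State) (a i v b : ℕ) :
    (s.setArr a i v).arr b = if b = a then Function.update (s.arr b) i v else s.arr b := by
  funext j
  by_cases hb : b = a <;> by_cases hj : j = i <;> simp [State.setArr, Function.update, hb, hj]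

/-- All entries of the state are at most `M`. Together with a bound on the size of the expressions
this implies that everything fits into a machine word. -/
def Bdd (M : ℕ) (s : State) : Prop := (∀ x, s.reg x ≤ M) ∧ ∀ a i, s.arr a i ≤ M

theorem Bdd.setReg {M : ℕ} {s : State} (h : Bdd M s) (x : ℕ) {v : ℕ} (hv : v ≤ M) :
    Bdd M (s.setReg x v) := by
  refine ⟨fun y => ?_, h.2⟩
  rw [State.setReg_reg]
  split_ifs
  exacts [hv, h.1 y]

theorem Bdd.setArr {M : ℕ} {s : State} (h : Bdd M s) (a i : ℕ) {v : ℕ} (hv : v ≤ M) :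
    Bdd M (s.setArr a i v) := by
  refine ⟨h.1, fun b j => ?_⟩
  simp only [State.setArr]
  split_ifs
  exacts [hv, h.2 b j]

/-- All constants in the expression are `0` or `1`. -/
def Expr.small : Expr → Bool
  | .const c => c ≤ 1
  | .reg _ => true
  | .get _ e => e.small
  | .add e f => e.small && f.small
  | .sub e f => e.small && f.small
  | .lt e f => e.small && f.small
  | .eq e f => e.small && f.small

theorem Expr.one_le_cost (e : Expr) : 1 ≤ e.cost := by
  cases e <;> simp [Expr.cost]

theorem Expr.eval_le {M : ℕ} (hM : 1 ≤ M) {s : State} (h : Bdd M s) (e : Expr)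
    (he : e.small = true) : e.eval s ≤ e.cost * M := by
  induction e with
  | const c => simp [Expr.small] at he; simp [Expr.eval, Expr.cost]; omega
  | reg x => simpa [Expr.eval, Expr.cost] using h.1 x
  | get a e ih =>
    have := h.2 a (e.eval s)
    simp only [Expr.eval, Expr.cost]; nlinarith
  | add e f ihe ihf =>
    simp only [Expr.small, Bool.and_eq_true] at he
    have := ihe he.1
    have := ihf he.2
    simp only [Expr.eval, Expr.cost]; nlinarith
  | sub e f ihe ihf =>
    simp only [Expr.small, Bool.and_eq_true] at he
    have := ihe he.1
    have : e.eval s - f.eval s ≤ e.eval s := Nat.sub_le _ _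
    simp only [Expr.eval, Expr.cost]; nlinarith
  | lt e f ihe ihf =>
    have : (if e.eval s < f.eval s then 1 else 0) ≤ 1 := by split_ifs <;> simp
    simp only [Expr.eval, Expr.cost]; nlinarith [e.one_le_cost]
  | eq e f ihe ihf =>
    have : (if e.eval s = f.eval s then 1 else 0) ≤ 1 := by split_ifs <;> simp
    simp only [Expr.eval, Expr.cost]; nlinarith [e.one_le_cost]

theorem Expr.fits_of_cost {M W : ℕ} (hM : 1 ≤ M) {s : State} (h : Bdd M s) (e : Expr)
    (he : e.small = true) (hW : e.cost * M < W) : e.Fits W s := by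
  have key := Expr.eval_le hM h
  induction e with
  | const c =>
    have := key _ he
    simp only [Expr.eval] at this; simp only [Expr.Fits]; omega
  | reg x => simp only [Expr.cost] at hW; have := h.1 x; simp only [Expr.Fits]; omega
  | get a e ih =>
    have := h.2 a (e.eval s)
    simp only [Expr.cost] at hW
    exact ⟨ih he (by nlinarith), by nlinarith⟩
  | add e f ihe ihf =>
    have h1 := key _ he
    simp only [Expr.small, Bool.and_eq_true] at he
    simp only [Expr.eval] at h1
    have h2 : e.cost * M ≤ (Expr.add e f).cost * M :=
      Nat.mul_le_mul_right _ (by simp [Expr.cost]; omega)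
    have h3 : f.cost * M ≤ (Expr.add e f).cost * M :=
      Nat.mul_le_mul_right _ (by simp [Expr.cost]; omega)
    exact ⟨ihe he.1 (by omega), ihf he.2 (by omega), by omega⟩
  | sub e f ihe ihf =>
    simp only [Expr.small, Bool.and_eq_true] at he
    have h2 : e.cost * M ≤ (Expr.sub e f).cost * M :=
      Nat.mul_le_mul_right _ (by simp [Expr.cost]; omega)
    have h3 : f.cost * M ≤ (Expr.sub e f).cost * M :=
      Nat.mul_le_mul_right _ (by simp [Expr.cost]; omega)
    exact ⟨ihe he.1 (by omega), ihf he.2 (by omega)⟩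
  | lt e f ihe ihf =>
    simp only [Expr.small, Bool.and_eq_true] at he
    have h2 : e.cost * M ≤ (Expr.lt e f).cost * M :=
      Nat.mul_le_mul_right _ (by simp [Expr.cost]; omega)
    have h3 : f.cost * M ≤ (Expr.lt e f).cost * M :=
      Nat.mul_le_mul_right _ (by simp [Expr.cost]; omega)
    refine ⟨ihe he.1 (by omega), ihf he.2 (by omega), ?_⟩
    simp only [Expr.cost] at hW; have := e.one_le_cost; nlinarith
  | eq e f ihe ihf =>
    simp only [Expr.small, Bool.and_eq_true] at he
    have h2 : e.cost * M ≤ (Expr.eq e f).cost * M :=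
      Nat.mul_le_mul_right _ (by simp [Expr.cost]; omega)
    have h3 : f.cost * M ≤ (Expr.eq e f).cost * M :=
      Nat.mul_le_mul_right _ (by simp [Expr.cost]; omega)
    refine ⟨ihe he.1 (by omega), ihf he.2 (by omega), ?_⟩
    simp only [Expr.cost] at hW; have := e.one_le_cost; nlinarith

/-- The expression has constants `0` and `1` only and at most twenty nodes. -/
def Expr.ok (e : Expr) : Bool := e.small && decide (e.cost ≤ 20)

theorem Expr.fits_of_ok {M W : ℕ} (hM : 1 ≤ M) (hW : 20 * M < W) {s : State} (h : Bdd M s)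
    {e : Expr}
    (he : e.ok = true) : e.Fits W s := by
  simp only [Expr.ok, Bool.and_eq_true, decide_eq_true_eq] at he
  exact e.fits_of_cost hM h he.1 (by nlinarith)

/-- All expressions of the program are `Expr.ok`. -/
def Prog.ok : Prog → Bool
  | .skip => true
  | .assign _ e => e.ok
  | .store _ i e => i.ok && e.ok
  | .seq p q => p.ok && q.ok
  | .branch b p q => b.ok && p.ok && q.ok
  | .loop b p => b.ok && p.ok

/-- The effect of a program without loops (loops are skipped). -/
def Prog.run : Prog → State → State
  | .skip, s => s
  | .assign x e, s => s.setReg x (e.eval s)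
  | .store a i e, s => s.setArr a (i.eval s) (e.eval s)
  | .seq p q, s => q.run (p.run s)
  | .branch b p q, s => if b.eval s ≠ 0 then p.run s else q.run s
  | .loop _ _, s => s

/-- The run of the program from `s` meets no loop and writes only values that are at most `M`. -/
def Prog.Safe (M : ℕ) : Prog → State → Prop
  | .skip, _ => True
  | .assign _ e, s => e.eval s ≤ M
  | .store _ _ e, s => e.eval s ≤ M
  | .seq p q, s => p.Safe M s ∧ q.Safe M (p.run s)
  | .branch b p q, s => (b.eval s ≠ 0 → p.Safe M s) ∧ (b.eval s = 0 → q.Safe M s)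
  | .loop _ _, _ => False

/-- An upper bound on the running time of a program without loops. -/
def Prog.time : Prog → ℕ
  | .skip => 1
  | .assign _ e => e.cost + 1
  | .store _ i e => i.cost + e.cost + 1
  | .seq p q => p.time + q.time
  | .branch b p q => b.cost + 1 + (p.time + q.time)
  | .loop _ _ => 0

/-- `Runs W M P s s' T`: the program takes the state `s` to `s'` in at most `T` steps, and the
entries of `s'` are at most `M`. -/
def Runs (W M : ℕ) (P : Prog) (s s' : State) (T : ℕ) : Prop :=
  ∃ t ≤ T, Exec W P s s' t ∧ Bdd M s'

theorem Runs.bdd {W M : ℕ} {P : Prog} {s s' : State} {T : ℕ} (h : Runs W M P s s' T)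
    : Bdd M s' := by
  obtain ⟨_, _, _, h⟩ := h
  exact h

theorem Runs.mono {W M : ℕ} {P : Prog} {s s' : State} {T T' : ℕ} (h : Runs W M P s s' T)
    (hT : T ≤ T') : Runs W M P s s' T' := by
  obtain ⟨t, ht, h⟩ := h
  exact ⟨t, ht.trans hT, h⟩

theorem Runs.seq {W M : ℕ} {P Q : Prog} {s s₁ s₂ : State} {T₁ T₂ : ℕ} (h₁ : Runs W M P s s₁ T₁)
    (h₂ : Runs W M Q s₁ s₂ T₂) : Runs W M (.seq P Q) s s₂ (T₁ + T₂) := by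
  obtain ⟨t₁, ht₁, e₁, _⟩ := h₁
  obtain ⟨t₂, ht₂, e₂, b₂⟩ := h₂
  exact ⟨t₁ + t₂, by omega, .seq e₁ e₂, b₂⟩

theorem Runs.of_safe {W M : ℕ} (hM : 1 ≤ M) (hW : 20 * M < W) (P : Prog) (hok : P.ok = true)
    {s : State} (hs : Bdd M s) (h : P.Safe M s) : Runs W M P s (P.run s) P.time := by
  induction P generalizing s with
  | skip => exact ⟨1, le_rfl, .skip s, hs⟩
  | assign x e => exact ⟨_, le_rfl, .assign s x e (e.fits_of_ok hM hW hs hok), hs.setReg x h⟩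
  | store a i e =>
    simp only [Prog.ok, Bool.and_eq_true] at hok
    exact ⟨_, le_rfl, .store s a i e (i.fits_of_ok hM hW hs hok.1) (e.fits_of_ok hM hW hs hok.2),
      hs.setArr a _ h⟩
  | seq p q ihp ihq =>
    simp only [Prog.ok, Bool.and_eq_true] at hok
    have h1 := ihp hok.1 hs h.1
    exact h1.seq (ihq hok.2 h1.bdd h.2)
  | branch b p q ihp ihq =>
    simp only [Prog.ok, Bool.and_eq_true] at hok
    by_cases hb : b.eval s = 0
    · obtain ⟨t, ht, e, hs'⟩ := ihq hok.2 hs (h.2 hb)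
      refine ⟨b.cost + 1 + t, by simp only [Prog.time]; omega, ?_, ?_⟩
      · simpa [Prog.run, hb] using Exec.branch_false (p := p) (b.fits_of_ok hM hW hs hok.1.1) hb e
      · simpa [Prog.run, hb] using hs'
    · obtain ⟨t, ht, e, hs'⟩ := ihp hok.1.2 hs (h.1 hb)
      refine ⟨b.cost + 1 + t, by simp only [Prog.time]; omega, ?_, ?_⟩
      · simpa [Prog.run, hb] using Exec.branch_true (q := q) (b.fits_of_ok hM hW hs hok.1.1) hb e
      · simpa [Prog.run, hb] using hs'
  | loop b p => exact h.elim

/-- The program does not assign register `x`. -/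
def Prog.noReg (x : ℕ) : Prog → Bool
  | .skip => true
  | .assign y _ => decide (x ≠ y)
  | .store _ _ _ => true
  | .seq p q => p.noReg x && q.noReg x
  | .branch _ p q => p.noReg x && q.noReg x
  | .loop _ p => p.noReg x

/-- The program does not store into array `a`. -/
def Prog.noArr (a : ℕ) : Prog → Bool
  | .skip => true
  | .assign _ _ => true
  | .store b _ _ => decide (a ≠ b)
  | .seq p q => p.noArr a && q.noArr a
  | .branch _ p q => p.noArr a && q.noArr a
  | .loop _ p => p.noArr a

theorem Exec.reg_eq {W : ℕ} {P : Prog} {s s' : State} {t : ℕ} (h : Exec W P s s' t) {x : ℕ}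
    (hx : P.noReg x = true) : s'.reg x = s.reg x := by
  induction h with
  | skip => rfl
  | assign s y e he =>
    simp only [Prog.noReg, decide_eq_true_eq] at hx
    simp [hx]
  | store => rfl
  | seq _ _ ihp ihq =>
    simp only [Prog.noReg, Bool.and_eq_true] at hx
    rw [ihq hx.2, ihp hx.1]
  | branch_true _ _ _ ih => simp only [Prog.noReg, Bool.and_eq_true] at hx; exact ih hx.1
  | branch_false _ _ _ ih => simp only [Prog.noReg, Bool.and_eq_true] at hx; exact ih hx.2
  | loop_false => rfl
  | loop_true _ _ _ _ ihp ihl => rw [ihl hx, ihp hx]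

theorem Exec.arr_eq {W : ℕ} {P : Prog} {s s' : State} {t : ℕ} (h : Exec W P s s' t) {a : ℕ}
    (ha : P.noArr a = true) : s'.arr a = s.arr a := by
  induction h with
  | skip => rfl
  | assign => rfl
  | store s b i e hi he =>
    simp only [Prog.noArr, decide_eq_true_eq] at ha
    simp [ha]
  | seq _ _ ihp ihq =>
    simp only [Prog.noArr, Bool.and_eq_true] at ha
    rw [ihq ha.2, ihp ha.1]
  | branch_true _ _ _ ih => simp only [Prog.noArr, Bool.and_eq_true] at ha; exact ih ha.1
  | branch_false _ _ _ ih => simp only [Prog.noArr, Bool.and_eq_true] at ha; exact ih ha.2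
  | loop_false => rfl
  | loop_true _ _ _ _ ihp ihl => rw [ihl ha, ihp ha]

theorem Runs.reg_eq {W M : ℕ} {P : Prog} {s s' : State} {T : ℕ} (h : Runs W M P s s' T) {x : ℕ}
    (hx : P.noReg x = true) : s'.reg x = s.reg x := by
  obtain ⟨_, _, h, _⟩ := h
  exact h.reg_eq hx

theorem Runs.arr_eq {W M : ℕ} {P : Prog} {s s' : State} {T : ℕ} (h : Runs W M P s s' T) {a : ℕ}
    (ha : P.noArr a = true) : s'.arr a = s.arr a := by
  obtain ⟨_, _, h, _⟩ := h
  exact h.arr_eq ha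

/-- `Frame P s s'`: the states agree on everything that `P` does not write. -/
def Frame (P : Prog) (s s' : State) : Prop :=
  (∀ x, P.noReg x = true → s'.reg x = s.reg x) ∧ ∀ a, P.noArr a = true → s'.arr a = s.arr a

/-- Loop rule: an invariant `I` and a measure `μ` that every round decreases. The body may itself
contain loops; `c` bounds the time of one round. -/
theorem Runs.loop_of_body {W M : ℕ} (hM : 1 ≤ M) (hW : 20 * M < W) {b : Expr} {P : Prog}
    (hb : b.ok = true) (I : State → Prop) (μ : State → ℕ) (c : ℕ) {s₀ : State}
    (step : ∀ s, Bdd M s → Frame P s₀ s → I s → b.eval s ≠ 0 →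
      ∃ s', Runs W M P s s' c ∧ I s' ∧ μ s' < μ s)
    (hs : Bdd M s₀) (hI : I s₀) :
    ∃ s', Runs W M (.loop b P) s₀ s' ((c + b.cost + 1) * (μ s₀ + 1)) ∧ I s' ∧ b.eval s' = 0 := by
  suffices H : ∀ k s, μ s ≤ k → Bdd M s → Frame P s₀ s → I s →
      ∃ s', Runs W M (.loop b P) s s' ((c + b.cost + 1) * (k + 1)) ∧ I s' ∧ b.eval s' = 0 from
    H _ s₀ le_rfl hs ⟨fun _ _ => rfl, fun _ _ => rfl⟩ hI
  intro k
  induction k with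
  | zero =>
    intro s hμ hs hf hI
    by_cases hbs : b.eval s = 0
    · exact ⟨s, ⟨_, by omega, .loop_false (b.fits_of_ok hM hW hs hb) hbs, hs⟩, hI, hbs⟩
    · obtain ⟨s', _, _, h⟩ := step s hs hf hI hbs
      omega
  | succ k ih =>
    intro s hμ hs hf hI
    by_cases hbs : b.eval s = 0
    · exact ⟨s, ⟨b.cost + 1, by nlinarith, .loop_false (b.fits_of_ok hM hW hs hb) hbs, hs⟩, hI, hbs⟩
    · obtain ⟨s₁, hr, hI₁, h⟩ := step s hs hf hI hbs
      have hf₁ : Frame P s₀ s₁ :=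
        ⟨fun x hx => (hr.reg_eq hx).trans (hf.1 x hx), fun a ha => (hr.arr_eq ha).trans (hf.2 a ha)⟩
      obtain ⟨s₂, ⟨t₂, ht₂, e₂, hs₂⟩, hI₂, hb₂⟩ := ih s₁ (by omega) hr.bdd hf₁ hI₁
      obtain ⟨t₁, ht₁, e₁, hs₁⟩ := hr
      refine ⟨s₂, ⟨b.cost + 1 + t₁ + t₂, ?_, .loop_true (b.fits_of_ok hM hW hs hb) hbs e₁ e₂, hs₂⟩,
        hI₂, hb₂⟩
      nlinarith

/-- Loop rule for a body without loops. -/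
theorem Runs.loop {W M : ℕ} (hM : 1 ≤ M) (hW : 20 * M < W) {b : Expr} {P : Prog}
    (hok : (Prog.loop b P).ok = true) (I : State → Prop) (μ : State → ℕ) {s₀ : State}
    (step : ∀ s, Bdd M s → Frame P s₀ s → I s → b.eval s ≠ 0 →
      P.Safe M s ∧ I (P.run s) ∧ μ (P.run s) < μ s)
    (hs : Bdd M s₀) (hI : I s₀) :
    ∃ s', Runs W M (.loop b P) s₀ s' ((P.time + b.cost + 1) * (μ s₀ + 1))
      ∧ I s' ∧ b.eval s' = 0 := by
  simp only [Prog.ok, Bool.and_eq_true] at hok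
  refine Runs.loop_of_body hM hW hok.1 I μ P.time (fun s hs hf hI hbs => ?_) hs hI
  obtain ⟨h₁, h₂, h₃⟩ := step s hs hf hI hbs
  exact ⟨_, Runs.of_safe hM hW P hok.2 hs h₁, h₂, h₃⟩

/-- The program "for `x = 0, 1, …, y - 1` do `P`", where `x` and `y` are registers. -/
def Prog.for (x y : ℕ) (P : Prog) : Prog :=
  .seq (.assign x (.const 0))
    (.loop (.lt (.reg x) (.reg y)) (.seq P (.assign x (.add (.reg x) (.const 1)))))

/-- Rule for counting loops: `I k` is the invariant after `k` rounds. -/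
theorem Runs.for {W M : ℕ} (hM : 1 ≤ M) (hW : 20 * M < W) (x y : ℕ) {P : Prog}
    (hok : P.ok = true) (hxy : y ≠ x) (hx : P.noReg x = true) (hy : P.noReg y = true)
    (I : ℕ → State → Prop) {s₀ : State} {N : ℕ} (hN : s₀.reg y = N)
    (step : ∀ k < N, ∀ s, Bdd M s → Frame (P.for x y) s₀ s → s.reg x = k → I k s →
      P.Safe M s ∧ I (k + 1) ((P.run s).setReg x (k + 1)))
    (hs : Bdd M s₀) (hI : I 0 (s₀.setReg x 0)) :
    ∃ s', Runs W M (P.for x y) s₀ s' ((P.time + 10) * (N + 1)) ∧ I N s' := by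
  subst hN
  have key := Runs.loop (W := W) (M := M) (s₀ := s₀.setReg x 0) (b := .lt (.reg x) (.reg y))
    (P := .seq P (.assign x (.add (.reg x) (.const 1)))) hM hW
    (by simpa [Prog.ok, Expr.ok, Expr.small, Expr.cost] using hok)
    (fun s => s.reg x ≤ s₀.reg y ∧ I (s.reg x) s) (fun s => s₀.reg y - s.reg x) ?_
    (hs.setReg x (Nat.zero_le _)) ?_
  · obtain ⟨s', h, ⟨h₁, h₂⟩, h₃⟩ := key
    have hy' : s'.reg y = s₀.reg y := by
      have := h.reg_eq (x := y) (by simp [Prog.noReg, hy, hxy])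
      simpa [hxy] using this
    have hx' : s'.reg x = s₀.reg y := by
      simp only [Expr.eval, hy'] at h₃
      split_ifs at h₃
      omega
    refine ⟨s', ?_, hx' ▸ h₂⟩
    have h0 : Runs W M (.assign x (.const 0)) s₀ (s₀.setReg x 0) 2 :=
      ⟨2, le_rfl, .assign s₀ x (.const 0) ((Expr.const 0).fits_of_ok hM hW hs rfl),
        hs.setReg x (Nat.zero_le _)⟩
    refine (h0.seq h).mono ?_
    simp only [Prog.time, Expr.cost, State.setReg_reg, if_true, Nat.sub_zero]
    ring_nf
    nlinarith
  · rintro s hsb ⟨hf₁, hf₂⟩ ⟨hle, hIs⟩ hbs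
    have hy' : s.reg y = s₀.reg y := by
      have := hf₁ y (by simp [Prog.noReg, hy, hxy])
      simpa [hxy] using this
    have hlt : s.reg x < s₀.reg y := by
      simp only [Expr.eval, hy'] at hbs
      by_contra h
      exact hbs (if_neg h)
    have hfr : Frame (P.for x y) s₀ s := by
      refine ⟨fun z hz => ?_, fun a ha => ?_⟩
      · simp only [Prog.for, Prog.noReg, Bool.and_eq_true, decide_eq_true_eq] at hz
        have := hf₁ z (by simp [Prog.noReg, hz])
        simpa [hz.1] using this
      · simp only [Prog.for, Prog.noArr, Bool.and_eq_true] at ha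
        have := hf₂ a (by simp [Prog.noArr, ha])
        simpa using this
    obtain ⟨h₁, h₂⟩ := step _ hlt s hsb hfr rfl hIs
    have hrx : (P.run s).reg x = s.reg x := (Runs.of_safe hM hW P hok hsb h₁).reg_eq hx
    refine ⟨⟨h₁, ?_⟩, ?_, ?_⟩
    · simp only [Prog.Safe, Expr.eval, hrx]
      have := hs.1 y
      omega
    · simp only [Prog.run, Expr.eval, hrx, State.setReg_reg, if_true]
      exact ⟨hlt, h₂⟩
    · simp only [Prog.run, Expr.eval, hrx, State.setReg_reg, if_true]
      omega
  · simpa using hI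

end RAM

/-! ### Cutting the links of a depth-first tree -/

namespace MaxCut

/-- `Anc pp a b`: in the forest in which `b` has the parent `p` if `pp b = p + 1`, and is a root if
`pp b = 0`, the vertex `a` is an ancestor of `b` or equal to `b`. -/
inductive Anc (pp : ℕ → ℕ) : ℕ → ℕ → Prop
  | refl (a : ℕ) : Anc pp a a
  | step {a p b : ℕ} (h : Anc pp a p) (hb : pp b = p + 1) : Anc pp a b

theorem Anc.le {pp : ℕ → ℕ} {n a b : ℕ} (hpp : ∀ k < n, pp k ≤ k) (h : Anc pp a b) (hb : b < n) :
    a ≤ b := by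
  induction h with
  | refl => exact le_rfl
  | step _ h ih => have := hpp _ hb; have := ih (by omega); omega

theorem Anc.trans {pp : ℕ → ℕ} {a b c : ℕ} (h : Anc pp a b) (h' : Anc pp b c) : Anc pp a c := by
  induction h' with
  | refl => exact h
  | step _ hb ih => exact .step ih hb

theorem Anc.mono {pp qq : ℕ → ℕ} {a b : ℕ} (h : Anc pp a b)
    (hpq : ∀ k, pp k ≠ 0 → qq k = pp k) : Anc qq a b := by
  induction h with
  | refl => exact .refl _
  | step _ hb ih => exact .step ih (by rw [hpq _ (by omega), hb])

/-- The ancestors of a vertex form a chain. -/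
theorem Anc.parent_of_lt {pp : ℕ → ℕ} {n a k v : ℕ} (hpp : ∀ k < n, pp k ≤ k) (hv : v < n)
    (ha : Anc pp a v) (hk : Anc pp k v) (hak : a < k) : ∃ p, pp k = p + 1 ∧ Anc pp a p := by
  induction hk with
  | refl =>
    cases ha with
    | refl => omega
    | step h hb => exact ⟨_, hb, h⟩
  | step hk' hb ih =>
    have hle := hpp _ hv
    cases ha with
    | refl => have := hk'.le hpp (by omega); omega
    | step h hb' =>
      obtain rfl : _ = _ := Nat.succ.inj (hb.symm.trans hb')
      exact ih (by omega) h

/-- The data of the decomposition of a signed multigraph along a depth-first forest. The vertices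
`0, …, n - 1` are numbered in preorder, `pp` encodes the parents as in `Anc`. Edge `i < m` has the
lower end `el i` and the upper end `eu i`, an ancestor of `el i`. A colouring `c` satisfies edge `i`
if `c (el i) + c (eu i) + z i` is even; `tau` satisfies all tree edges. The link from `k` to its
parent is cut if `cp k = 0` and `pp k ≠ 0`, and `top k` is the highest vertex of the component of
`k` that remains. The entry `hi k` is `0` or one more than the deepest upper end of a violated edge
whose lower end is in the part of that component below `k`. -/
structure CutForest (n m : ℕ) (el eu z pp tau hi cp top : ℕ → ℕ) : Prop where
  el_lt : ∀ i < m, el i < n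
  anc : ∀ i < m, Anc pp (eu i) (el i)
  pp_le : ∀ k < n, pp k ≤ k
  tree : ∀ k < n, pp k ≠ 0 →
    ∃ i < m, el i = k ∧ eu i + 1 = pp k ∧ (tau k + tau (eu i) + z i) % 2 = 0
  hi_edge : ∀ i < m, eu i < el i → (tau (el i) + tau (eu i) + z i) % 2 ≠ 0 → eu i + 1 ≤ hi (el i)
  cp_ne : ∀ k < n, cp k ≠ 0 → cp k = pp k ∧ hi k < pp k ∧ hi k ≤ hi (pp k - 1)
  cp_zero : ∀ k < n, cp k = 0 → pp k = 0 ∨ pp k ≤ hi k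
  wit : ∀ k < n, hi k ≠ 0 → ∃ i < m, eu i < el i ∧ (tau (el i) + tau (eu i) + z i) % 2 ≠ 0 ∧
    eu i + 1 = hi k ∧ Anc cp k (el i)
  top_eq : ∀ k < n, top k = if cp k = 0 then k else top (cp k - 1)

/-- The edges with lower end in the component with top `J` that leave it, and that are satisfied
(`r = 0`) or violated (`r = 1`) if the component keeps the colouring `tau` while the upper end is
coloured by `col`. -/
def crossing (m : ℕ) (el eu z tau top col : ℕ → ℕ) (J r : ℕ) : Finset ℕ :=
  (Finset.range m).filter fun i =>
    top (el i) = J ∧ top (eu i) ≠ J ∧ (tau (el i) + col (eu i) + z i) % 2 = r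

namespace CutForest

variable {n m : ℕ} {el eu z pp tau hi cp top : ℕ → ℕ}

theorem cp_le (h : CutForest n m el eu z pp tau hi cp top) {k : ℕ} (hk : k < n) : cp k ≤ k := by
  by_cases h0 : cp k = 0
  · omega
  · rw [(h.cp_ne k hk h0).1]; exact h.pp_le k hk

theorem top_spec (h : CutForest n m el eu z pp tau hi cp top) {k : ℕ} (hk : k < n) :
    top k ≤ k ∧ cp (top k) = 0 ∧ top (top k) = top k := by
  induction k using Nat.strong_induction_on with
  | _ k ih =>
    have := h.cp_le hk
    rw [h.top_eq k hk]
    split_ifs with h0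
    · exact ⟨le_rfl, h0, by rw [h.top_eq k hk, if_pos h0]⟩
    · obtain ⟨h1, h2, h3⟩ := ih (cp k - 1) (by omega) (by omega)
      exact ⟨by omega, h2, h3⟩

theorem top_eq_of_anc (h : CutForest n m el eu z pp tau hi cp top) {a v : ℕ} (ha : Anc cp a v)
    (hv : v < n) : top v = top a := by
  induction ha with
  | refl => rfl
  | step _ hb ih =>
    have := h.cp_le hv
    rw [h.top_eq _ hv, if_neg (by omega), hb, Nat.add_sub_cancel, ih (by omega)]

theorem lt_top (h : CutForest n m el eu z pp tau hi cp top) {a v : ℕ} (ha : Anc pp a v)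
    (hv : v < n) (hne : top a ≠ top v) : a < top v := by
  induction ha with
  | refl => exact absurd rfl hne
  | @step p v ha' hb ih =>
    have hle := h.pp_le v hv
    by_cases h0 : cp v = 0
    · have htv : top v = v := by rw [h.top_eq _ hv, if_pos h0]
      have := ha'.le h.pp_le (by omega : p < n)
      omega
    · have htv : top v = top p := by
        rw [h.top_eq _ hv, if_neg h0, (h.cp_ne v hv h0).1, hb, Nat.add_sub_cancel]
      rw [htv] at hne ⊢
      exact ih (by omega) hne

/-- Every violated edge leaves its component: some link on the tree path between its ends is cut. -/
theorem lt_top_of_violated (h : CutForest n m el eu z pp tau hi cp top) {i : ℕ} (hi' : i < m)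
    (hlt : eu i < el i) (hbad : (tau (el i) + tau (eu i) + z i) % 2 ≠ 0) : eu i < top (el i) := by
  suffices H : ∀ {a v}, Anc pp a v → v < n → a < v → a + 1 ≤ hi v → a < top v from
    H (h.anc i hi') (h.el_lt i hi') hlt (h.hi_edge i hi' hlt hbad)
  intro a v ha hv hav hhi
  induction ha with
  | refl => omega
  | @step p v ha' hb ih =>
    have hle := h.pp_le v hv
    by_cases h0 : cp v = 0
    · rw [h.top_eq _ hv, if_pos h0]; exact hav
    · obtain ⟨h1, h2, h3⟩ := h.cp_ne v hv h0
      rw [h.top_eq _ hv, if_neg h0, h1]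
      rw [hb, Nat.add_sub_cancel] at h3
      rw [hb, Nat.add_sub_cancel]
      exact ih (by omega) (by omega) (by omega)

theorem satisfied_of_top_eq (h : CutForest n m el eu z pp tau hi cp top) {i : ℕ} (hi' : i < m)
    (hlt : eu i < el i) (ht : top (eu i) = top (el i)) :
    (tau (el i) + tau (eu i) + z i) % 2 = 0 := by
  by_contra hbad
  have h1 := h.lt_top_of_violated hi' hlt hbad
  have h2 := h.top_spec (k := eu i) (by have := h.el_lt i hi'; omega)
  omega

/-- The link above `k` is cut only if a violated edge leads from the component of `k` to the parent
of `k`. -/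
theorem exists_trigger (h : CutForest n m el eu z pp tau hi cp top) {k : ℕ} (hk : k < n)
    (hc : cp k = 0) (hp : pp k ≠ 0) : ∃ i < m, eu i < el i ∧
      (tau (el i) + tau (eu i) + z i) % 2 ≠ 0 ∧ top (el i) = k ∧ eu i + 1 = pp k := by
  have hle := h.pp_le k hk
  have hhi := (h.cp_zero k hk hc).resolve_left hp
  obtain ⟨i, him, hlt, hbad, hih, hanc⟩ := h.wit k hk (by omega)
  have hel := h.el_lt i him
  have htop : top (el i) = k := by
    rw [h.top_eq_of_anc hanc hel, h.top_eq k hk, if_pos hc]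
  refine ⟨i, him, hlt, hbad, htop, ?_⟩
  have h1 := h.lt_top_of_violated him hlt hbad
  have hanc' : Anc pp k (el i) := by
    clear hih hbad hlt h1 htop
    generalize el i = v at hanc hel
    induction hanc with
    | refl => exact .refl _
    | @step p v _ hb ih =>
      have := h.cp_le hel
      exact .step (ih (by omega)) (by rw [← (h.cp_ne v hel (by omega)).1, hb])
  obtain ⟨p, hp', ha⟩ := Anc.parent_of_lt h.pp_le hel (h.anc i him) hanc' (by omega)
  have := ha.le h.pp_le (by omega : p < n)
  omega

/-- The component below a cut link, together with that link, carries an edge that is violated by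
`κ`: the triggering edge closes an odd cycle. -/
theorem exists_violated (h : CutForest n m el eu z pp tau hi cp top) (κ : ℕ → ℕ)
    {k : ℕ} (hk : k < n)
    (hc : cp k = 0) (hp : pp k ≠ 0) : ∃ i < m, eu i < el i ∧
      (κ (el i) + κ (eu i) + z i) % 2 ≠ 0 ∧ top (el i) = k := by
  by_contra hcon
  push Not at hcon
  have hgood : ∀ i < m, eu i < el i → top (el i) = k → (κ (el i) + κ (eu i) + z i) % 2 = 0 := by
    intro i hi' hlt ht
    by_contra hb
    exact hcon i hi' hlt hb ht
  have hconst : ∀ v < n, top v = k → (κ v + tau v + κ (pp k - 1) + tau (pp k - 1)) % 2 = 0 := by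
    intro v
    induction v using Nat.strong_induction_on with
    | _ v ih =>
      intro hv ht
      have hle := h.pp_le v hv
      have ht' := h.top_eq v hv
      by_cases h0 : cp v = 0
      · rw [if_pos h0] at ht'
        obtain rfl : v = k := by omega
        obtain ⟨i, hi', he, hu, hs⟩ := h.tree v hv hp
        have := hgood i hi' (by omega) (by rw [he]; exact ht)
        rw [he] at this
        have hu' : eu i = pp v - 1 := by omega
        rw [hu'] at this hs
        omega
      · obtain ⟨h1, -, -⟩ := h.cp_ne v hv h0
        rw [if_neg h0, h1] at ht'
        obtain ⟨i, hi', he, hu, hs⟩ := h.tree v hv (by omega)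
        have := hgood i hi' (by omega) (by rw [he]; exact ht)
        rw [he] at this
        have hu' : eu i = pp v - 1 := by omega
        rw [hu'] at this hs
        have := ih (pp v - 1) (by omega) (by omega) (by omega)
        omega
  obtain ⟨i, hi', hlt, hbad, htop, hu⟩ := h.exists_trigger hk hc hp
  have h1 := hgood i hi' hlt htop
  have h2 := hconst _ (h.el_lt i hi') htop
  have hu' : eu i = pp k - 1 := by omega
  rw [hu'] at h1 hbad
  omega

/-- Every colouring violates at least as many edges as there are cut links. -/
theorem card_cut_le (h : CutForest n m el eu z pp tau hi cp top) (κ : ℕ → ℕ) :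
    ((Finset.range n).filter fun k => cp k = 0 ∧ pp k ≠ 0).card ≤
      ((Finset.range m).filter fun i => eu i < el i ∧ (κ (el i) + κ (eu i) + z i) % 2 ≠ 0).card := by
  refine le_trans (Finset.card_le_card (t := Finset.image (fun i => top (el i)) _) ?_)
    Finset.card_image_le
  intro k hk
  simp only [Finset.mem_filter, Finset.mem_range, Finset.mem_image] at hk ⊢
  obtain ⟨i, h1, h2, h3, h4⟩ := h.exists_violated κ hk.1 hk.2.1 hk.2.2
  exact ⟨i, ⟨h1, h2, h3⟩, h4⟩

/-- If every component is flipped according to the majority of its upward edges, then the number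
of satisfied edges exceeds the number of violated edges by at least the number of uncut links. -/
theorem card_uncut_le_sum (h : CutForest n m el eu z pp tau hi cp top) (col phi : ℕ → ℕ)
    (hcol : ∀ k < n, (col k + tau k + phi (top k)) % 2 = 0)
    (hphi : ∀ k < n, phi k = if (crossing m el eu z tau top col k 0).card <
      (crossing m el eu z tau top col k 1).card then 1 else 0) :
    (((Finset.range n).filter fun k => cp k ≠ 0).card : ℤ) ≤
      ∑ i ∈ (Finset.range m).filter fun i => eu i < el i,
        if (col (el i) + col (eu i) + z i) % 2 = 0 then (1 : ℤ) else -1 := by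
  classical
  have hanc_le : ∀ i < m, eu i ≤ el i := fun i hi' => (h.anc i hi').le h.pp_le (h.el_lt i hi')
  set f : ℕ → ℤ := fun i => if (col (el i) + col (eu i) + z i) % 2 = 0 then (1 : ℤ) else -1 with hf
  rw [← Finset.sum_filter_add_sum_filter_not ((Finset.range m).filter fun i => eu i < el i)
    (fun i => top (eu i) = top (el i)) f]
  have h1 : (((Finset.range n).filter fun k => cp k ≠ 0).card : ℤ) ≤
      ∑ i ∈ ((Finset.range m).filter fun i => eu i < el i).filter
        (fun i => top (eu i) = top (el i)), f i := by
    have hone : ∀ i ∈ ((Finset.range m).filter fun i => eu i < el i).filter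
        (fun i => top (eu i) = top (el i)), f i = 1 := by
      intro i hi'
      simp only [Finset.mem_filter, Finset.mem_range] at hi'
      obtain ⟨⟨him, hlt⟩, ht⟩ := hi'
      have h1 := h.satisfied_of_top_eq him hlt ht
      have h2 := hcol (el i) (h.el_lt i him)
      have h3 := hcol (eu i) (by have := h.el_lt i him; omega)
      rw [ht] at h3
      simp only [hf]
      rw [if_pos (by omega)]
    rw [Finset.sum_congr rfl hone, Finset.sum_const, nsmul_eq_mul, mul_one]
    norm_cast
    refine le_trans (Finset.card_le_card (t := Finset.image el _) ?_) Finset.card_image_le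
    intro k hk
    simp only [Finset.mem_filter, Finset.mem_range, Finset.mem_image] at hk ⊢
    obtain ⟨hk, h0⟩ := hk
    obtain ⟨hcp, -, -⟩ := h.cp_ne k hk h0
    have hle := h.pp_le k hk
    obtain ⟨i, him, he, hu, -⟩ := h.tree k hk (by omega)
    refine ⟨i, ⟨⟨him, by omega⟩, ?_⟩, he⟩
    rw [he, h.top_eq k hk, if_neg h0, hcp, ← hu, Nat.add_sub_cancel]
  have h2 : 0 ≤ ∑ i ∈ ((Finset.range m).filter fun i => eu i < el i).filter
        (fun i => ¬ top (eu i) = top (el i)), f i := by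
    rw [← Finset.sum_fiberwise_of_maps_to (t := Finset.range n) (g := fun i => top (el i))]
    · refine Finset.sum_nonneg fun J hJ => ?_
      rw [Finset.mem_range] at hJ
      set A := crossing m el eu z tau top col J 0 with hA
      set B := crossing m el eu z tau top col J 1 with hB
      have hAB : Disjoint A B := by
        rw [Finset.disjoint_left]
        intro i h1 h2
        simp only [hA, hB, crossing, Finset.mem_filter] at h1 h2
        omega
      have hset : (((Finset.range m).filter fun i => eu i < el i).filter
          (fun i => ¬ top (eu i) = top (el i))).filter (fun i => top (el i) = J) = A ∪ B := by
        ext i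
        simp only [hA, hB, crossing, Finset.mem_filter, Finset.mem_union, Finset.mem_range]
        constructor
        · rintro ⟨⟨⟨him, hlt⟩, hne⟩, rfl⟩
          rcases Nat.mod_two_eq_zero_or_one (tau (el i) + col (eu i) + z i) with h0 | h0
          · exact .inl ⟨him, rfl, hne, h0⟩
          · exact .inr ⟨him, rfl, hne, h0⟩
        · rintro (⟨him, rfl, hne, h0⟩ | ⟨him, rfl, hne, h0⟩)
          all_goals
            refine ⟨⟨⟨him, lt_of_le_of_ne (hanc_le i him) ?_⟩, hne⟩, rfl⟩
            intro he
            exact hne (by rw [he])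
      rw [hset, Finset.sum_union hAB]
      have hval : ∀ i, i ∈ A ∨ i ∈ B → f i = if (tau (el i) + phi J + col (eu i) + z i) % 2 = 0
          then 1 else -1 := by
        intro i hi'
        have him : i < m ∧ top (el i) = J := by
          rcases hi' with hi' | hi' <;>
          · simp only [hA, hB, crossing, Finset.mem_filter, Finset.mem_range] at hi'
            exact ⟨hi'.1, hi'.2.1⟩
        have h2 := hcol (el i) (h.el_lt i him.1)
        rw [him.2] at h2
        simp only [hf]
        congr 1
        simp only [eq_iff_iff]
        omega
      have hφ := hphi J hJ
      rw [← hA, ← hB] at hφ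
      have hsA : ∑ i ∈ A, f i = if phi J = 0 then (A.card : ℤ) else -A.card := by
        rw [Finset.sum_congr rfl (g := fun _ => if phi J = 0 then (1 : ℤ) else -1)]
        · split_ifs <;> simp
        · intro i hi'
          rw [hval i (.inl hi')]
          simp only [hA, crossing, Finset.mem_filter] at hi'
          congr 1
          simp only [eq_iff_iff]
          split_ifs at hφ <;> omega
      have hsB : ∑ i ∈ B, f i = if phi J = 0 then -(B.card : ℤ) else B.card := by
        rw [Finset.sum_congr rfl (g := fun _ => if phi J = 0 then (-1 : ℤ) else 1)]
        · split_ifs <;> simp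
        · intro i hi'
          rw [hval i (.inr hi')]
          simp only [hB, crossing, Finset.mem_filter] at hi'
          split_ifs at hφ <;> split_ifs <;> omega
      rw [hsA, hsB]
      split_ifs at hφ <;> rw [hφ] <;> simp <;> omega
    · intro i hi'
      simp only [Finset.mem_filter, Finset.mem_range] at hi' ⊢
      have h1 := h.el_lt i hi'.1.1
      have h2 := (h.top_spec h1).1
      omega
  linarith

/-- The surplus of satisfied over violated edges, loops excluded, compared with the number of edges
that an arbitrary colouring `κ` violates. -/
theorem card_nonroot_le (h : CutForest n m el eu z pp tau hi cp top) (col phi κ : ℕ → ℕ)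
    (hcol : ∀ k < n, (col k + tau k + phi (top k)) % 2 = 0)
    (hphi : ∀ k < n, phi k = if (crossing m el eu z tau top col k 0).card <
      (crossing m el eu z tau top col k 1).card then 1 else 0) :
    (((Finset.range n).filter fun k => pp k ≠ 0).card : ℤ) ≤
      (∑ i ∈ (Finset.range m).filter fun i => eu i < el i,
        if (col (el i) + col (eu i) + z i) % 2 = 0 then (1 : ℤ) else -1) +
      ((Finset.range m).filter fun i => eu i < el i ∧ (κ (el i) + κ (eu i) + z i) % 2 ≠ 0).card := by
  have h1 := h.card_uncut_le_sum col phi hcol hphi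
  have h2 := h.card_cut_le κ
  have h3 : ((Finset.range n).filter fun k => pp k ≠ 0).card =
      ((Finset.range n).filter fun k => cp k ≠ 0).card +
      ((Finset.range n).filter fun k => cp k = 0 ∧ pp k ≠ 0).card := by
    rw [← Finset.card_union_of_disjoint]
    · congr 1
      ext k
      simp only [Finset.mem_filter, Finset.mem_union, Finset.mem_range]
      constructor
      · tauto
      · rintro (⟨hk, h0⟩ | h0)
        · exact ⟨hk, by rw [← (h.cp_ne k hk h0).1]; exact h0⟩
        · tauto
    · rw [Finset.disjoint_left]
      intro k h1 h2
      simp only [Finset.mem_filter] at h1 h2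
      tauto
  rw [h3]
  push_cast
  have h2' : (((Finset.range n).filter fun k => cp k = 0 ∧ pp k ≠ 0).card : ℤ) ≤
    ((Finset.range m).filter fun i => eu i < el i ∧ (κ (el i) + κ (eu i) + z i) % 2 ≠ 0).card := by
    exact_mod_cast h2
  linarith

end CutForest

end MaxCut

/-! ### Depth-first search -/

namespace MaxCut

/-- `IsLast key b k q`: `q` is one more than the largest `i < b` with `key i = k`, or `0` if there
is no such `i`. This describes the pointers of linked lists with `0` as the null pointer. -/
def IsLast (key : ℕ → ℕ) (b k q : ℕ) : Prop :=
  q ≤ b ∧ (q = 0 ∨ key (q - 1) = k) ∧ ∀ i < b, key i = k → i < q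

/-- Linked lists, one for each `k < n`, of the numbers `i < c` with `key i = k`, in decreasing
order. The list of `k` starts with the pointer `head k`, and `nxt (i + 1)` is the pointer that
follows the pointer `i + 1` to `i`. -/
structure Buckets (n c : ℕ) (key head nxt : ℕ → ℕ) : Prop where
  head_last : ∀ k < n, IsLast key c k (head k)
  nxt_last : ∀ i < c, IsLast key i (key i) (nxt (i + 1))

theorem Anc.congr {pp qq : ℕ → ℕ} {n a b : ℕ} (h : Anc pp a b) (hpp : ∀ k < n, pp k ≤ k)
    (hpq : ∀ k < n, qq k = pp k) (hb : b < n) : Anc qq a b := by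
  induction h with
  | refl => exact .refl _
  | step _ hb' ih =>
    have := hpp _ hb
    exact .step (ih (by omega)) (by rw [hpq _ hb, hb'])

/-- The result of a depth-first search of the graph with vertices `0, …, n - 1` and arcs `src q →
tgt q` for `q < c`, with signs `z q`. The vertex `v` has the preorder number `pre v - 1`, and
`ord` is the inverse numbering. The entries of `pp` (parents, encoded as in `Anc`), of `tau` (a
colouring that satisfies the tree arcs) and of `rt` (roots) refer to preorder numbers. -/
structure IsDfs (n c : ℕ) (src tgt z pre ord pp tau rt : ℕ → ℕ) : Prop where
  ord_lt : ∀ k < n, ord k < n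
  pre_ord : ∀ k < n, pre (ord k) = k + 1
  pre_le : ∀ v < n, pre v ≤ n
  pre_ne : ∀ v < n, pre v ≠ 0
  ord_pre : ∀ v < n, ord (pre v - 1) = v
  pp_le : ∀ k < n, pp k ≤ k
  tau_le : ∀ k < n, tau k ≤ 1
  rt_le : ∀ k < n, rt k ≤ k
  root : ∀ k < n, pp k = 0 → rt k = k
  tree : ∀ k < n, pp k ≠ 0 → rt k = rt (pp k - 1) ∧
    ∃ q < c, src q = ord (pp k - 1) ∧ tgt q = ord k ∧ (tau k + tau (pp k - 1) + z q) % 2 = 0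
  comparable : ∀ q < c, Anc pp (pre (src q) - 1) (pre (tgt q) - 1) ∨
    Anc pp (pre (tgt q) - 1) (pre (src q) - 1)

/-- The invariant of depth-first search. So far `cnt` vertices have been visited, `cur` is one more
than the preorder number of the current vertex (`0` if there is none), `ptr v` points to the first
arc out of `v` that has not been explored, and all vertices below `rc` have been visited. -/
structure DfsInv (n c : ℕ) (src tgt z ptr pre ord pp tau rt : ℕ → ℕ) (rc cur cnt : ℕ) : Prop where
  cnt_le : cnt ≤ n
  cur_le : cur ≤ cnt
  rc_le : rc ≤ n
  ord_lt : ∀ k < cnt, ord k < n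
  pre_ord : ∀ k < cnt, pre (ord k) = k + 1
  pre_le : ∀ v < n, pre v ≤ cnt
  ord_pre : ∀ v < n, pre v ≠ 0 → ord (pre v - 1) = v
  pp_le : ∀ k < cnt, pp k ≤ k
  tau_le : ∀ k < cnt, tau k ≤ 1
  rt_le : ∀ k < cnt, rt k ≤ k
  root : ∀ k < cnt, pp k = 0 → rt k = k
  tree : ∀ k < cnt, pp k ≠ 0 → rt k = rt (pp k - 1) ∧
    ∃ q < c, src q = ord (pp k - 1) ∧ tgt q = ord k ∧ (tau k + tau (pp k - 1) + z q) % 2 = 0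
  ptr_last : ∀ v < n, ptr v ≤ c ∧ (ptr v = 0 ∨ src (ptr v - 1) = v)
  fresh : ∀ q < c, pre (src q) = 0 → q < ptr (src q)
  explored : ∀ q < c, ptr (src q) ≤ q → pre (tgt q) ≠ 0
  active : ∀ k < cnt, ptr (ord k) = 0 ∨ cur ≠ 0 ∧ Anc pp k (cur - 1)
  comparable : ∀ q < c, pre (src q) ≠ 0 → pre (tgt q) ≠ 0 →
    Anc pp (pre (src q) - 1) (pre (tgt q) - 1) ∨ Anc pp (pre (tgt q) - 1) (pre (src q) - 1)
  visited : ∀ v < rc, pre v ≠ 0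

open Classical in
/-- The potential that every step of depth-first search decreases: the number of unexplored arcs,
twice the number of unvisited vertices, the length of the path from the root to the current vertex,
and the number of vertices that have not been tried as roots. -/
noncomputable def dfsPotential (n c : ℕ) (src ptr pp : ℕ → ℕ) (rc cur cnt : ℕ) : ℕ :=
  ((Finset.range c).filter fun q => q < ptr (src q)).card + 2 * (n - cnt) +
    ((Finset.range n).filter fun a => cur ≠ 0 ∧ Anc pp a (cur - 1)).card + (n - rc)

theorem dfsPotential_le (n c : ℕ) (src ptr pp : ℕ → ℕ) (rc cur cnt : ℕ) :
    dfsPotential n c src ptr pp rc cur cnt ≤ c + 2 * n + n + n := by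
  classical
  exact Nat.add_le_add (Nat.add_le_add (Nat.add_le_add
    ((Finset.card_filter_le _ _).trans_eq (Finset.card_range _)) (by omega))
    ((Finset.card_filter_le _ _).trans_eq (Finset.card_range _))) (by omega)

namespace DfsInv

variable {n c : ℕ} {src tgt z ptr pre ord pp tau rt nxt : ℕ → ℕ} {rc cur cnt : ℕ}

theorem init (hsrc : ∀ q < c, src q < n) (hptr : ∀ v < n, IsLast src c v (ptr v))
    (hpre : ∀ v < n, pre v = 0) : DfsInv n c src tgt z ptr pre ord pp tau rt 0 0 0 where
  cnt_le := Nat.zero_le _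
  cur_le := le_rfl
  rc_le := Nat.zero_le _
  ord_lt := by simp
  pre_ord := by simp
  pre_le v hv := by simp [hpre v hv]
  ord_pre v hv h := absurd (hpre v hv) h
  pp_le := by simp
  tau_le := by simp
  rt_le := by simp
  root := by simp
  tree := by simp
  ptr_last v hv := ⟨(hptr v hv).1, (hptr v hv).2.1⟩
  fresh q hq _ := (hptr _ (hsrc q hq)).2.2 q hq rfl
  explored q hq h := absurd ((hptr _ (hsrc q hq)).2.2 q hq rfl) (by omega)
  active := by simp
  comparable q hq h := absurd (hpre _ (hsrc q hq)) h
  visited := by simp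

theorem next (h : DfsInv n c src tgt z ptr pre ord pp tau rt rc cur cnt) (hrc : rc < n)
    (hv : pre rc ≠ 0) : DfsInv n c src tgt z ptr pre ord pp tau rt (rc + 1) cur cnt where
  __ := h
  rc_le := hrc
  visited v hv' := by
    rcases Nat.lt_succ_iff_lt_or_eq.mp hv' with h' | rfl
    exacts [h.visited v h', hv]

theorem pop (h : DfsInv n c src tgt z ptr pre ord pp tau rt rc cur cnt) (hcur : cur ≠ 0)
    (hp : ptr (ord (cur - 1)) = 0) :
    DfsInv n c src tgt z ptr pre ord pp tau rt rc (pp (cur - 1)) cnt where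
  __ := h
  cur_le := by have := h.cur_le; have := h.pp_le (cur - 1) (by omega); omega
  active k hk := by
    rcases h.active k hk with h0 | ⟨-, ha⟩
    · exact .inl h0
    · cases ha with
      | refl => exact .inl hp
      | step ha hb => exact .inr ⟨by omega, by rw [hb]; exact ha⟩

/-- The arc that the pointer of an active vertex points to may be passed over if its target has
been visited. -/
theorem advance (h : DfsInv n c src tgt z ptr pre ord pp tau rt rc cur cnt)
    (hnxt : ∀ i < c, IsLast src i (src i) (nxt (i + 1))) {x : ℕ} (hxn : x < n) (hx : pre x ≠ 0)
    (hcur : cur ≠ 0) (hx' : Anc pp (pre x - 1) (cur - 1)) (hq : ptr x ≠ 0)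
    (hy : pre (tgt (ptr x - 1)) ≠ 0) :
    DfsInv n c src tgt z (Function.update ptr x (nxt (ptr x))) pre ord pp tau rt rc cur cnt where
  __ := h
  ptr_last v hv := by
    rcases eq_or_ne v x with rfl | hvx
    · obtain ⟨h1, h2⟩ := h.ptr_last v hv
      obtain ⟨h3, h4, h5⟩ := hnxt (ptr v - 1) (by omega)
      rw [Nat.sub_add_cancel (by omega)] at h3 h4
      rw [Function.update_self]
      rw [h2.resolve_left hq] at h4
      exact ⟨by omega, h4⟩
    · rw [Function.update_of_ne hvx]; exact h.ptr_last v hv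
  fresh q hq h0 := by
    rw [Function.update_of_ne (by rintro rfl; exact hx h0)]
    exact h.fresh q hq h0
  explored q hqc hle := by
    rcases eq_or_ne (src q) x with hs | hs
    · rw [hs, Function.update_self] at hle
      obtain ⟨h1, h2⟩ := h.ptr_last x hxn
      obtain ⟨h3, h4, h5⟩ := hnxt (ptr x - 1) (by omega)
      rw [Nat.sub_add_cancel (by omega)] at h3 h4 h5
      rcases lt_trichotomy q (ptr x - 1) with hlt | rfl | hlt
      · have := h5 q hlt (by rw [hs, h2.resolve_left hq])
        omega
      · exact hy
      · exact h.explored q hqc (by rw [hs]; omega)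
    · rw [Function.update_of_ne hs] at hle
      exact h.explored q hqc hle
  active k hk := by
    rcases eq_or_ne (ord k) x with hs | hs
    · subst hs
      rw [h.pre_ord k hk, Nat.add_sub_cancel] at hx'
      exact .inr ⟨hcur, hx'⟩
    · rw [Function.update_of_ne hs]; exact h.active k hk

theorem cnt_lt {y : ℕ} (h : DfsInv n c src tgt z ptr pre ord pp tau rt rc cur cnt)
    (hyn : y < n) (hy : pre y = 0) : cnt < n := by
  by_contra hcn
  have hcn' : cnt = n := le_antisymm h.cnt_le (by omega)
  have hinj : Set.InjOn ord (Finset.range n : Finset ℕ) := by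
    intro a ha b hb hab
    simp only [Finset.coe_range, Set.mem_Iio] at ha hb
    have h1 := h.pre_ord a (by omega)
    have h2 := h.pre_ord b (by omega)
    rw [hab] at h1
    omega
  have hsurj := Finset.surjOn_of_injOn_of_card_le (s := Finset.range n) (t := Finset.range n) ord
    (fun a ha => by
      simp only [Finset.coe_range, Set.mem_Iio] at ha ⊢
      exact h.ord_lt a (by omega)) hinj le_rfl
  obtain ⟨k, hk, hky⟩ := hsurj (by simpa using hyn : y ∈ ((Finset.range n : Finset ℕ) : Set ℕ))
  simp only [Finset.coe_range, Set.mem_Iio] at hk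
  have := h.pre_ord k (by omega)
  rw [hky] at this
  omega

/-- A new vertex is visited, with the current vertex, if there is one, as its parent. All visited
neighbours of the new vertex are active, since everything adjacent to a finished vertex has been
visited. -/
theorem visit (h : DfsInv n c src tgt z ptr pre ord pp tau rt rc cur cnt)
    (hsrc : ∀ q < c, src q < n) (hsymm : ∀ q < c, ∃ r < c, src r = tgt q ∧ tgt r = src q)
    {y t r : ℕ} (hyn : y < n) (hy : pre y = 0) (ht : t ≤ 1) (hr₀ : cur = 0 → r = cnt)
    (hr : cur ≠ 0 → r = rt (cur - 1) ∧
      ∃ q < c, src q = ord (cur - 1) ∧ tgt q = y ∧ (t + tau (cur - 1) + z q) % 2 = 0) :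
    DfsInv n c src tgt z ptr (Function.update pre y (cnt + 1)) (Function.update ord cnt y)
      (Function.update pp cnt cur) (Function.update tau cnt t) (Function.update rt cnt r)
      rc (cnt + 1) (cnt + 1) := by
  have hcn := h.cnt_lt hyn hy
  have hcur := h.cur_le
  have hordy : ∀ k < cnt, ord k ≠ y := by
    intro k hk he
    have := h.pre_ord k hk
    rw [he] at this
    omega
  have hanc : ∀ a b, b < cnt → Anc pp a b → Anc (Function.update pp cnt cur) a b :=
    fun a b hb hab => hab.congr h.pp_le (fun k hk => Function.update_of_ne (by omega) _ _) hb
  have hact : ∀ k < cnt, cur ≠ 0 ∧ Anc pp k (cur - 1) → Anc (Function.update pp cnt cur) k cnt := by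
    rintro k hk ⟨h0, ha⟩
    exact .step (p := cur - 1) (hanc _ _ (by omega) ha) (by rw [Function.update_self]; omega)
  have hnb : ∀ q < c, tgt q = y → pre (src q) ≠ 0 →
      Anc (Function.update pp cnt cur) (pre (src q) - 1) cnt := by
    intro q hq htq hs
    have hs' := hsrc q hq
    have hle := h.pre_le _ hs'
    refine hact _ (by omega) ((h.active _ (by omega)).resolve_left fun h0 => ?_)
    rw [h.ord_pre _ hs' hs] at h0
    exact h.explored q hq (by omega) (htq ▸ hy)
  exact
  { cnt_le := hcn
    cur_le := le_rfl
    rc_le := h.rc_le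
    ord_lt := by
      intro k hk
      rcases Nat.lt_succ_iff_lt_or_eq.mp hk with hk | rfl
      · rw [Function.update_of_ne (by omega)]; exact h.ord_lt k hk
      · rwa [Function.update_self]
    pre_ord := by
      intro k hk
      rcases Nat.lt_succ_iff_lt_or_eq.mp hk with hk | rfl
      · rw [Function.update_of_ne (a := k) (by omega), Function.update_of_ne (hordy k hk)]
        exact h.pre_ord k hk
      · rw [Function.update_self, Function.update_self]
    pre_le := by
      intro v hv
      rcases eq_or_ne v y with rfl | hvy
      · rw [Function.update_self]
      · rw [Function.update_of_ne hvy]; have := h.pre_le v hv; omega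
    ord_pre := by
      intro v hv h0
      rcases eq_or_ne v y with rfl | hvy
      · rw [Function.update_self, Nat.add_sub_cancel, Function.update_self]
      · rw [Function.update_of_ne hvy] at h0 ⊢
        have := h.pre_le v hv
        rw [Function.update_of_ne (by omega)]
        exact h.ord_pre v hv h0
    pp_le := by
      intro k hk
      rcases Nat.lt_succ_iff_lt_or_eq.mp hk with hk | rfl
      · rw [Function.update_of_ne (by omega)]; exact h.pp_le k hk
      · rwa [Function.update_self]
    tau_le := by
      intro k hk
      rcases Nat.lt_succ_iff_lt_or_eq.mp hk with hk | rfl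
      · rw [Function.update_of_ne (by omega)]; exact h.tau_le k hk
      · rwa [Function.update_self]
    rt_le := by
      intro k hk
      rcases Nat.lt_succ_iff_lt_or_eq.mp hk with hk | rfl
      · rw [Function.update_of_ne (by omega)]; exact h.rt_le k hk
      · rw [Function.update_self]
        rcases eq_or_ne cur 0 with h0 | h0
        · exact (hr₀ h0).le
        · rw [(hr h0).1]
          have := h.rt_le (cur - 1) (by omega)
          omega
    root := by
      intro k hk h0
      rcases Nat.lt_succ_iff_lt_or_eq.mp hk with hk | rfl
      · rw [Function.update_of_ne (by omega)] at h0 ⊢; exact h.root k hk h0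
      · rw [Function.update_self] at h0 ⊢; exact hr₀ h0
    tree := by
      intro k hk h0
      rcases Nat.lt_succ_iff_lt_or_eq.mp hk with hk | rfl
      · have hple := h.pp_le k hk
        rw [Function.update_of_ne (a := k) (by omega)] at h0
        rw [Function.update_of_ne (a := k) (by omega), Function.update_of_ne (a := k) (by omega),
          Function.update_of_ne (a := k) (by omega), Function.update_of_ne (a := k) (by omega),
          Function.update_of_ne (a := pp k - 1) (by omega),
          Function.update_of_ne (a := pp k - 1) (by omega),
          Function.update_of_ne (a := pp k - 1) (by omega)]
        exact h.tree k hk h0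
      · rw [Function.update_self] at h0
        simp only [Function.update_self]
        rw [Function.update_of_ne (a := cur - 1) (by omega),
          Function.update_of_ne (a := cur - 1) (by omega),
          Function.update_of_ne (a := cur - 1) (by omega)]
        exact hr h0
    ptr_last := h.ptr_last
    fresh := by
      intro q hq h0
      rcases eq_or_ne (src q) y with hs | hs
      · rw [hs, Function.update_self] at h0; omega
      · rw [Function.update_of_ne hs] at h0; exact h.fresh q hq h0
    explored := by
      intro q hq hle
      rcases eq_or_ne (tgt q) y with hs | hs
      · rw [hs, Function.update_self]; omega
      · rw [Function.update_of_ne hs]; exact h.explored q hq hle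
    active := by
      intro k hk
      rcases Nat.lt_succ_iff_lt_or_eq.mp hk with hk | rfl
      · rw [Function.update_of_ne (by omega)]
        rcases h.active k hk with h0 | h0
        · exact .inl h0
        · exact .inr ⟨by omega, hact k hk h0⟩
      · exact .inr ⟨by omega, .refl _⟩
    comparable := by
      intro q hq hs ht
      by_cases hsy : src q = y <;> by_cases hty : tgt q = y
      · rw [hsy, hty]; exact .inl (.refl _)
      · rw [Function.update_of_ne hty] at ht ⊢
        rw [hsy, Function.update_self, Nat.add_sub_cancel]
        obtain ⟨r, hr, h1, h2⟩ := hsymm q hq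
        rw [← h1] at ht ⊢
        exact .inr (hnb r hr (by rw [h2, hsy]) ht)
      · rw [Function.update_of_ne hsy] at hs ⊢
        rw [hty, Function.update_self, Nat.add_sub_cancel]
        exact .inl (hnb q hq hty hs)
      · rw [Function.update_of_ne hsy] at hs ⊢
        rw [Function.update_of_ne hty] at ht ⊢
        have hs' := hsrc q hq
        have ht' : tgt q < n := by obtain ⟨r, hr, h1, -⟩ := hsymm q hq; rw [← h1]; exact hsrc r hr
        have := h.pre_le _ hs'
        have := h.pre_le _ ht'
        rcases h.comparable q hq hs ht with h1 | h1
        · exact .inl (hanc _ _ (by omega) h1)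
        · exact .inr (hanc _ _ (by omega) h1)
    visited := by
      intro v hv
      rcases eq_or_ne v y with rfl | hvy
      · rw [Function.update_self]; omega
      · rw [Function.update_of_ne hvy]; exact h.visited v hv }

theorem isDfs (h : DfsInv n c src tgt z ptr pre ord pp tau rt n cur cnt)
    (hsrc : ∀ q < c, src q < n) (htgt : ∀ q < c, tgt q < n) :
    IsDfs n c src tgt z pre ord pp tau rt := by
  obtain rfl : cnt = n := by
    refine le_antisymm h.cnt_le ?_
    have hsub : Finset.image (fun v => pre v - 1) (Finset.range n) ⊆ Finset.range cnt := by
      intro k hk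
      simp only [Finset.mem_image, Finset.mem_range] at hk ⊢
      obtain ⟨v, hv, rfl⟩ := hk
      have := h.pre_le v hv
      have := h.visited v hv
      omega
    have hinj : Set.InjOn (fun v => pre v - 1) (Finset.range n : Finset ℕ) := by
      intro a ha b hb hab
      simp only [Finset.coe_range, Set.mem_Iio] at ha hb hab
      rw [← h.ord_pre a ha (h.visited a ha), hab, h.ord_pre b hb (h.visited b hb)]
    have := Finset.card_le_card hsub
    rwa [Finset.card_image_of_injOn hinj, Finset.card_range, Finset.card_range] at this
  exact
  { ord_lt := h.ord_lt
    pre_ord := h.pre_ord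
    pre_le := h.pre_le
    pre_ne := h.visited
    ord_pre := fun v hv => h.ord_pre v hv (h.visited v hv)
    pp_le := h.pp_le
    tau_le := h.tau_le
    rt_le := h.rt_le
    root := h.root
    tree := h.tree
    comparable := fun q hq =>
      h.comparable q hq (h.visited _ (hsrc q hq)) (h.visited _ (htgt q hq)) }

theorem potential_next (hrc : rc < n) :
    dfsPotential n c src ptr pp (rc + 1) cur cnt < dfsPotential n c src ptr pp rc cur cnt := by
  unfold dfsPotential
  omega

theorem potential_pop (h : DfsInv n c src tgt z ptr pre ord pp tau rt rc cur cnt) (hcur : cur ≠ 0) :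
    dfsPotential n c src ptr pp rc (pp (cur - 1)) cnt < dfsPotential n c src ptr pp rc cur cnt := by
  classical
  unfold dfsPotential
  have h1 := h.cur_le
  have h2 := h.cnt_le
  have hlt : ((Finset.range n).filter fun a => pp (cur - 1) ≠ 0 ∧ Anc pp a (pp (cur - 1) - 1)).card
      <
      ((Finset.range n).filter fun a => cur ≠ 0 ∧ Anc pp a (cur - 1)).card := by
    apply Finset.card_lt_card
    rw [Finset.ssubset_iff_of_subset]
    · refine ⟨cur - 1, ?_, ?_⟩
      · simp only [Finset.mem_filter, Finset.mem_range]
        exact ⟨by omega, hcur, .refl _⟩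
      · simp only [Finset.mem_filter, Finset.mem_range, not_and]
        intro _ h0 ha
        have h3 := h.pp_le (cur - 1) (by omega)
        have := ha.le h.pp_le (by omega : pp (cur - 1) - 1 < cnt)
        omega
    · intro a ha
      simp only [Finset.mem_filter, Finset.mem_range] at ha ⊢
      exact ⟨ha.1, hcur, .step ha.2.2 (by omega)⟩
  convert Nat.add_lt_add_right (Nat.add_lt_add_left hlt _) _ using 4

theorem potential_advance (h : DfsInv n c src tgt z ptr pre ord pp tau rt rc cur cnt)
    (hnxt : ∀ i < c, IsLast src i (src i) (nxt (i + 1))) {x : ℕ} (hxn : x < n) (hq : ptr x ≠ 0)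
    (pp' : ℕ → ℕ) (rc' cur' cnt' : ℕ) :
    dfsPotential n c src (Function.update ptr x (nxt (ptr x))) pp' rc' cur' cnt' <
      dfsPotential n c src ptr pp' rc' cur' cnt' := by
  unfold dfsPotential
  obtain ⟨h1, h2⟩ := h.ptr_last x hxn
  have hs := h2.resolve_left hq
  have h3 := (hnxt (ptr x - 1) (by omega)).1
  rw [Nat.sub_add_cancel (by omega)] at h3
  have hlt : ((Finset.range c).filter fun q =>
      q < Function.update ptr x (nxt (ptr x)) (src q)).card <
      ((Finset.range c).filter fun q => q < ptr (src q)).card := by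
    apply Finset.card_lt_card
    rw [Finset.ssubset_iff_of_subset]
    · refine ⟨ptr x - 1, ?_, ?_⟩
      · simp only [Finset.mem_filter, Finset.mem_range, hs]; omega
      · simp only [Finset.mem_filter, Finset.mem_range, hs, Function.update_self]; omega
    · intro q hq
      simp only [Finset.mem_filter, Finset.mem_range] at hq ⊢
      refine ⟨hq.1, ?_⟩
      rcases eq_or_ne (src q) x with hx | hx
      · have := hq.2
        rw [hx, Function.update_self] at this
        rw [hx]; omega
      · have := hq.2
        rwa [Function.update_of_ne hx] at this
  omega

theorem potential_visit (h : DfsInv n c src tgt z ptr pre ord pp tau rt rc cur cnt)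
    (hcn : cnt < n) :
    dfsPotential n c src ptr (Function.update pp cnt cur) rc (cnt + 1) (cnt + 1) <
      dfsPotential n c src ptr pp rc cur cnt := by
  classical
  unfold dfsPotential
  have hle : ((Finset.range n).filter fun a =>
      cnt + 1 ≠ 0 ∧ Anc (Function.update pp cnt cur) a (cnt + 1 - 1)).card ≤
      ((Finset.range n).filter fun a => cur ≠ 0 ∧ Anc pp a (cur - 1)).card + 1 := by
    refine le_trans (Finset.card_le_card (t := insert cnt _) ?_) (Finset.card_insert_le _ _)
    intro a ha
    simp only [Finset.mem_filter, Finset.mem_range, Finset.mem_insert, Nat.add_sub_cancel] at ha ⊢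
    obtain ⟨han, -, ha⟩ := ha
    cases ha with
    | refl => exact .inl rfl
    | step ha hb =>
      rename_i p
      rw [Function.update_self] at hb
      have := h.cur_le
      refine .inr ⟨han, by omega, ?_⟩
      have hpc : p = cur - 1 := by omega
      rw [← hpc]
      refine ha.congr (n := cnt) (fun k hk => ?_) (fun k hk => ?_) (by omega)
      · rw [Function.update_of_ne (by omega)]; exact h.pp_le k hk
      · rw [Function.update_of_ne (by omega)]
  have h2 : ∀ A B B' D : ℕ, B' ≤ B + 1 →
      A + 2 * (n - (cnt + 1)) + B' + D < A + 2 * (n - cnt) + B + D := by omega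
  convert h2 _ _ _ _ hle using 4

end DfsInv

theorem IsDfs.rt_eq_of_anc {n c : ℕ} {src tgt z pre ord pp tau rt : ℕ → ℕ}
    (h : IsDfs n c src tgt z pre ord pp tau rt) {a b : ℕ} (hab : Anc pp a b) (hb : b < n) :
    rt b = rt a := by
  induction hab with
  | refl => rfl
  | @step p b _ hb' ih =>
    have h1 := h.pp_le b hb
    obtain ⟨h2, -⟩ := h.tree b hb (by omega)
    rw [h2, hb', Nat.add_sub_cancel]
    exact ih (by omega)

/-- The two ends of an arc lie in the same tree. -/
theorem IsDfs.rt_eq {n c : ℕ} {src tgt z pre ord pp tau rt : ℕ → ℕ}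
    (h : IsDfs n c src tgt z pre ord pp tau rt) (hsrc : ∀ q < c, src q < n)
    (htgt : ∀ q < c, tgt q < n) {q : ℕ} (hq : q < c) :
    rt (pre (src q) - 1) = rt (pre (tgt q) - 1) := by
  have h1 := h.pre_le _ (hsrc q hq)
  have h2 := h.pre_le _ (htgt q hq)
  have h3 := h.pre_ne _ (hsrc q hq)
  have h4 := h.pre_ne _ (htgt q hq)
  rcases h.comparable q hq with h0 | h0
  · exact (h.rt_eq_of_anc h0 (by omega)).symm
  · exact h.rt_eq_of_anc h0 (by omega)

end MaxCut

/-! ### Computing the cut links and the colouring -/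

namespace MaxCut

/-- The invariant of the bottom-up computation of the cut links: the vertices from `K` on have
been treated, the others still have `cp k = 0`. -/
structure CutInv (n m : ℕ) (el eu z pp tau hi cp : ℕ → ℕ) (K : ℕ) : Prop where
  hi_edge : ∀ i < m, eu i < el i → (tau (el i) + tau (eu i) + z i) % 2 ≠ 0 → eu i + 1 ≤ hi (el i)
  cp_ne : ∀ k < n, K ≤ k → cp k ≠ 0 → cp k = pp k ∧ hi k < pp k ∧ hi k ≤ hi (pp k - 1)
  cp_zero : ∀ k < n, K ≤ k → cp k = 0 → pp k = 0 ∨ pp k ≤ hi k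
  unset : ∀ k < K, cp k = 0
  wit : ∀ k < n, hi k ≠ 0 → ∃ i < m, eu i < el i ∧ (tau (el i) + tau (eu i) + z i) % 2 ≠ 0 ∧
    eu i + 1 = hi k ∧ Anc cp k (el i)

namespace CutInv

variable {n m : ℕ} {el eu z pp tau hi cp : ℕ → ℕ} {x : ℕ}

theorem skip (h : CutInv n m el eu z pp tau hi cp (x + 1)) (hx : pp x = 0 ∨ pp x ≤ hi x) :
    CutInv n m el eu z pp tau hi cp x where
  __ := h
  cp_ne k hk hxk h0 := by
    rcases hxk.lt_or_eq with hlt | rfl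
    · exact h.cp_ne k hk hlt h0
    · exact absurd (h.unset x (Nat.lt_succ_self x)) h0
  cp_zero k hk hxk h0 := by
    rcases hxk.lt_or_eq with hlt | rfl
    · exact h.cp_zero k hk hlt h0
    · exact hx
  unset k hk := h.unset k (by omega)

theorem keep (h : CutInv n m el eu z pp tau hi cp (x + 1)) (hxn : x < n)
    (hpp : ∀ k < n, pp k ≤ k) (h0 : pp x ≠ 0) (hlt : hi x < pp x) :
    CutInv n m el eu z pp tau
      (Function.update hi (pp x - 1) (hi (pp x - 1) + (hi x - hi (pp x - 1))))
      (Function.update cp x (pp x)) x := by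
  have hpx := hpp x hxn
  have hmono : ∀ k, hi k ≤
      Function.update hi (pp x - 1) (hi (pp x - 1) + (hi x - hi (pp x - 1))) k := by
    intro k
    rcases eq_or_ne k (pp x - 1) with rfl | hne
    · rw [Function.update_self]; omega
    · rw [Function.update_of_ne hne]
  have hsame : ∀ k, x ≤ k →
      Function.update hi (pp x - 1) (hi (pp x - 1) + (hi x - hi (pp x - 1))) k = hi k :=
    fun k hk => Function.update_of_ne (by omega) _ _
  have hanc : ∀ a b, Anc cp a b → Anc (Function.update cp x (pp x)) a b := fun a b hab =>
    hab.mono fun k hk => Function.update_of_ne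
      (by rintro rfl; exact hk (h.unset k (Nat.lt_succ_self k))) _ _
  exact
  { hi_edge := fun i hi' h1 h2 => (h.hi_edge i hi' h1 h2).trans (hmono _)
    cp_ne := by
      intro k hk hxk hc
      rw [hsame k hxk]
      rcases hxk.lt_or_eq with hlt' | rfl
      · rw [Function.update_of_ne (by omega)] at hc ⊢
        obtain ⟨h1, h2, h3⟩ := h.cp_ne k hk hlt' hc
        exact ⟨h1, h2, h3.trans (hmono _)⟩
      · refine ⟨by rw [Function.update_self], hlt, ?_⟩
        rw [Function.update_self]; omega
    cp_zero := by
      intro k hk hxk hc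
      rw [hsame k hxk]
      rcases hxk.lt_or_eq with hlt' | rfl
      · rw [Function.update_of_ne (by omega)] at hc
        exact h.cp_zero k hk hlt' hc
      · rw [Function.update_self] at hc
        exact absurd hc h0
    unset := by
      intro k hk
      rw [Function.update_of_ne (by omega)]
      exact h.unset k (by omega)
    wit := by
      intro k hk hk0
      by_cases hkp : k = pp x - 1 ∧ hi k < hi x
      · obtain ⟨rfl, hlt'⟩ := hkp
        rw [Function.update_self] at hk0 ⊢
        obtain ⟨i, h1, h2, h3, h4, h5⟩ := h.wit x hxn (by omega)
        refine ⟨i, h1, h2, h3, by omega, Anc.trans (.step (.refl _) ?_) (hanc _ _ h5)⟩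
        rw [Function.update_self]; omega
      · have hk' : Function.update hi (pp x - 1) (hi (pp x - 1) + (hi x - hi (pp x - 1))) k =
            hi k := by
          rcases eq_or_ne k (pp x - 1) with rfl | hne
          · rw [Function.update_self]; omega
          · rw [Function.update_of_ne hne]
        rw [hk'] at hk0 ⊢
        obtain ⟨i, h1, h2, h3, h4, h5⟩ := h.wit k hk hk0
        exact ⟨i, h1, h2, h3, h4, hanc _ _ h5⟩ }

end CutInv

/-- The invariant of the top-down colouring: the vertices below `a` have been coloured, and the
edges whose upper end is below `a - 1`, or is `a - 1` and whose index is at least `q`, have been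
counted in `sat` and `vio`. -/
structure ColInv (n m : ℕ) (el eu z tau top sat vio phi col : ℕ → ℕ) (a q : ℕ) : Prop where
  a_le : a ≤ n
  q_le : q ≤ m
  q_eq : q = 0 ∨ eu (q - 1) + 1 = a
  sat_eq : ∀ J < n, sat J = ((crossing m el eu z tau top col J 0).filter
    fun i => eu i + 1 < a ∨ eu i + 1 = a ∧ q ≤ i).card
  vio_eq : ∀ J < n, vio J = ((crossing m el eu z tau top col J 1).filter
    fun i => eu i + 1 < a ∨ eu i + 1 = a ∧ q ≤ i).card
  col_le : ∀ k < a, col k ≤ 1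
  phi_le : ∀ k < a, phi k ≤ 1
  col_eq : ∀ k < a, (col k + tau k + phi (top k)) % 2 = 0
  phi_eq : ∀ k < a, phi k = if (crossing m el eu z tau top col k 0).card <
      (crossing m el eu z tau top col k 1).card then 1 else 0

/-- The number of edges and vertices that the colouring has not treated. -/
def colPotential (n m : ℕ) (eu : ℕ → ℕ) (a q : ℕ) : ℕ :=
  ((Finset.range m).filter fun i => ¬ (eu i + 1 < a ∨ eu i + 1 = a ∧ q ≤ i)).card + (n - a)

theorem colPotential_le (n m : ℕ) (eu : ℕ → ℕ) (a q : ℕ) : colPotential n m eu a q ≤ m + n :=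
  Nat.add_le_add ((Finset.card_filter_le _ _).trans_eq (Finset.card_range _)) (by omega)

theorem card_crossing_le (m : ℕ) (el eu z tau top col : ℕ → ℕ) (J r : ℕ) :
    (crossing m el eu z tau top col J r).card ≤ m :=
  (Finset.card_filter_le _ _).trans_eq (Finset.card_range _)

namespace ColInv

variable {n m : ℕ} {el eu z pp tau hi cp top sat vio phi col : ℕ → ℕ} {a q : ℕ}

theorem init (hsat : ∀ J < n, sat J = 0) (hvio : ∀ J < n, vio J = 0) :
    ColInv n m el eu z tau top sat vio phi col 0 0 where
  a_le := Nat.zero_le _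
  q_le := Nat.zero_le _
  q_eq := .inl rfl
  sat_eq J hJ := by simp [hsat J hJ]
  vio_eq J hJ := by simp [hvio J hJ]
  col_le := by simp
  phi_le := by simp
  col_eq := by simp
  phi_eq := by simp

theorem color (h : ColInv n m el eu z tau top sat vio phi col a 0)
    (hf : CutForest n m el eu z pp tau hi cp top) {nxt : ℕ} (ha : a < n)
    (hnxt : IsLast eu m a nxt) (htau : tau a ≤ 1) :
    ColInv n m el eu z tau top sat vio
      (Function.update phi a (if sat a < vio a then 1 else 0))
      (Function.update col a (1 - if tau a =
        Function.update phi a (if sat a < vio a then 1 else 0) (top a) then 1 else 0))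
      (a + 1) nxt := by
  set phi' := Function.update phi a (if sat a < vio a then 1 else 0) with hphi'
  set col' := Function.update col a (1 - if tau a = phi' (top a) then 1 else 0) with hcol'
  -- An edge that leaves the component of `J` upwards has its upper end above `J`.
  have hup : ∀ J r (c : ℕ → ℕ), ∀ i ∈ crossing m el eu z tau top c J r, eu i < J := by
    intro J r c i hi'
    simp only [crossing, Finset.mem_filter, Finset.mem_range] at hi'
    obtain ⟨him, rfl, hne, -⟩ := hi'
    exact hf.lt_top (hf.anc i him) (hf.el_lt i him) hne
  have hcongr : ∀ J r, (crossing m el eu z tau top col' J r).filter (fun i => eu i < a) =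
      (crossing m el eu z tau top col J r).filter (fun i => eu i < a) := by
    intro J r
    ext i
    simp only [crossing, Finset.mem_filter]
    refine and_congr_left fun hlt => ?_
    rw [hcol', Function.update_of_ne (by omega)]
  have hcross : ∀ J ≤ a, ∀ r, crossing m el eu z tau top col' J r =
      crossing m el eu z tau top col J r := by
    intro J hJ r
    have h1 := hcongr J r
    rwa [Finset.filter_true_of_mem, Finset.filter_true_of_mem] at h1
    · intro i hi'; have := hup J r _ i hi'; omega
    · intro i hi'; have := hup J r _ i hi'; omega
  have hfil : ∀ J r, (crossing m el eu z tau top col' J r).filter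
      (fun i => eu i + 1 < a + 1 ∨ eu i + 1 = a + 1 ∧ nxt ≤ i) =
      (crossing m el eu z tau top col J r).filter
      (fun i => eu i + 1 < a ∨ eu i + 1 = a ∧ 0 ≤ i) := by
    intro J r
    calc _ = (crossing m el eu z tau top col' J r).filter (fun i => eu i < a) := by
          refine Finset.filter_congr fun i hi' => ?_
          simp only [crossing, Finset.mem_filter, Finset.mem_range] at hi'
          have := hnxt.2.2 i hi'.1
          omega
      _ = (crossing m el eu z tau top col J r).filter (fun i => eu i < a) := hcongr J r
      _ = _ := Finset.filter_congr fun i _ => by omega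
  have hphia : phi' a = if (crossing m el eu z tau top col a 0).card <
      (crossing m el eu z tau top col a 1).card then 1 else 0 := by
    rw [hphi', Function.update_self, h.sat_eq a ha, h.vio_eq a ha,
      Finset.filter_true_of_mem, Finset.filter_true_of_mem]
    · intro i hi'; have := hup a 1 _ i hi'; omega
    · intro i hi'; have := hup a 0 _ i hi'; omega
  have hphile : ∀ k < a + 1, phi' k ≤ 1 := by
    intro k hk
    rcases Nat.lt_succ_iff_lt_or_eq.mp hk with hk | rfl
    · rw [hphi', Function.update_of_ne (by omega)]; exact h.phi_le k hk
    · rw [hphi', Function.update_self]; split_ifs <;> omega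
  exact
  { a_le := ha
    q_le := hnxt.1
    q_eq := hnxt.2.1.imp_right fun h1 => by rw [h1]
    sat_eq := fun J hJ => by rw [hfil, ← h.sat_eq J hJ]
    vio_eq := fun J hJ => by rw [hfil, ← h.vio_eq J hJ]
    col_le := by
      intro k hk
      rcases Nat.lt_succ_iff_lt_or_eq.mp hk with hk | rfl
      · rw [hcol', Function.update_of_ne (by omega)]; exact h.col_le k hk
      · rw [hcol', Function.update_self]; omega
    phi_le := hphile
    col_eq := by
      intro k hk
      have ht := (hf.top_spec (k := k) (by omega)).1
      rcases Nat.lt_succ_iff_lt_or_eq.mp hk with hk | rfl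
      · rw [hcol', hphi', Function.update_of_ne (by omega), Function.update_of_ne (by omega)]
        exact h.col_eq k hk
      · have := hphile (top k) (by omega)
        rw [hcol', Function.update_self]
        split_ifs <;> omega
    phi_eq := by
      intro k hk
      rw [hcross k (by omega) 0, hcross k (by omega) 1]
      rcases Nat.lt_succ_iff_lt_or_eq.mp hk with hk | rfl
      · rw [hphi', Function.update_of_ne (by omega)]; exact h.phi_eq k hk
      · exact hphia }

/-- Passing from the pointer `q` to the next pointer adds exactly the edge `q - 1` to the
counted edges. -/
theorem counted_iff (h : ColInv n m el eu z tau top sat vio phi col a q) {nxt : ℕ} (hq : q ≠ 0)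
    (hnxt : IsLast eu (q - 1) (eu (q - 1)) nxt) (i : ℕ) :
    (eu i + 1 < a ∨ eu i + 1 = a ∧ nxt ≤ i) ↔
      i = q - 1 ∨ (eu i + 1 < a ∨ eu i + 1 = a ∧ q ≤ i) := by
  have h1 := h.q_eq.resolve_left hq
  have h2 := hnxt.1
  constructor
  · rintro (h3 | ⟨h3, h4⟩)
    · exact .inr (.inl h3)
    · rcases lt_trichotomy i (q - 1) with h5 | h5 | h5
      · have := hnxt.2.2 i h5 (by omega)
        omega
      · exact .inl h5
      · exact .inr (.inr ⟨h3, by omega⟩)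
  · rintro (rfl | h3 | h3)
    · exact .inr ⟨h1, h2⟩
    · exact .inl h3
    · exact .inr ⟨h3.1, by omega⟩

/-- The effect of counting one edge on the numbers of counted edges. -/
theorem card_counted (h : ColInv n m el eu z tau top sat vio phi col a q) {nxt : ℕ} (hq : q ≠ 0)
    (hnxt : IsLast eu (q - 1) (eu (q - 1)) nxt) (J r : ℕ) :
    ((crossing m el eu z tau top col J r).filter
      fun i => eu i + 1 < a ∨ eu i + 1 = a ∧ nxt ≤ i).card =
    ((crossing m el eu z tau top col J r).filter
      fun i => eu i + 1 < a ∨ eu i + 1 = a ∧ q ≤ i).card +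
      if q - 1 ∈ crossing m el eu z tau top col J r then 1 else 0 := by
  rw [Finset.filter_congr fun i _ => h.counted_iff hq hnxt i, Finset.filter_or,
    Finset.card_union_of_disjoint, add_comm]
  · congr 1
    rw [Finset.filter_eq']
    split_ifs <;> simp
  · rw [Finset.disjoint_left]
    intro i h1 h2
    simp only [Finset.mem_filter] at h1 h2
    obtain ⟨-, rfl⟩ := h1
    have := h.q_eq
    omega

theorem count (h : ColInv n m el eu z tau top sat vio phi col a q) {nxt : ℕ} (hq : q ≠ 0)
    (hnxt : IsLast eu (q - 1) (eu (q - 1)) nxt) {sat' vio' : ℕ → ℕ}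
    (hsat : ∀ J < n, sat' J = sat J + if q - 1 ∈ crossing m el eu z tau top col J 0 then 1 else 0)
    (hvio : ∀ J < n, vio' J = vio J + if q - 1 ∈ crossing m el eu z tau top col J 1 then 1 else 0) :
    ColInv n m el eu z tau top sat' vio' phi col a nxt where
  __ := h
  q_le := by have := h.q_le; have := hnxt.1; omega
  q_eq := hnxt.2.1.imp_right fun h1 => by rw [h1]; exact h.q_eq.resolve_left hq
  sat_eq J hJ := by rw [h.card_counted hq hnxt, ← h.sat_eq J hJ, hsat J hJ]
  vio_eq J hJ := by rw [h.card_counted hq hnxt, ← h.vio_eq J hJ, hvio J hJ]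

theorem potential_color (nxt : ℕ) (ha : a < n) :
    colPotential n m eu (a + 1) nxt < colPotential n m eu a 0 := by
  have : (Finset.range m).filter (fun i => ¬ (eu i + 1 < a + 1 ∨ eu i + 1 = a + 1 ∧ nxt ≤ i)) ⊆
      (Finset.range m).filter fun i => ¬ (eu i + 1 < a ∨ eu i + 1 = a ∧ 0 ≤ i) := by
    intro i hi'
    simp only [Finset.mem_filter, Finset.mem_range] at hi' ⊢
    omega
  have := Finset.card_le_card this
  unfold colPotential
  omega

theorem potential_count (h : ColInv n m el eu z tau top sat vio phi col a q) {nxt : ℕ} (hq : q ≠ 0)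
    (hnxt : IsLast eu (q - 1) (eu (q - 1)) nxt) :
    colPotential n m eu a nxt < colPotential n m eu a q := by
  have : ((Finset.range m).filter fun i => ¬ (eu i + 1 < a ∨ eu i + 1 = a ∧ nxt ≤ i)).card <
      ((Finset.range m).filter fun i => ¬ (eu i + 1 < a ∨ eu i + 1 = a ∧ q ≤ i)).card := by
    apply Finset.card_lt_card
    have h1 := h.q_le
    have h2 := h.q_eq
    rw [Finset.ssubset_iff_of_subset]
    · refine ⟨q - 1, ?_, ?_⟩
      · simp only [Finset.mem_filter, Finset.mem_range]; omega
      · simp only [Finset.mem_filter, h.counted_iff hq hnxt]; tauto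
    · intro i hi'
      simp only [Finset.mem_filter, h.counted_iff hq hnxt] at hi' ⊢
      tauto
  unfold colPotential
  omega

end ColInv

end MaxCut

/-! ### Linked lists and depth-first search on the RAM -/

namespace MaxCut

open RAM RAM.Prog RAM.Expr

/- Names of the registers and of the arrays. The registers `rN` and `rM` and the arrays `aU` and
`aV` hold the input, and `aOut` holds the output. -/
local notation "rN" => (0 : ℕ)
local notation "rM" => (1 : ℕ)
local notation "rLo" => (2 : ℕ)
local notation "rSkip" => (3 : ℕ)
local notation "rBest" => (4 : ℕ)
local notation "rI" => (5 : ℕ)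
local notation "rArcs" => (6 : ℕ)
local notation "rRoot" => (7 : ℕ)
local notation "rCur" => (8 : ℕ)
local notation "rCnt" => (9 : ℕ)
local notation "rX" => (10 : ℕ)
local notation "rQ" => (11 : ℕ)
local notation "rY" => (12 : ℕ)
local notation "rZ" => (13 : ℕ)
local notation "aU" => (0 : ℕ)
local notation "aV" => (1 : ℕ)
local notation "aOut" => (2 : ℕ)
local notation "aSrc" => (3 : ℕ)
local notation "aTgt" => (4 : ℕ)
local notation "aSgn" => (5 : ℕ)
local notation "aHead" => (6 : ℕ)
local notation "aNext" => (7 : ℕ)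
local notation "aPre" => (8 : ℕ)
local notation "aOrd" => (9 : ℕ)
local notation "aPar" => (10 : ℕ)
local notation "aTau" => (11 : ℕ)
local notation "aRoot" => (12 : ℕ)
local notation "aRep" => (13 : ℕ)
local notation "aSide" => (14 : ℕ)
local notation "aLow" => (15 : ℕ)
local notation "aUp" => (16 : ℕ)
local notation "aHi" => (17 : ℕ)
local notation "aCut" => (18 : ℕ)
local notation "aTop" => (19 : ℕ)
local notation "aSat" => (20 : ℕ)
local notation "aVio" => (21 : ℕ)
local notation "aFlip" => (22 : ℕ)
local notation "aCol" => (23 : ℕ)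
local notation "aNew" => (24 : ℕ)

/-- The sum modulo two of two expressions with values `0` or `1`. -/
def addMod (e f : Expr) : Expr := .sub (.const 1) (.eq e f)

/-- Sort the numbers `i < cnt` by `key i` into linked lists. -/
def bucketProg (key cnt : ℕ) : Prog :=
  .seq (.for rI rN (.store aHead (.reg rI) (.const 0)))
    (.for rI cnt
      (.seq (.store aNext (.add (.reg rI) (.const 1)) (.get aHead (.get key (.reg rI))))
        (.store aHead (.get key (.reg rI)) (.add (.reg rI) (.const 1)))))

theorem IsLast.update {key head : ℕ → ℕ} {n i : ℕ} (h : ∀ k < n, IsLast key i k (head k)) :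
    ∀ k < n, IsLast key (i + 1) k (Function.update head (key i) (i + 1) k) := by
  intro k hk
  rcases eq_or_ne k (key i) with rfl | hne
  · rw [Function.update_self]
    exact ⟨le_rfl, .inr (by simp), fun j hj _ => hj⟩
  · rw [Function.update_of_ne hne]
    obtain ⟨h1, h2, h3⟩ := h k hk
    refine ⟨by omega, h2, fun j hj hjk => h3 j ?_ hjk⟩
    rcases Nat.lt_succ_iff_lt_or_eq.mp hj with hj | rfl
    exacts [hj, absurd hjk.symm hne]

theorem bucketProg_spec {W M n c key cnt : ℕ} (hM : 1 ≤ M) (hW : 20 * M < W) {s : State}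
    (hs : Bdd M s) (hk₁ : key ≠ aHead) (hk₂ : key ≠ aNext) (hcnt : cnt ≠ rI) (hn : s.reg rN = n)
    (hc : s.reg cnt = c) (hkey : ∀ i < c, s.arr key i < n) :
    ∃ s', Runs W M (bucketProg key cnt) s s' (50 * (n + c + 2)) ∧
      Buckets n c (s.arr key) (s'.arr aHead) (s'.arr aNext) := by
  obtain ⟨s₁, h₁, hz⟩ := Runs.for (s₀ := s) hM hW rI rN (P := .store aHead (.reg rI) (.const 0))
    rfl (by decide) rfl rfl (fun k s => ∀ i < k, s.arr aHead i = 0) hn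
    (by
      intro k hk s hs hf hx hI
      refine ⟨Nat.zero_le _, ?_⟩
      intro i hi
      rcases eq_or_ne i k with rfl | hne
      · simp [Prog.run, Expr.eval, hx]
      · have := hI i (by omega)
        simpa [Prog.run, Expr.eval, hx, hne] using this) hs (by simp)
  have hkey₁ : s₁.arr key = s.arr key :=
    h₁.arr_eq (by simp [Prog.for, Prog.noArr, hk₁])
  have hc₁ : s₁.reg cnt = c := by
    rw [← hc]; exact h₁.reg_eq (by simp [Prog.for, Prog.noReg, hcnt])
  obtain ⟨s₂, h₂, hI₂⟩ := Runs.for (s₀ := s₁) hM hW rI cnt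
    (P := .seq (.store aNext (.add (.reg rI) (.const 1)) (.get aHead (.get key (.reg rI))))
        (.store aHead (.get key (.reg rI)) (.add (.reg rI) (.const 1))))
    rfl hcnt rfl rfl
    (fun k t => (∀ v < n, IsLast (s.arr key) k v (t.arr aHead v)) ∧
      ∀ i < k, IsLast (s.arr key) i (s.arr key i) (t.arr aNext (i + 1))) hc₁
    (by
      intro k hk t ht hf hx hI
      have hkt : t.arr key = s.arr key :=
        (hf.2 key (by simp [Prog.for, Prog.noArr, hk₁, hk₂])).trans hkey₁
      have hcM : c ≤ M := hc₁ ▸ h₁.bdd.1 cnt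
      refine ⟨⟨ht.2 _ _, ?_⟩, ?_, ?_⟩
      · simp [Prog.Safe, Prog.run, Expr.eval, hx]; omega
      · have := IsLast.update hI.1
        simpa [Prog.run, Expr.eval, hx, hkt, hk₂] using this
      · intro i hi
        rcases eq_or_ne i k with rfl | hne
        · have := hI.1 _ (hkey i hk)
          simpa [Prog.run, Expr.eval, hx, hkt] using this
        · have := hI.2 i (by omega)
          simpa [Prog.run, Expr.eval, hx, hne] using this) h₁.bdd
    (by
      refine ⟨fun v hv => ?_, by simp⟩
      simp only [State.setReg_arr]
      rw [hz v hv]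
      exact ⟨le_rfl, .inl rfl, by simp⟩)
  refine ⟨s₂, (h₁.seq h₂).mono ?_, hI₂.1, hI₂.2⟩
  simp only [Prog.time, Expr.cost]
  omega

/-- Write the arcs of all edges: edge `i` yields the arcs `i` and `m + i` in opposite directions.
The program `P` computes the ends and the sign of edge `i` in three registers. -/
def arcsProg (P : Prog) : Prog :=
  .for rI rM (.seq P
    (.seq (.store aSrc (.reg rI) (.reg rX))
    (.seq (.store aTgt (.reg rI) (.reg rY))
    (.seq (.store aSgn (.reg rI) (.reg rZ))
    (.seq (.store aSrc (.add (.reg rM) (.reg rI)) (.reg rY))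
    (.seq (.store aTgt (.add (.reg rM) (.reg rI)) (.reg rX))
      (.store aSgn (.add (.reg rM) (.reg rI)) (.reg rZ))))))))

/-- The arcs `i` and `m + i`, for `i < m`, join `x i` and `y i` in the two directions, with the sign
`z i`. -/
def IsArcs (m : ℕ) (x y z src tgt sgn : ℕ → ℕ) : Prop :=
  ∀ i < m, src i = x i ∧ tgt i = y i ∧ sgn i = z i ∧
    src (m + i) = y i ∧ tgt (m + i) = x i ∧ sgn (m + i) = z i

theorem arcsProg_spec {W M m : ℕ} (hM : 1 ≤ M) (hW : 20 * M < W) {s : State} (hs : Bdd M s)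
    (hm : s.reg rM = m) {P : Prog} (hok : P.ok = true) (hI : P.noReg rI = true)
    (hrM : P.noReg rM = true) (harr : ∀ a, P.noArr a = true) (x y z : ℕ → ℕ)
    (hP : ∀ i < m, ∀ t, Bdd M t → Frame (arcsProg P) s t → t.reg rI = i →
      P.Safe M t ∧ (P.run t).reg rX = x i ∧ (P.run t).reg rY = y i ∧ (P.run t).reg rZ = z i) :
    ∃ s', Runs W M (arcsProg P) s s' ((P.time + 40) * (m + 1)) ∧
      IsArcs m x y z (s'.arr aSrc) (s'.arr aTgt) (s'.arr aSgn) := by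
  obtain ⟨s₁, h₁, hs₁⟩ := Runs.for (s₀ := s) hM hW rI rM (P := .seq P
    (.seq (.store aSrc (.reg rI) (.reg rX))
    (.seq (.store aTgt (.reg rI) (.reg rY))
    (.seq (.store aSgn (.reg rI) (.reg rZ))
    (.seq (.store aSrc (.add (.reg rM) (.reg rI)) (.reg rY))
    (.seq (.store aTgt (.add (.reg rM) (.reg rI)) (.reg rX))
      (.store aSgn (.add (.reg rM) (.reg rI)) (.reg rZ))))))))
    (by simpa [Prog.ok, Expr.ok, Expr.small, Expr.cost] using hok) (by decide)
    (by simpa [Prog.noReg] using hI) (by simpa [Prog.noReg] using hrM)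
    (fun k t => ∀ i < k, t.arr aSrc i = x i ∧ t.arr aTgt i = y i ∧ t.arr aSgn i = z i ∧
      t.arr aSrc (m + i) = y i ∧ t.arr aTgt (m + i) = x i ∧ t.arr aSgn (m + i) = z i) hm
    (by
      intro k hk t ht hf hx hIt
      obtain ⟨h1, h2, h3, h4⟩ := hP k hk t ht hf hx
      have hr := Runs.of_safe hM hW P hok ht h1
      have hb := hr.bdd
      have hrI : (P.run t).reg rI = k := (hr.reg_eq hI).trans hx
      have hrM' : (P.run t).reg rM = m := by
        rw [hr.reg_eq hrM, hf.1 rM (by simp [Prog.for, Prog.noReg, hrM]), hm]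
      have ha : ∀ a, (P.run t).arr a = t.arr a := fun a => hr.arr_eq (harr a)
      refine ⟨⟨h1, ?_⟩, ?_⟩
      · simp only [Prog.Safe, Prog.run, Expr.eval, State.setArr_reg]
        exact ⟨hb.1 _, hb.1 _, hb.1 _, hb.1 _, hb.1 _, hb.1 _⟩
      · intro i hi
        simp only [Prog.run, Expr.eval, State.setReg_arr, State.setArr_arr, State.setArr_reg, hrI,
          hrM', h2, h3, h4, ha, if_true, Nat.reduceEqDiff, if_false]
        rcases Nat.lt_succ_iff_lt_or_eq.mp hi with hi | rfl
        · have h5 : i ≠ k := by omega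
          have h6 : i ≠ m + k := by omega
          have h7 : m + i ≠ k := by omega
          have h8 : m + i ≠ m + k := by omega
          simpa [Function.update, h5, h6, h7, h8] using hIt i hi
        · have h6 : m ≠ 0 := by omega
          simp [Function.update, h6]) hs
    (by simp)
  refine ⟨s₁, h₁.mono ?_, hs₁⟩
  simp only [Prog.time, Expr.cost]
  exact Nat.mul_le_mul_right _ (by omega)

/-- One step of depth-first search. -/
def dfsStep : Prog :=
  .branch (.reg rCur)
    (.seq (.assign rX (.get aOrd (.sub (.reg rCur) (.const 1))))
    (.seq (.assign rQ (.get aHead (.reg rX)))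
      (.branch (.reg rQ)
        (.seq (.assign rY (.get aTgt (.sub (.reg rQ) (.const 1))))
        (.seq (.store aHead (.reg rX) (.get aNext (.reg rQ)))
          (.branch (.get aPre (.reg rY)) .skip
            (.seq (.store aOrd (.reg rCnt) (.reg rY))
            (.seq (.store aPar (.reg rCnt) (.reg rCur))
            (.seq (.store aTau (.reg rCnt) (addMod (.get aTau (.sub (.reg rCur) (.const 1)))
              (.get aSgn (.sub (.reg rQ) (.const 1)))))
            (.seq (.store aRoot (.reg rCnt) (.get aRoot (.sub (.reg rCur) (.const 1))))
            (.seq (.assign rCnt (.add (.reg rCnt) (.const 1)))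
            (.seq (.store aPre (.reg rY) (.reg rCnt))
              (.assign rCur (.reg rCnt)))))))))))
        (.assign rCur (.get aPar (.sub (.reg rCur) (.const 1)))))))
    (.branch (.get aPre (.reg rRoot))
      (.assign rRoot (.add (.reg rRoot) (.const 1)))
      (.seq (.store aOrd (.reg rCnt) (.reg rRoot))
      (.seq (.store aPar (.reg rCnt) (.const 0))
      (.seq (.store aTau (.reg rCnt) (.const 0))
      (.seq (.store aRoot (.reg rCnt) (.reg rCnt))
      (.seq (.assign rCnt (.add (.reg rCnt) (.const 1)))
      (.seq (.store aPre (.reg rRoot) (.reg rCnt))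
        (.assign rCur (.reg rCnt)))))))))

theorem dfsStep_spec {M n c : ℕ} {src tgt z nxt : ℕ → ℕ} {t : State} (ht : Bdd M t) (hM : 1 ≤ M)
    (hnM : n ≤ M) (hsrc : ∀ q < c, src q < n) (hz : ∀ q < c, z q ≤ 1)
    (hsymm : ∀ q < c, ∃ r < c, src r = tgt q ∧ tgt r = src q)
    (hnxt : ∀ i < c, IsLast src i (src i) (nxt (i + 1)))
    (h₂ : t.arr aTgt = tgt) (h₃ : t.arr aSgn = z)
    (h₄ : t.arr aNext = nxt)
    (hI : DfsInv n c src tgt z (t.arr aHead) (t.arr aPre) (t.arr aOrd) (t.arr aPar) (t.arr aTau)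
      (t.arr aRoot) (t.reg rRoot) (t.reg rCur) (t.reg rCnt)) (hrc : t.reg rRoot < n) :
    dfsStep.Safe M t ∧
    DfsInv n c src tgt z ((dfsStep.run t).arr aHead) ((dfsStep.run t).arr aPre)
      ((dfsStep.run t).arr aOrd) ((dfsStep.run t).arr aPar) ((dfsStep.run t).arr aTau)
      ((dfsStep.run t).arr aRoot) ((dfsStep.run t).reg rRoot) ((dfsStep.run t).reg rCur)
      ((dfsStep.run t).reg rCnt) ∧
    dfsPotential n c src ((dfsStep.run t).arr aHead) ((dfsStep.run t).arr aPar)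
      ((dfsStep.run t).reg rRoot) ((dfsStep.run t).reg rCur) ((dfsStep.run t).reg rCnt) <
    dfsPotential n c src (t.arr aHead) (t.arr aPar) (t.reg rRoot) (t.reg rCur) (t.reg rCnt) := by
  by_cases hcur : t.reg rCur = 0
  · by_cases hp : t.arr aPre (t.reg rRoot) = 0
    · have hcn := hI.cnt_lt hrc hp
      have h1 := hI.visit hsrc hsymm (t := 0) (r := t.reg rCnt) hrc hp (by omega) (fun _ => rfl)
        (fun h => absurd hcur h)
      have h2 := hI.potential_visit hcn
      rw [hcur] at h1 h2
      refine ⟨?_, ?_, ?_⟩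
      · simp [dfsStep, Prog.Safe, Prog.run, Expr.eval, hcur, hp]
        exact ⟨ht.1 _, ht.1 _, by omega⟩
      · simpa [dfsStep, Prog.run, Expr.eval, hcur, hp] using h1
      · simpa [dfsStep, Prog.run, Expr.eval, hcur, hp] using h2
    · have h1 := hI.next hrc hp
      have h2 := DfsInv.potential_next (n := n) (c := c) (src := src) (ptr := t.arr aHead)
        (pp := t.arr aPar) (cur := t.reg rCur) (cnt := t.reg rCnt) hrc
      refine ⟨?_, ?_, ?_⟩
      · simp [dfsStep, Prog.Safe, Prog.run, Expr.eval, hcur, hp]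
        omega
      · simpa [dfsStep, Prog.run, Expr.eval, hcur, hp] using h1
      · simpa [dfsStep, Prog.run, Expr.eval, hcur, hp] using h2
  · have hle := hI.cur_le
    have hcn := hI.cnt_le
    by_cases hq : t.arr aHead (t.arr aOrd (t.reg rCur - 1)) = 0
    · have h1 := hI.pop hcur hq
      have h2 := hI.potential_pop hcur
      refine ⟨?_, ?_, ?_⟩
      · simp [dfsStep, Prog.Safe, Prog.run, Expr.eval, hcur, hq]
        exact ⟨ht.2 _ _, ht.2 _ _⟩
      · simpa [dfsStep, Prog.run, Expr.eval, hcur, hq] using h1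
      · simpa [dfsStep, Prog.run, Expr.eval, hcur, hq] using h2
    · have hxn := hI.ord_lt (t.reg rCur - 1) (by omega)
      have hpx := hI.pre_ord (t.reg rCur - 1) (by omega)
      by_cases hy : t.arr aPre (tgt (t.arr aHead (t.arr aOrd (t.reg rCur - 1)) - 1)) = 0
      · obtain ⟨hqc, hqs⟩ := hI.ptr_last _ hxn
        have hqs := hqs.resolve_left hq
        have hyn : tgt (t.arr aHead (t.arr aOrd (t.reg rCur - 1)) - 1) < n := by
          obtain ⟨r, hr, h1, -⟩ := hsymm (t.arr aHead (t.arr aOrd (t.reg rCur - 1)) - 1) (by omega)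
          rw [← h1]
          exact hsrc r hr
        have hcn := hI.cnt_lt hyn hy
        have hτ := hI.tau_le (t.reg rCur - 1) (by omega)
        have hzq := hz (t.arr aHead (t.arr aOrd (t.reg rCur - 1)) - 1) (by omega)
        have hxy : t.arr aOrd (t.reg rCur - 1) ≠
            tgt (t.arr aHead (t.arr aOrd (t.reg rCur - 1)) - 1) := by
          intro he
          rw [← he] at hy
          omega
        have h1 := hI.visit hsrc hsymm
          (t := 1 - if t.arr aTau (t.reg rCur - 1) =
            z (t.arr aHead (t.arr aOrd (t.reg rCur - 1)) - 1) then 1 else 0)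
          (r := t.arr aRoot (t.reg rCur - 1)) hyn hy (by omega) (fun h => absurd h hcur)
          (fun _ => ⟨rfl, _, by omega, hqs, rfl, by split_ifs <;> omega⟩)
        have h2 := h1.advance hnxt hxn (by rw [Function.update_of_ne hxy]; omega) (by omega)
          (by
            rw [Function.update_of_ne hxy, hpx, Nat.add_sub_cancel, Nat.add_sub_cancel]
            exact .step (.refl _) (by rw [Function.update_self]; omega)) hq
          (by rw [Function.update_self]; omega)
        have h3 := hI.potential_visit hcn
        have h4 := hI.potential_advance hnxt hxn hq
          (Function.update (t.arr aPar) (t.reg rCnt) (t.reg rCur)) (t.reg rRoot)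
          (t.reg rCnt + 1) (t.reg rCnt + 1)
        have h5 := h4.trans h3
        refine ⟨?_, ?_, ?_⟩
        · simp [dfsStep, addMod, Prog.Safe, Prog.run, Expr.eval, hcur, hq, h₂, hy]
          exact ⟨ht.2 _ _, ht.2 _ _, by omega, ht.2 _ _, by omega, ht.1 _, by omega, ht.2 _ _,
            by omega⟩
        · simpa [dfsStep, addMod, Prog.run, Expr.eval, hcur, hq, h₂, h₃, h₄, hy] using h2
        · simpa [dfsStep, addMod, Prog.run, Expr.eval, hcur, hq, h₂, h₃, h₄, hy] using h5
      · have h1 := hI.advance hnxt hxn (by omega) hcur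
          (by rw [hpx, Nat.add_sub_cancel]; exact .refl _) hq hy
        have h2 := hI.potential_advance hnxt hxn hq (t.arr aPar) (t.reg rRoot) (t.reg rCur)
          (t.reg rCnt)
        refine ⟨?_, ?_, ?_⟩
        · simp [dfsStep, addMod, Prog.Safe, Prog.run, Expr.eval, hcur, hq, h₂, hy]
          exact ⟨ht.2 _ _, ht.2 _ _, h₂ ▸ ht.2 _ _, ht.2 _ _⟩
        · simpa [dfsStep, addMod, Prog.run, Expr.eval, hcur, hq, h₂, h₃, h₄, hy] using h1
        · simpa [dfsStep, addMod, Prog.run, Expr.eval, hcur, hq, h₂, h₃, h₄, hy] using h2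

/-- Depth-first search of the graph given by its arcs. -/
def dfsProg : Prog :=
  .seq (.assign rArcs (.add (.reg rM) (.reg rM)))
  (.seq (bucketProg aSrc rArcs)
  (.seq (.for rI rN (.store aPre (.reg rI) (.const 0)))
  (.seq (.seq (.assign rRoot (.const 0)) (.seq (.assign rCur (.const 0)) (.assign rCnt (.const 0))))
    (.loop (.lt (.reg rRoot) (.reg rN)) dfsStep))))

theorem dfsProg_spec {W M n m : ℕ} {x y z : ℕ → ℕ} (hM : 1 ≤ M) (hW : 20 * M < W) {s : State}
    (hs : Bdd M s) (hn : s.reg rN = n) (hm : s.reg rM = m) (hmM : m + m ≤ M)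
    (harcs : IsArcs m x y z (s.arr aSrc) (s.arr aTgt) (s.arr aSgn))
    (hx : ∀ i < m, x i < n) (hy : ∀ i < m, y i < n) (hz : ∀ i < m, z i ≤ 1) :
    ∃ s', Runs W M dfsProg s s' (1000 * (n + m + 1)) ∧
      IsDfs n (m + m) (s.arr aSrc) (s.arr aTgt) (s.arr aSgn) (s'.arr aPre) (s'.arr aOrd)
        (s'.arr aPar) (s'.arr aTau) (s'.arr aRoot) := by
  have hcases : ∀ q < m + m, q < m ∨ ∃ i < m, q = m + i := fun q hq => by
    rcases lt_or_ge q m with h | h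
    · exact .inl h
    · exact .inr ⟨q - m, by omega, by omega⟩
  have hsrc : ∀ q < m + m, s.arr aSrc q < n := by
    intro q hq
    rcases hcases q hq with h | ⟨i, h, rfl⟩
    · rw [(harcs q h).1]; exact hx q h
    · rw [(harcs i h).2.2.2.1]; exact hy i h
  have htgt : ∀ q < m + m, s.arr aTgt q < n := by
    intro q hq
    rcases hcases q hq with h | ⟨i, h, rfl⟩
    · rw [(harcs q h).2.1]; exact hy q h
    · rw [(harcs i h).2.2.2.2.1]; exact hx i h
  have hsgn : ∀ q < m + m, s.arr aSgn q ≤ 1 := by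
    intro q hq
    rcases hcases q hq with h | ⟨i, h, rfl⟩
    · rw [(harcs q h).2.2.1]; exact hz q h
    · rw [(harcs i h).2.2.2.2.2]; exact hz i h
  have hsymm : ∀ q < m + m, ∃ r < m + m, s.arr aSrc r = s.arr aTgt q ∧
      s.arr aTgt r = s.arr aSrc q := by
    intro q hq
    rcases hcases q hq with h | ⟨i, h, rfl⟩
    · obtain ⟨h1, h2, -, h3, h4, -⟩ := harcs q h
      exact ⟨m + q, by omega, by rw [h3, h2], by rw [h4, h1]⟩
    · obtain ⟨h1, h2, -, h3, h4, -⟩ := harcs i h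
      exact ⟨i, by omega, by rw [h1, h4], by rw [h2, h3]⟩
  have hnM : n ≤ M := hn ▸ hs.1 _
  have r₁ : Runs W M (.assign rArcs (.add (.reg rM) (.reg rM))) s _ _ :=
    Runs.of_safe hM hW (.assign rArcs (.add (.reg rM) (.reg rM))) rfl hs
      (by simp only [Prog.Safe, Expr.eval, hm]; exact hmM)
  set s₁ := (Prog.assign rArcs (.add (.reg rM) (.reg rM))).run s with hs₁
  have h1n : s₁.reg rN = n := (r₁.reg_eq rfl).trans hn
  have h1c : s₁.reg rArcs = m + m := by simp [hs₁, Prog.run, Expr.eval, hm]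
  have h1a : s₁.arr = s.arr := rfl
  obtain ⟨s₂, r₂, hb⟩ := bucketProg_spec (n := n) (c := m + m) (key := aSrc) (cnt := rArcs) hM hW
    r₁.bdd (by decide) (by decide) (by decide) h1n h1c hsrc
  obtain ⟨s₃, r₃, hz₃⟩ := Runs.for (s₀ := s₂) (N := n) hM hW rI rN
    (P := .store aPre (.reg rI) (.const 0)) rfl (by decide) rfl rfl
    (fun k t => ∀ i < k, t.arr aPre i = 0) ((r₂.reg_eq rfl).trans h1n)
    (by
      intro k hk t ht hf hxk hI
      refine ⟨Nat.zero_le _, ?_⟩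
      intro i hi
      rcases eq_or_ne i k with rfl | hne
      · simp [Prog.run, Expr.eval, hxk]
      · have := hI i (by omega)
        simpa [Prog.run, Expr.eval, hxk, hne] using this) r₂.bdd (by simp)
  have r₄ : Runs W M (.seq (.assign rRoot (.const 0)) (.seq (.assign rCur (.const 0))
      (.assign rCnt (.const 0)))) s₃ _ _ :=
    Runs.of_safe hM hW (.seq (.assign rRoot (.const 0)) (.seq (.assign rCur (.const 0))
      (.assign rCnt (.const 0)))) rfl r₃.bdd (by simp [Prog.Safe, Expr.eval])
  set s₄ := (Prog.seq (.assign rRoot (.const 0)) (.seq (.assign rCur (.const 0))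
      (.assign rCnt (.const 0)))).run s₃ with hs₄
  have h4n : s₄.reg rN = n :=
    (r₄.reg_eq rfl).trans ((r₃.reg_eq rfl).trans ((r₂.reg_eq rfl).trans h1n))
  have h4r : s₄.reg rRoot = 0 ∧ s₄.reg rCur = 0 ∧ s₄.reg rCnt = 0 := by
    simp [hs₄, Prog.run, Expr.eval]
  have h4t : s₄.arr aTgt = s.arr aTgt :=
    (r₄.arr_eq rfl).trans ((r₃.arr_eq rfl).trans (r₂.arr_eq rfl))
  have h4s : s₄.arr aSgn = s.arr aSgn :=
    (r₄.arr_eq rfl).trans ((r₃.arr_eq rfl).trans (r₂.arr_eq rfl))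
  have h4h : s₄.arr aHead = s₂.arr aHead := (r₄.arr_eq rfl).trans (r₃.arr_eq rfl)
  have h4x : s₄.arr aNext = s₂.arr aNext := (r₄.arr_eq rfl).trans (r₃.arr_eq rfl)
  have h4p : s₄.arr aPre = s₃.arr aPre := r₄.arr_eq rfl
  obtain ⟨s₅, r₅, hI₅, hb₅⟩ := Runs.loop (s₀ := s₄) hM hW (b := .lt (.reg rRoot) (.reg rN))
    (P := dfsStep) rfl
    (fun t => DfsInv n (m + m) (s.arr aSrc) (s.arr aTgt) (s.arr aSgn) (t.arr aHead) (t.arr aPre)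
      (t.arr aOrd) (t.arr aPar) (t.arr aTau) (t.arr aRoot) (t.reg rRoot) (t.reg rCur) (t.reg rCnt))
    (fun t => dfsPotential n (m + m) (s.arr aSrc) (t.arr aHead) (t.arr aPar) (t.reg rRoot)
      (t.reg rCur) (t.reg rCnt))
    (by
      intro t ht hf hI hbt
      refine dfsStep_spec ht hM hnM hsrc hsgn hsymm hb.nxt_last
        ((hf.2 aTgt rfl).trans h4t) ((hf.2 aSgn rfl).trans h4s) ((hf.2 aNext rfl).trans h4x) hI ?_
      simp only [Expr.eval, hf.1 rN rfl, h4n] at hbt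
      by_contra h
      exact hbt (if_neg h)) r₄.bdd
    (by
      rw [h4r.1, h4r.2.1, h4r.2.2, h4h, h4p]
      exact DfsInv.init hsrc hb.head_last hz₃)
  have hroot : s₅.reg rRoot = n := by
    simp only [Expr.eval, (r₅.reg_eq rfl).trans h4n] at hb₅
    refine le_antisymm hI₅.rc_le ?_
    by_contra h
    simp [not_le.mp h] at hb₅
  simp only [hroot] at hI₅
  refine ⟨s₅, (r₁.seq (r₂.seq (r₃.seq (r₄.seq r₅)))).mono ?_, hI₅.isDfs hsrc htgt⟩
  have hpot : dfsPotential n (m + m) (s.arr aSrc) (s₄.arr aHead) (s₄.arr aPar) (s₄.reg rRoot)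
      (s₄.reg rCur) (s₄.reg rCnt) ≤ 2 * m + 4 * n := by
    have := dfsPotential_le n (m + m) (s.arr aSrc) (s₄.arr aHead) (s₄.arr aPar) (s₄.reg rRoot)
      (s₄.reg rCur) (s₄.reg rCnt)
    omega
  have ht : dfsStep.time ≤ 100 := by decide
  have h1 : (dfsStep.time + (Expr.lt (.reg rRoot) (.reg rN)).cost + 1) ≤ 104 := by
    simp only [Expr.cost]; omega
  have h2 := Nat.mul_le_mul h1 (Nat.add_le_add_right hpot 1)
  refine le_trans (Nat.add_le_add_left (Nat.add_le_add_left (Nat.add_le_add_left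
    (Nat.add_le_add_left h2 _) _) _) _) ?_
  simp only [Prog.time, Expr.cost]
  omega

/-! ### Cutting links on the RAM -/

/-- The ends of all edges as preorder numbers: `aLow` gets the larger and `aUp` the smaller one. -/
def endsProg : Prog :=
  .for rI rM
    (.seq (.assign rX (.sub (.get aPre (.get aSrc (.reg rI))) (.const 1)))
    (.seq (.assign rY (.sub (.get aPre (.get aTgt (.reg rI))) (.const 1)))
      (.branch (.lt (.reg rX) (.reg rY))
        (.seq (.store aLow (.reg rI) (.reg rY)) (.store aUp (.reg rI) (.reg rX)))
        (.seq (.store aLow (.reg rI) (.reg rX)) (.store aUp (.reg rI) (.reg rY))))))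

theorem endsProg_spec {W M m : ℕ} (hM : 1 ≤ M) (hW : 20 * M < W) {s : State} (hs : Bdd M s)
    (hm : s.reg rM = m) :
    ∃ s', Runs W M endsProg s s' (100 * (m + 1)) ∧ ∀ i < m,
      s'.arr aLow i = max (s.arr aPre (s.arr aSrc i) - 1) (s.arr aPre (s.arr aTgt i) - 1) ∧
      s'.arr aUp i = min (s.arr aPre (s.arr aSrc i) - 1) (s.arr aPre (s.arr aTgt i) - 1) := by
  obtain ⟨s', h, hI⟩ := Runs.for (s₀ := s) hM hW rI rM
    (P := .seq (.assign rX (.sub (.get aPre (.get aSrc (.reg rI))) (.const 1)))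
    (.seq (.assign rY (.sub (.get aPre (.get aTgt (.reg rI))) (.const 1)))
      (.branch (.lt (.reg rX) (.reg rY))
        (.seq (.store aLow (.reg rI) (.reg rY)) (.store aUp (.reg rI) (.reg rX)))
        (.seq (.store aLow (.reg rI) (.reg rX)) (.store aUp (.reg rI) (.reg rY))))))
    rfl (by decide) rfl rfl
    (fun k t => ∀ i < k,
      t.arr aLow i = max (s.arr aPre (s.arr aSrc i) - 1) (s.arr aPre (s.arr aTgt i) - 1) ∧
      t.arr aUp i = min (s.arr aPre (s.arr aSrc i) - 1) (s.arr aPre (s.arr aTgt i) - 1)) hm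
    (by
      intro k hk t ht hf hx hI
      have h1 : t.arr aPre = s.arr aPre := hf.2 _ rfl
      have h2 : t.arr aSrc = s.arr aSrc := hf.2 _ rfl
      have h3 : t.arr aTgt = s.arr aTgt := hf.2 _ rfl
      have h4 := ht.2 aPre (t.arr aSrc k)
      have h5 := ht.2 aPre (t.arr aTgt k)
      refine ⟨?_, fun i hi => ?_⟩
      · simp [Prog.Safe, Prog.run, Expr.eval, hx]
        omega
      · by_cases hlt : s.arr aPre (s.arr aSrc k) - 1 < s.arr aPre (s.arr aTgt k) - 1 <;>
        rcases Nat.lt_succ_iff_lt_or_eq.mp hi with hi | rfl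
        · simpa [Prog.run, Expr.eval, hx, h1, h2, h3, hlt, hi.ne] using hI i hi
        · simp [Prog.run, Expr.eval, hx, h1, h2, h3, hlt, hlt.le]
        · simpa [Prog.run, Expr.eval, hx, h1, h2, h3, hlt, hi.ne] using hI i hi
        · simp [Prog.run, Expr.eval, hx, h1, h2, h3, hlt, not_lt.mp hlt]) hs (by simp)
  exact ⟨s', h.mono (by simp only [Prog.time, Expr.cost]; omega), hI⟩

/-- Clear the arrays that are updated incrementally. -/
def clearProg : Prog :=
  .for rI rN
    (.seq (.store aHi (.reg rI) (.const 0)) (.seq (.store aCut (.reg rI) (.const 0))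
    (.seq (.store aSat (.reg rI) (.const 0)) (.store aVio (.reg rI) (.const 0)))))

theorem clearProg_spec {W M n : ℕ} (hM : 1 ≤ M) (hW : 20 * M < W) {s : State} (hs : Bdd M s)
    (hn : s.reg rN = n) :
    ∃ s', Runs W M clearProg s s' (50 * (n + 1)) ∧ ∀ i < n,
      s'.arr aHi i = 0 ∧ s'.arr aCut i = 0 ∧ s'.arr aSat i = 0 ∧ s'.arr aVio i = 0 := by
  obtain ⟨s', h, hI⟩ := Runs.for (s₀ := s) hM hW rI rN
    (P := .seq (.store aHi (.reg rI) (.const 0)) (.seq (.store aCut (.reg rI) (.const 0))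
    (.seq (.store aSat (.reg rI) (.const 0)) (.store aVio (.reg rI) (.const 0)))))
    rfl (by decide) rfl rfl
    (fun k t => ∀ i < k, t.arr aHi i = 0 ∧ t.arr aCut i = 0 ∧ t.arr aSat i = 0 ∧ t.arr aVio i = 0)
      hn
    (by
      intro k hk t ht hf hx hI
      refine ⟨by simp [Prog.Safe, Expr.eval], fun i hi => ?_⟩
      rcases Nat.lt_succ_iff_lt_or_eq.mp hi with hi | rfl
      · simpa [Prog.run, Expr.eval, hx, hi.ne] using hI i hi
      · simp [Prog.run, Expr.eval, hx]) hs (by simp)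
  exact ⟨s', h.mono (by simp only [Prog.time, Expr.cost]; omega), hI⟩

/-- The invariant of the computation of the deepest upper ends of the violated edges with a given
lower end, after `K` edges. -/
structure HiInv (n m : ℕ) (el eu z tau hi : ℕ → ℕ) (K : ℕ) : Prop where
  hi_edge : ∀ i < K, eu i < el i → (tau (el i) + tau (eu i) + z i) % 2 ≠ 0 → eu i + 1 ≤ hi (el i)
  wit : ∀ k < n, hi k ≠ 0 → ∃ i < m, eu i < el i ∧ (tau (el i) + tau (eu i) + z i) % 2 ≠ 0 ∧
    eu i + 1 = hi k ∧ el i = k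

theorem HiInv.skip {n m : ℕ} {el eu z tau hi : ℕ → ℕ} {K : ℕ} (h : HiInv n m el eu z tau hi K)
    (hK : ¬ (eu K < el K ∧ (tau (el K) + tau (eu K) + z K) % 2 ≠ 0)) :
    HiInv n m el eu z tau hi (K + 1) where
  hi_edge i hi' h1 h2 := by
    rcases Nat.lt_succ_iff_lt_or_eq.mp hi' with hi' | rfl
    exacts [h.hi_edge i hi' h1 h2, absurd ⟨h1, h2⟩ hK]
  wit := h.wit

theorem HiInv.update {n m : ℕ} {el eu z tau hi : ℕ → ℕ} {K : ℕ} (h : HiInv n m el eu z tau hi K)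
    (hKm : K < m) (hlt : eu K < el K) (hbad : (tau (el K) + tau (eu K) + z K) % 2 ≠ 0) :
    HiInv n m el eu z tau
      (Function.update hi (el K) (hi (el K) + (eu K + 1 - hi (el K)))) (K + 1) where
  hi_edge i hi' h1 h2 := by
    rcases Nat.lt_succ_iff_lt_or_eq.mp hi' with hi' | rfl
    · have := h.hi_edge i hi' h1 h2
      rcases eq_or_ne (el i) (el K) with he | hne
      · rw [he] at this ⊢
        rw [Function.update_self]; omega
      · rwa [Function.update_of_ne hne]
    · rw [Function.update_self]; omega
  wit k hk hk0 := by
    rcases eq_or_ne k (el K) with rfl | hne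
    · rw [Function.update_self] at hk0 ⊢
      rcases le_or_gt (eu K + 1) (hi (el K)) with hle | hgt
      · obtain ⟨i, h1, h2, h3, h4, h5⟩ := h.wit (el K) hk (by omega)
        exact ⟨i, h1, h2, h3, by omega, h5⟩
      · exact ⟨K, hKm, hlt, hbad, by omega, rfl⟩
    · rw [Function.update_of_ne hne] at hk0 ⊢
      exact h.wit k hk hk0

/-- For every vertex, the deepest upper end of a violated edge with this lower end. -/
def hiProg : Prog :=
  .for rI rM
    (.branch (.lt (.get aUp (.reg rI)) (.get aLow (.reg rI)))
      (.branch (.eq (.eq (.get aTau (.get aLow (.reg rI))) (.get aTau (.get aUp (.reg rI))))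
          (.get aSgn (.reg rI)))
        (.store aHi (.get aLow (.reg rI)) (.add (.get aHi (.get aLow (.reg rI)))
          (.sub (.add (.get aUp (.reg rI)) (.const 1)) (.get aHi (.get aLow (.reg rI))))))
        .skip) .skip)

/-- A comparison of bits expresses that a sum of three bits is odd. -/
theorem eq_ite_iff {a b c : ℕ} (ha : a ≤ 1) (hb : b ≤ 1) (hc : c ≤ 1) :
    ((if a = b then 1 else 0) = c) ↔ (a + b + c) % 2 ≠ 0 := by
  split_ifs <;> omega

theorem hiProg_spec {W M n m : ℕ} (hM : 1 ≤ M) (hW : 20 * M < W) {s : State} (hs : Bdd M s)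
    (hm : s.reg rM = m) (hnM : n ≤ M) (hlow : ∀ i < m, s.arr aLow i < n)
    (htau : ∀ k < n, s.arr aTau k ≤ 1) (hsgn : ∀ i < m, s.arr aSgn i ≤ 1)
    (hz : ∀ k < n, s.arr aHi k = 0) :
    ∃ s', Runs W M hiProg s s' (100 * (m + 1)) ∧
      HiInv n m (s.arr aLow) (s.arr aUp) (s.arr aSgn) (s.arr aTau) (s'.arr aHi) m := by
  obtain ⟨s', h, hI⟩ := Runs.for (s₀ := s) hM hW rI rM
    (P := .branch (.lt (.get aUp (.reg rI)) (.get aLow (.reg rI)))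
      (.branch (.eq (.eq (.get aTau (.get aLow (.reg rI))) (.get aTau (.get aUp (.reg rI))))
          (.get aSgn (.reg rI)))
        (.store aHi (.get aLow (.reg rI)) (.add (.get aHi (.get aLow (.reg rI)))
          (.sub (.add (.get aUp (.reg rI)) (.const 1)) (.get aHi (.get aLow (.reg rI))))))
        .skip) .skip)
    rfl (by decide) rfl rfl
    (fun k t => HiInv n m (s.arr aLow) (s.arr aUp) (s.arr aSgn) (s.arr aTau) (t.arr aHi) k) hm
    (by
      intro k hk t ht hf hx hI
      have h1 : t.arr aLow = s.arr aLow := hf.2 _ rfl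
      have h2 : t.arr aUp = s.arr aUp := hf.2 _ rfl
      have h3 : t.arr aSgn = s.arr aSgn := hf.2 _ rfl
      have h4 : t.arr aTau = s.arr aTau := hf.2 _ rfl
      have h5 := hlow k hk
      have h6 := ht.2 aHi (s.arr aLow k)
      by_cases hlt : s.arr aUp k < s.arr aLow k
      · have h7 := eq_ite_iff (htau _ h5) (htau _ (hlt.trans h5)) (hsgn k hk)
        by_cases hbad : (if s.arr aTau (s.arr aLow k) = s.arr aTau (s.arr aUp k) then 1 else 0) =
            s.arr aSgn k
        · refine ⟨?_, ?_⟩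
          · simp [Prog.Safe, Expr.eval, hx, h1, h2, h3, h4, hlt, hbad]
            omega
          · simpa [Prog.run, Expr.eval, hx, h1, h2, h3, h4, hlt, hbad] using
              hI.update hk hlt (h7.mp hbad)
        · refine ⟨?_, ?_⟩
          · simp [Prog.Safe, Expr.eval, hx, h1, h2, h3, h4, hlt, hbad]
          · simpa [Prog.run, Expr.eval, hx, h1, h2, h3, h4, hlt, hbad] using
              hI.skip fun h => hbad (h7.mpr h.2)
      · refine ⟨?_, ?_⟩
        · simp [Prog.Safe, Expr.eval, hx, h1, h2, hlt]
        · simpa [Prog.run, Expr.eval, hx, h1, h2, hlt] using hI.skip fun h => hlt h.1) hs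
    ⟨by simp, fun k hk h0 => absurd (hz k hk) h0⟩
  exact ⟨s', h.mono (by simp only [Prog.time, Expr.cost]; omega), hI⟩

/-- Go through the vertices in reverse preorder and decide which links are kept. -/
def cutProg : Prog :=
  .for rI rN
    (.seq (.assign rX (.sub (.reg rN) (.add (.reg rI) (.const 1))))
    (.seq (.assign rY (.get aPar (.reg rX)))
      (.branch (.reg rY)
        (.branch (.lt (.get aHi (.reg rX)) (.reg rY))
          (.seq (.store aCut (.reg rX) (.reg rY))
            (.store aHi (.sub (.reg rY) (.const 1)) (.add (.get aHi (.sub (.reg rY) (.const 1)))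
              (.sub (.get aHi (.reg rX)) (.get aHi (.sub (.reg rY) (.const 1)))))))
          .skip) .skip)))

theorem cutProg_spec {W M n m : ℕ} (hM : 1 ≤ M) (hW : 20 * M < W) {s : State} (hs : Bdd M s)
    (hn : s.reg rN = n) {el eu z tau : ℕ → ℕ} (hpp : ∀ k < n, s.arr aPar k ≤ k)
    (h0 : CutInv n m el eu z (s.arr aPar) tau (s.arr aHi) (s.arr aCut) n) :
    ∃ s', Runs W M cutProg s s' (100 * (n + 1)) ∧
      CutInv n m el eu z (s.arr aPar) tau (s'.arr aHi) (s'.arr aCut) 0 := by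
  obtain ⟨s', h, hI⟩ := Runs.for (s₀ := s) hM hW rI rN
    (P := .seq (.assign rX (.sub (.reg rN) (.add (.reg rI) (.const 1))))
    (.seq (.assign rY (.get aPar (.reg rX)))
      (.branch (.reg rY)
        (.branch (.lt (.get aHi (.reg rX)) (.reg rY))
          (.seq (.store aCut (.reg rX) (.reg rY))
            (.store aHi (.sub (.reg rY) (.const 1)) (.add (.get aHi (.sub (.reg rY) (.const 1)))
              (.sub (.get aHi (.reg rX)) (.get aHi (.sub (.reg rY) (.const 1)))))))
          .skip) .skip)))
    rfl (by decide) rfl rfl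
    (fun k t => CutInv n m el eu z (s.arr aPar) tau (t.arr aHi) (t.arr aCut) (n - k)) hn
    (by
      intro k hk t ht hf hx hI
      have h1 : t.arr aPar = s.arr aPar := hf.2 _ rfl
      have h2 : t.reg rN = n := (hf.1 _ rfl).trans hn
      obtain ⟨x, hxk⟩ : ∃ x, n - (k + 1) = x := ⟨_, rfl⟩
      have h3 : n - k = x + 1 := by omega
      have hnM : n ≤ M := h2 ▸ ht.1 _
      have h4 := ht.2 aPar x
      have h5 := ht.2 aHi x
      have h6 := ht.2 aHi (s.arr aPar x - 1)
      rw [h1] at h4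
      rw [h3] at hI
      by_cases hp : s.arr aPar x = 0
      · refine ⟨?_, ?_⟩
        · simp [Prog.Safe, Prog.run, Expr.eval, hx, h1, h2, hxk, hp]
          omega
        · simpa [Prog.run, Expr.eval, hx, h1, h2, hxk, hp] using hI.skip (.inl hp)
      · by_cases hlt : t.arr aHi x < s.arr aPar x
        · refine ⟨?_, ?_⟩
          · simp [Prog.Safe, Prog.run, Expr.eval, hx, h1, h2, hxk, hp, hlt]
            omega
          · simpa [Prog.run, Expr.eval, hx, h1, h2, hxk, hp, hlt] using
              hI.keep (by omega) hpp hp hlt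
        · refine ⟨?_, ?_⟩
          · simp [Prog.Safe, Prog.run, Expr.eval, hx, h1, h2, hxk, hp, hlt]
            omega
          · simpa [Prog.run, Expr.eval, hx, h1, h2, hxk, hp, hlt] using
              hI.skip (.inr (by omega))) hs
    (by simpa using h0)
  exact ⟨s', h.mono (by simp only [Prog.time, Expr.cost]; omega), by simpa using hI⟩

/-- Compute the tops of the components. -/
def topProg : Prog :=
  .for rI rN
    (.branch (.get aCut (.reg rI))
      (.store aTop (.reg rI) (.get aTop (.sub (.get aCut (.reg rI)) (.const 1))))
      (.store aTop (.reg rI) (.reg rI)))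

theorem topProg_spec {W M n : ℕ} (hM : 1 ≤ M) (hW : 20 * M < W) {s : State} (hs : Bdd M s)
    (hn : s.reg rN = n) (hcp : ∀ k < n, s.arr aCut k ≤ k) :
    ∃ s', Runs W M topProg s s' (50 * (n + 1)) ∧ ∀ k < n,
      s'.arr aTop k = if s.arr aCut k = 0 then k else s'.arr aTop (s.arr aCut k - 1) := by
  obtain ⟨s', h, hI⟩ := Runs.for (s₀ := s) hM hW rI rN
    (P := .branch (.get aCut (.reg rI))
      (.store aTop (.reg rI) (.get aTop (.sub (.get aCut (.reg rI)) (.const 1))))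
      (.store aTop (.reg rI) (.reg rI)))
    rfl (by decide) rfl rfl
    (fun j t => ∀ k < j, t.arr aTop k =
      if s.arr aCut k = 0 then k else t.arr aTop (s.arr aCut k - 1)) hn
    (by
      intro k hk t ht hf hx hI
      have h1 : t.arr aCut = s.arr aCut := hf.2 _ rfl
      have h2 := hcp k hk
      refine ⟨?_, fun i hi => ?_⟩
      · by_cases hc : s.arr aCut k = 0
        · simpa [Prog.Safe, Expr.eval, hx, h1, hc] using hx ▸ ht.1 rI
        · simpa [Prog.Safe, Expr.eval, hx, h1, hc] using ht.2 _ _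
      · have h4 := hcp i (by omega)
        have key : ∀ v : ℕ, (s.arr aCut k = 0 → v = k) →
            (s.arr aCut k ≠ 0 → v = t.arr aTop (s.arr aCut k - 1)) →
            Function.update (t.arr aTop) k v i = if s.arr aCut i = 0 then i
              else Function.update (t.arr aTop) k v (s.arr aCut i - 1) := by
          intro v hv1 hv2
          rcases Nat.lt_succ_iff_lt_or_eq.mp hi with hi | rfl
          · rw [Function.update_of_ne (by omega), Function.update_of_ne (by omega)]
            exact hI i hi
          · rw [Function.update_self]
            split_ifs with hc
            · exact hv1 hc
            · rw [Function.update_of_ne (by omega)]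
              exact hv2 hc
        by_cases hc : s.arr aCut k = 0
        · simpa [Prog.run, Expr.eval, hx, h1, hc] using key k (fun _ => rfl) (fun h => absurd hc h)
        · simpa [Prog.run, Expr.eval, hx, h1, hc] using
            key (t.arr aTop (s.arr aCut k - 1)) (fun h => absurd h hc) (fun _ => rfl)) hs
    (by simp)
  exact ⟨s', h.mono (by simp only [Prog.time, Expr.cost]; omega), hI⟩

/-- Decompose the depth-first forest by cutting links. -/
def forestProg : Prog :=
  .seq clearProg (.seq endsProg (.seq hiProg (.seq cutProg topProg)))

theorem forestProg_spec {W M n m : ℕ} {x y z : ℕ → ℕ} (hM : 1 ≤ M) (hW : 20 * M < W) {s : State}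
    (hs : Bdd M s) (hn : s.reg rN = n) (hm : s.reg rM = m)
    (harcs : IsArcs m x y z (s.arr aSrc) (s.arr aTgt) (s.arr aSgn))
    (hx : ∀ i < m, x i < n) (hy : ∀ i < m, y i < n) (hz : ∀ i < m, z i ≤ 1)
    (hd : IsDfs n (m + m) (s.arr aSrc) (s.arr aTgt) (s.arr aSgn) (s.arr aPre) (s.arr aOrd)
        (s.arr aPar) (s.arr aTau) (s.arr aRoot)) :
    ∃ s', Runs W M forestProg s s' (1000 * (n + m + 1)) ∧
      CutForest n m (s'.arr aLow) (s'.arr aUp) (s.arr aSgn) (s.arr aPar) (s.arr aTau) (s'.arr aHi)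
        (s'.arr aCut) (s'.arr aTop) ∧
      (∀ k < n, s'.arr aSat k = 0 ∧ s'.arr aVio k = 0) ∧
      ∀ i < m, s'.arr aLow i = max (s.arr aPre (x i) - 1) (s.arr aPre (y i) - 1) ∧
        s'.arr aUp i = min (s.arr aPre (x i) - 1) (s.arr aPre (y i) - 1) := by
  have hnM : n ≤ M := hn ▸ hs.1 _
  obtain ⟨s₁, r₁, h₁⟩ := clearProg_spec hM hW hs hn
  obtain ⟨s₂, r₂, h₂⟩ := endsProg_spec (m := m) hM hW r₁.bdd ((r₁.reg_eq rfl).trans hm)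
  have he : ∀ i < m, s₂.arr aLow i = max (s.arr aPre (x i) - 1) (s.arr aPre (y i) - 1) ∧
      s₂.arr aUp i = min (s.arr aPre (x i) - 1) (s.arr aPre (y i) - 1) := by
    intro i hi
    have := h₂ i hi
    rwa [r₁.arr_eq rfl, r₁.arr_eq rfl, r₁.arr_eq rfl, (harcs i hi).1, (harcs i hi).2.1] at this
  have hlow : ∀ i < m, s₂.arr aLow i < n := by
    intro i hi
    have h1 := hd.pre_le _ (hx i hi)
    have h2 := hd.pre_le _ (hy i hi)
    have h3 := hd.pre_ne _ (hx i hi)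
    rw [(he i hi).1]
    omega
  have hsgn : ∀ i < m, s.arr aSgn i ≤ 1 := fun i hi => (harcs i hi).2.2.1 ▸ hz i hi
  have e2sgn : s₂.arr aSgn = s.arr aSgn := (r₂.arr_eq rfl).trans (r₁.arr_eq rfl)
  have e2tau : s₂.arr aTau = s.arr aTau := (r₂.arr_eq rfl).trans (r₁.arr_eq rfl)
  have e2par : s₂.arr aPar = s.arr aPar := (r₂.arr_eq rfl).trans (r₁.arr_eq rfl)
  have e2hi : s₂.arr aHi = s₁.arr aHi := r₂.arr_eq rfl
  have e2cut : s₂.arr aCut = s₁.arr aCut := r₂.arr_eq rfl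
  obtain ⟨s₃, r₃, h₃⟩ := hiProg_spec (n := n) (m := m) hM hW r₂.bdd
    ((r₂.reg_eq rfl).trans ((r₁.reg_eq rfl).trans hm)) hnM hlow
    (by rw [e2tau]; exact hd.tau_le) (by rw [e2sgn]; exact hsgn)
    (by rw [e2hi]; exact fun k hk => (h₁ k hk).1)
  rw [e2sgn, e2tau] at h₃
  have e3par : s₃.arr aPar = s.arr aPar := (r₃.arr_eq rfl).trans e2par
  have e3cut : s₃.arr aCut = s₁.arr aCut := (r₃.arr_eq rfl).trans e2cut
  have e3n : s₃.reg rN = n :=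
    (r₃.reg_eq rfl).trans ((r₂.reg_eq rfl).trans ((r₁.reg_eq rfl).trans hn))
  obtain ⟨s₄, r₄, h₄⟩ := cutProg_spec (m := m) (el := s₂.arr aLow) (eu := s₂.arr aUp)
    (z := s.arr aSgn) (tau := s.arr aTau) hM hW r₃.bdd e3n (by rw [e3par]; exact hd.pp_le)
    { hi_edge := h₃.hi_edge
      cp_ne := fun k hk hk' => absurd hk (by omega)
      cp_zero := fun k hk hk' => absurd hk (by omega)
      unset := fun k hk => by rw [e3cut]; exact (h₁ k hk).2.1
      wit := fun k hk h0 => by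
        obtain ⟨i, g1, g2, g3, g4, g5⟩ := h₃.wit k hk h0
        exact ⟨i, g1, g2, g3, g4, g5 ▸ .refl _⟩ }
  rw [e3par] at h₄
  obtain ⟨s₅, r₅, h₅⟩ := topProg_spec (n := n) hM hW r₄.bdd ((r₄.reg_eq rfl).trans e3n)
    (fun k hk => by
      by_cases h0 : s₄.arr aCut k = 0
      · omega
      · rw [(h₄.cp_ne k hk (Nat.zero_le _) h0).1]; exact hd.pp_le k hk)
  have e5low : s₅.arr aLow = s₂.arr aLow :=
    (r₅.arr_eq rfl).trans ((r₄.arr_eq rfl).trans (r₃.arr_eq rfl))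
  have e5up : s₅.arr aUp = s₂.arr aUp :=
    (r₅.arr_eq rfl).trans ((r₄.arr_eq rfl).trans (r₃.arr_eq rfl))
  have e5hi : s₅.arr aHi = s₄.arr aHi := r₅.arr_eq rfl
  have e5cut : s₅.arr aCut = s₄.arr aCut := r₅.arr_eq rfl
  have e5sat : s₅.arr aSat = s₁.arr aSat :=
    (r₅.arr_eq rfl).trans ((r₄.arr_eq rfl).trans ((r₃.arr_eq rfl).trans (r₂.arr_eq rfl)))
  have e5vio : s₅.arr aVio = s₁.arr aVio :=
    (r₅.arr_eq rfl).trans ((r₄.arr_eq rfl).trans ((r₃.arr_eq rfl).trans (r₂.arr_eq rfl)))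
  refine ⟨s₅, (r₁.seq (r₂.seq (r₃.seq (r₄.seq r₅)))).mono (by omega), ?_, ?_, ?_⟩
  · rw [e5low, e5up, e5hi, e5cut]
    exact
    { el_lt := hlow
      anc := by
        intro i hi
        have hp := hd.comparable i (by omega)
        rw [(harcs i hi).1, (harcs i hi).2.1] at hp
        obtain ⟨h1, h2⟩ := he i hi
        have h3 := hd.pre_le _ (hx i hi)
        have h4 := hd.pre_le _ (hy i hi)
        have h5 := hd.pre_ne _ (hx i hi)
        have h6 := hd.pre_ne _ (hy i hi)
        rcases hp with hp | hp <;> have h7 := hp.le hd.pp_le (by omega)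
        · rwa [h1, h2, max_eq_right h7, min_eq_left h7]
        · rwa [h1, h2, max_eq_left h7, min_eq_right h7]
      pp_le := hd.pp_le
      tree := by
        intro k hk h0
        have hple := hd.pp_le k hk
        obtain ⟨-, q, hq, h1, h2, h3⟩ := hd.tree k hk h0
        have hpk := hd.pre_ord k hk
        have hpp := hd.pre_ord (s.arr aPar k - 1) (by omega)
        rcases lt_or_ge q m with hqm | hqm
        · obtain ⟨g1, g2, -⟩ := harcs q hqm
          obtain ⟨g3, g4⟩ := he q hqm
          rw [← g1, ← g2, h1, h2, hpk, hpp] at g3 g4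
          have g5 : s₂.arr aUp q = s.arr aPar k - 1 := by omega
          exact ⟨q, hqm, by omega, by omega, by rw [g5]; exact h3⟩
        · obtain ⟨i, rfl⟩ : ∃ i, q = m + i := ⟨q - m, by omega⟩
          obtain ⟨-, -, g0, g1, g2, g0'⟩ := harcs i (by omega)
          obtain ⟨g3, g4⟩ := he i (by omega)
          rw [← g1, ← g2, h1, h2, hpk, hpp] at g3 g4
          have g5 : s₂.arr aUp i = s.arr aPar k - 1 := by omega
          exact ⟨i, by omega, by omega, by omega, by rw [g5, g0, ← g0']; exact h3⟩
      hi_edge := h₄.hi_edge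
      cp_ne := fun k hk => h₄.cp_ne k hk (Nat.zero_le _)
      cp_zero := fun k hk => h₄.cp_zero k hk (Nat.zero_le _)
      wit := h₄.wit
      top_eq := h₅ }
  · rw [e5sat, e5vio]
    exact fun k hk => (h₁ k hk).2.2
  · rw [e5low, e5up]
    exact he

/-! ### Colouring on the RAM -/

theorem ite_le_one (p : Prop) [Decidable p] : (if p then 1 else 0) ≤ 1 := by
  split_ifs <;> omega

/-- One step of the top-down colouring: count one edge for the component of its lower end, or colour
the next vertex. -/
def colorStep : Prog :=
  .branch (.reg rQ)
    (.seq (.assign rX (.sub (.reg rQ) (.const 1)))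
    (.seq (.assign rQ (.get aNext (.reg rQ)))
    (.seq (.assign rY (.get aTop (.get aLow (.reg rX))))
      (.branch (.eq (.reg rY) (.get aTop (.get aUp (.reg rX)))) .skip
        (.branch (.eq (.eq (.get aTau (.get aLow (.reg rX))) (.get aCol (.get aUp (.reg rX))))
            (.get aSgn (.reg rX)))
          (.store aVio (.reg rY) (.add (.get aVio (.reg rY)) (.const 1)))
          (.store aSat (.reg rY) (.add (.get aSat (.reg rY)) (.const 1))))))))
    (.seq (.store aFlip (.reg rCur) (.lt (.get aSat (.reg rCur)) (.get aVio (.reg rCur))))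
    (.seq (.store aCol (.reg rCur)
        (addMod (.get aTau (.reg rCur)) (.get aFlip (.get aTop (.reg rCur)))))
    (.seq (.assign rQ (.get aHead (.reg rCur)))
      (.assign rCur (.add (.reg rCur) (.const 1))))))

theorem colorStep_spec {M n m : ℕ} {el eu z pp tau hi cp top nxt hd : ℕ → ℕ} {t : State}
    (ht : Bdd M t) (hM : 1 ≤ M) (hnM : n ≤ M) (hmM : m ≤ M)
    (hf : CutForest n m el eu z pp tau hi cp top) (hz : ∀ i < m, z i ≤ 1)
    (htau : ∀ k < n, tau k ≤ 1) (hb : Buckets n m eu hd nxt)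
    (h₁ : t.arr aLow = el) (h₂ : t.arr aUp = eu) (h₃ : t.arr aSgn = z) (h₄ : t.arr aTau = tau)
    (h₅ : t.arr aTop = top) (h₆ : t.arr aNext = nxt) (h₇ : t.arr aHead = hd)
    (hI : ColInv n m el eu z tau top (t.arr aSat) (t.arr aVio) (t.arr aFlip) (t.arr aCol)
      (t.reg rCur) (t.reg rQ)) (hgo : t.reg rCur < n ∨ t.reg rQ ≠ 0) :
    colorStep.Safe M t ∧
    ColInv n m el eu z tau top ((colorStep.run t).arr aSat) ((colorStep.run t).arr aVio)
      ((colorStep.run t).arr aFlip) ((colorStep.run t).arr aCol)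
      ((colorStep.run t).reg rCur) ((colorStep.run t).reg rQ) ∧
    colPotential n m eu ((colorStep.run t).reg rCur) ((colorStep.run t).reg rQ) <
      colPotential n m eu (t.reg rCur) (t.reg rQ) := by
  by_cases hq : t.reg rQ = 0
  · have ha : t.reg rCur < n := hgo.resolve_right (not_not_intro hq)
    rw [hq] at hI
    have h1 := hI.color hf ha (hb.head_last _ ha) (htau _ ha)
    have h2 := ColInv.potential_color (m := m) (eu := eu) (hd (t.reg rCur)) ha
    have h3 : hd (t.reg rCur) ≤ M := (hb.head_last _ ha).1.trans hmM
    refine ⟨?_, ?_, ?_⟩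
    · simp [colorStep, addMod, Prog.Safe, Prog.run, Expr.eval, hq, h₇]
      exact ⟨(ite_le_one _).trans hM, by omega, h3, by omega⟩
    · simp [colorStep, addMod, Prog.run, Expr.eval, hq, h₄, h₅, h₇]
      convert h1 <;> exact if_congr Iff.rfl rfl rfl
    · simpa [colorStep, addMod, Prog.run, Expr.eval, hq, h₇] using h2
  · have hqm := hI.q_le
    have hqe := hI.q_eq.resolve_left hq
    have hlast : IsLast eu (t.reg rQ - 1) (eu (t.reg rQ - 1)) (nxt (t.reg rQ)) := by
      have := hb.nxt_last (t.reg rQ - 1) (by omega)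
      rwa [Nat.sub_add_cancel (by omega)] at this
    have hel := hf.el_lt (t.reg rQ - 1) (by omega)
    have han := hI.a_le
    have hpar := eq_ite_iff (htau _ hel) (hI.col_le (eu (t.reg rQ - 1)) (by omega))
      (hz (t.reg rQ - 1) (by omega))
    have hmem : ∀ J r, t.reg rQ - 1 ∈ crossing m el eu z tau top (t.arr aCol) J r ↔
        top (el (t.reg rQ - 1)) = J ∧ top (eu (t.reg rQ - 1)) ≠ J ∧
        (tau (el (t.reg rQ - 1)) + t.arr aCol (eu (t.reg rQ - 1)) + z (t.reg rQ - 1)) % 2 = r := by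
      intro J r
      simp only [crossing, Finset.mem_filter, Finset.mem_range]
      exact and_iff_right (by omega)
    have hpot := hI.potential_count hq hlast
    have hnM' : nxt (t.reg rQ) ≤ M := by have := hlast.1; omega
    have hyM : top (el (t.reg rQ - 1)) ≤ M := h₅ ▸ ht.2 _ _
    have hqM : t.reg rQ ≤ M + 1 := by omega
    have hJ : top (el (t.reg rQ - 1)) < n := (hf.top_spec hel).1.trans_lt hel
    have hle : ∀ J r (p : ℕ → Prop) [DecidablePred p],
        ((crossing m el eu z tau top (t.arr aCol) J r).filter p).card ≤ M := fun J r p _ =>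
      ((Finset.card_filter_le _ _).trans (card_crossing_le _ _ _ _ _ _ _ _ _)).trans hmM
    by_cases hc : top (el (t.reg rQ - 1)) = top (eu (t.reg rQ - 1))
    · have h1 := hI.count hq hlast (sat' := t.arr aSat) (vio' := t.arr aVio)
        (fun J _ => by
          rw [if_neg fun h => ((hmem J 0).mp h).2.1 (hc ▸ ((hmem J 0).mp h).1), add_zero])
        (fun J _ => by
          rw [if_neg fun h => ((hmem J 1).mp h).2.1 (hc ▸ ((hmem J 1).mp h).1), add_zero])
      refine ⟨?_, ?_, ?_⟩
      · simp [colorStep, Prog.Safe, Prog.run, Expr.eval, hq, h₁, h₂, h₅, h₆, hc]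
        exact ⟨by omega, hnM', hc ▸ hyM⟩
      · simpa [colorStep, Prog.run, Expr.eval, hq, h₁, h₂, h₅, h₆, hc] using h1
      · simpa [colorStep, Prog.run, Expr.eval, hq, h₁, h₂, h₅, h₆, hc] using hpot
    · by_cases hv : (if tau (el (t.reg rQ - 1)) = t.arr aCol (eu (t.reg rQ - 1)) then 1 else 0) =
          z (t.reg rQ - 1)
      · have hodd := hpar.mp hv
        have h1 := hI.count hq hlast (sat' := t.arr aSat)
          (vio' := Function.update (t.arr aVio) (top (el (t.reg rQ - 1)))
            (t.arr aVio (top (el (t.reg rQ - 1))) + 1))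
          (fun J _ => by rw [if_neg fun h => hodd ((hmem J 0).mp h).2.2, add_zero])
          (fun J _ => by
            rcases eq_or_ne J (top (el (t.reg rQ - 1))) with rfl | hne
            · rw [Function.update_self, if_pos ((hmem _ 1).mpr ⟨rfl, Ne.symm hc, by omega⟩)]
            · rw [Function.update_of_ne hne, if_neg fun h => hne ((hmem J 1).mp h).1.symm,
                add_zero])
        have h2 := h1.vio_eq _ hJ
        rw [Function.update_self] at h2
        refine ⟨?_, ?_, ?_⟩
        · simp [colorStep, Prog.Safe, Prog.run, Expr.eval, hq, h₁, h₂, h₃, h₄, h₅, h₆, hc, hv]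
          exact ⟨by omega, hnM', hyM, h2.trans_le (hle _ _ _)⟩
        · simpa [colorStep, Prog.run, Expr.eval, hq, h₁, h₂, h₃, h₄, h₅, h₆, hc, hv] using h1
        · simpa [colorStep, Prog.run, Expr.eval, hq, h₁, h₂, h₃, h₄, h₅, h₆, hc, hv] using hpot
      · have heven : (tau (el (t.reg rQ - 1)) + t.arr aCol (eu (t.reg rQ - 1)) +
            z (t.reg rQ - 1)) % 2 = 0 := by
          by_contra h
          exact hv (hpar.mpr h)
        have h1 := hI.count hq hlast (vio' := t.arr aVio)
          (sat' := Function.update (t.arr aSat) (top (el (t.reg rQ - 1)))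
            (t.arr aSat (top (el (t.reg rQ - 1))) + 1))
          (fun J _ => by
            rcases eq_or_ne J (top (el (t.reg rQ - 1))) with rfl | hne
            · rw [Function.update_self, if_pos ((hmem _ 0).mpr ⟨rfl, Ne.symm hc, heven⟩)]
            · rw [Function.update_of_ne hne, if_neg fun h => hne ((hmem J 0).mp h).1.symm,
                add_zero])
          (fun J _ => by
            rw [if_neg fun h => by have := ((hmem J 1).mp h).2.2; omega, add_zero])
        have h2 := h1.sat_eq _ hJ
        rw [Function.update_self] at h2
        refine ⟨?_, ?_, ?_⟩
        · simp [colorStep, Prog.Safe, Prog.run, Expr.eval, hq, h₁, h₂, h₃, h₄, h₅, h₆, hc, hv]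
          exact ⟨by omega, hnM', hyM, h2.trans_le (hle _ _ _)⟩
        · simpa [colorStep, Prog.run, Expr.eval, hq, h₁, h₂, h₃, h₄, h₅, h₆, hc, hv] using h1
        · simpa [colorStep, Prog.run, Expr.eval, hq, h₁, h₂, h₃, h₄, h₅, h₆, hc, hv] using hpot

/-- Colour the vertices in preorder, flipping a component if this satisfies more of the edges that
lead to vertices coloured before. -/
def colorProg : Prog :=
  .seq (bucketProg aUp rM)
  (.seq (.seq (.assign rCur (.const 0)) (.assign rQ (.const 0)))
    (.loop (.add (.lt (.reg rCur) (.reg rN)) (.reg rQ)) colorStep))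

theorem colorProg_spec {W M n m : ℕ} {pp hi cp : ℕ → ℕ} (hM : 1 ≤ M) (hW : 20 * M < W) {s : State}
    (hs : Bdd M s) (hn : s.reg rN = n) (hm : s.reg rM = m)
    (hf : CutForest n m (s.arr aLow) (s.arr aUp) (s.arr aSgn) pp (s.arr aTau) hi cp (s.arr aTop))
    (hz : ∀ i < m, s.arr aSgn i ≤ 1) (htau : ∀ k < n, s.arr aTau k ≤ 1)
    (hz' : ∀ k < n, s.arr aSat k = 0 ∧ s.arr aVio k = 0) :
    ∃ s', Runs W M colorProg s s' (1000 * (n + m + 1)) ∧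
      (∀ k < n, s'.arr aCol k ≤ 1) ∧
      (∀ k < n, (s'.arr aCol k + s.arr aTau k + s'.arr aFlip (s.arr aTop k)) % 2 = 0) ∧
      ∀ k < n, s'.arr aFlip k =
        if (crossing m (s.arr aLow) (s.arr aUp) (s.arr aSgn) (s.arr aTau) (s.arr aTop)
            (s'.arr aCol) k 0).card <
          (crossing m (s.arr aLow) (s.arr aUp) (s.arr aSgn) (s.arr aTau) (s.arr aTop)
            (s'.arr aCol) k 1).card then 1 else 0 := by
  have hnM : n ≤ M := hn ▸ hs.1 _
  have hmM : m ≤ M := hm ▸ hs.1 _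
  obtain ⟨s₁, r₁, hb⟩ := bucketProg_spec (n := n) (c := m) (key := aUp) (cnt := rM) hM hW
    hs (by decide) (by decide) (by decide) hn hm
    (fun i hi => ((hf.anc i hi).le hf.pp_le (hf.el_lt i hi)).trans_lt (hf.el_lt i hi))
  have r₂ : Runs W M (.seq (.assign rCur (.const 0)) (.assign rQ (.const 0))) s₁ _ _ :=
    Runs.of_safe hM hW (.seq (.assign rCur (.const 0)) (.assign rQ (.const 0))) rfl r₁.bdd
      (by simp [Prog.Safe, Expr.eval])
  set s₂ := (Prog.seq (.assign rCur (.const 0)) (.assign rQ (.const 0))).run s₁ with hs₂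
  have e2 : ∀ a, Prog.noArr a (bucketProg aUp rM) = true → s₂.arr a = s.arr a :=
    fun a ha => (r₂.arr_eq rfl).trans (r₁.arr_eq ha)
  have e2n : s₂.reg rN = n := (r₂.reg_eq rfl).trans ((r₁.reg_eq rfl).trans hn)
  have e2c : s₂.reg rCur = 0 ∧ s₂.reg rQ = 0 := by simp [hs₂, Prog.run, Expr.eval]
  obtain ⟨s₃, r₃, hI, hb₃⟩ := Runs.loop (s₀ := s₂) hM hW
    (b := .add (.lt (.reg rCur) (.reg rN)) (.reg rQ)) (P := colorStep) rfl
    (fun t => ColInv n m (s.arr aLow) (s.arr aUp) (s.arr aSgn) (s.arr aTau) (s.arr aTop)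
      (t.arr aSat) (t.arr aVio) (t.arr aFlip) (t.arr aCol) (t.reg rCur) (t.reg rQ))
    (fun t => colPotential n m (s.arr aUp) (t.reg rCur) (t.reg rQ))
    (by
      intro t ht hft hI hbt
      refine colorStep_spec ht hM hnM hmM hf hz htau hb ((hft.2 _ rfl).trans (e2 _ rfl))
        ((hft.2 _ rfl).trans (e2 _ rfl)) ((hft.2 _ rfl).trans (e2 _ rfl))
        ((hft.2 _ rfl).trans (e2 _ rfl)) ((hft.2 _ rfl).trans (e2 _ rfl))
        ((hft.2 _ rfl).trans (r₂.arr_eq rfl)) ((hft.2 _ rfl).trans (r₂.arr_eq rfl)) hI ?_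
      by_contra hcon
      push Not at hcon
      refine hbt ?_
      simp only [Expr.eval, hft.1 rN rfl, e2n, hcon.2, if_neg (not_lt.mpr hcon.1)]) r₂.bdd
    (by
      rw [e2c.1, e2c.2]
      exact ColInv.init (fun k hk => by rw [e2 _ rfl]; exact (hz' k hk).1)
        (fun k hk => by rw [e2 _ rfl]; exact (hz' k hk).2))
  have h3n : s₃.reg rCur = n := by
    have := hI.a_le
    simp only [Expr.eval, (r₃.reg_eq rfl).trans e2n] at hb₃
    by_contra hne
    rw [if_pos (by omega)] at hb₃
    omega
  rw [h3n] at hI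
  refine ⟨s₃, (r₁.seq (r₂.seq r₃)).mono ?_, hI.col_le, hI.col_eq, hI.phi_eq⟩
  have hpot := colPotential_le n m (s.arr aUp) (s₂.reg rCur) (s₂.reg rQ)
  have ht : colorStep.time ≤ 120 := by decide
  have h1 : colorStep.time + (Expr.add (.lt (.reg rCur) (.reg rN)) (.reg rQ)).cost + 1 ≤ 126 := by
    simp only [Expr.cost]; omega
  have h2 := Nat.mul_le_mul h1 (Nat.add_le_add_right hpot 1)
  refine le_trans (Nat.add_le_add_left (Nat.add_le_add_left h2 _) _) ?_
  simp only [Prog.time, Expr.cost]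
  omega

/-! ### Contraction of a set of edges -/

theorem IsDfs.pre_sub_one_lt {n c : ℕ} {src tgt z pre ord pp tau rt : ℕ → ℕ}
    (h : IsDfs n c src tgt z pre ord pp tau rt) {v : ℕ} (hv : v < n) : pre v - 1 < n := by
  have := h.pre_le v hv
  omega

theorem IsDfs.pre_inj {n c : ℕ} {src tgt z pre ord pp tau rt : ℕ → ℕ}
    (h : IsDfs n c src tgt z pre ord pp tau rt) {v w : ℕ} (hv : v < n) (hw : w < n)
    (he : pre v - 1 = pre w - 1) : v = w := by
  rw [← h.ord_pre v hv, he, h.ord_pre w hw]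

/-- If all vertices of a set lie in one tree of the forest, then at most one of them is a root. -/
theorem IsDfs.card_le_nonroot {n c : ℕ} {src tgt z pre ord pp tau rt : ℕ → ℕ}
    (h : IsDfs n c src tgt z pre ord pp tau rt) {R : Finset ℕ} (hR : ∀ v ∈ R, v < n) {ρ : ℕ}
    (hρ : ∀ v ∈ R, rt (pre v - 1) = ρ) :
    R.card ≤ ((Finset.range n).filter fun k => pp k ≠ 0).card + 1 := by
  rw [← Finset.card_image_of_injOn (f := fun v => pre v - 1) (s := R)
    fun v hv w hw he => h.pre_inj (hR v hv) (hR w hw) he]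
  refine le_trans (Finset.card_le_card (t := insert ρ _) ?_) (Finset.card_insert_le _ _)
  intro k hk
  simp only [Finset.mem_image, Finset.mem_insert, Finset.mem_filter, Finset.mem_range] at hk ⊢
  obtain ⟨v, hv, rfl⟩ := hk
  have h1 := h.pre_sub_one_lt (hR v hv)
  by_cases h0 : pp (pre v - 1) = 0
  · exact .inl ((h.root _ h1 h0).symm.trans (hρ v hv))
  · exact .inr ⟨h1, h0⟩

/-- A colouring that satisfies all arcs agrees with `tau` on every tree up to a flip of the tree. -/
theorem IsDfs.tau_rt {n c : ℕ} {src tgt z pre ord pp tau rt : ℕ → ℕ}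
    (h : IsDfs n c src tgt z pre ord pp tau rt) (κ : ℕ → ℕ)
    (hκ : ∀ q < c, src q ≠ tgt q → (κ (src q) + κ (tgt q) + z q) % 2 = 0) :
    ∀ k < n, (κ (ord k) + tau k + κ (ord (rt k)) + tau (rt k)) % 2 = 0 := by
  intro k
  induction k using Nat.strong_induction_on with
  | _ k ih =>
    intro hk
    by_cases h0 : pp k = 0
    · rw [h.root k hk h0]; omega
    · have hle := h.pp_le k hk
      obtain ⟨h1, q, hq, h2, h3, h4⟩ := h.tree k hk h0
      have h5 := ih (pp k - 1) (by omega) (by omega)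
      have h6 := hκ q hq (by
        rw [h2, h3]
        intro he
        have := h.pre_ord k hk
        have := h.pre_ord (pp k - 1) (by omega)
        rw [he] at this
        omega)
      rw [h2, h3] at h6
      rw [h1]
      omega

/-- Edge `i < m` joins `u i` and `v i`, and its image in the contracted graph joins `x i` and `y
i` with the sign `z i`. The colouring `new` cuts an edge if and only if `c` satisfies its image,
and `κ` and `κ'` correspond to each other in the same way. If the edges of `S`, all cut by `κ`,
have become loops, then the surplus of `new` is that of `c` on the edges that are not loops, plus
the number of loops, of which at least those in `S` are cut. -/
theorem card_le_of_contract {m a : ℕ} {x y z u v new c κ κ' : ℕ → ℕ} {S : Finset ℕ}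
    (hS : ∀ i ∈ S, i < m ∧ x i = y i ∧ (κ (u i) + κ (v i)) % 2 ≠ 0)
    (hnew : ∀ i < m, (new (u i) + new (v i) + 1 + c (x i) + c (y i) + z i) % 2 = 0)
    (hκ' : ∀ i < m, (κ (u i) + κ (v i) + 1 + κ' (x i) + κ' (y i) + z i) % 2 = 0)
    (ha : (a : ℤ) ≤ (∑ i ∈ (Finset.range m).filter fun i => x i ≠ y i,
        if (c (x i) + c (y i) + z i) % 2 = 0 then (1 : ℤ) else -1) +
      ((Finset.range m).filter fun i => x i ≠ y i ∧ (κ' (x i) + κ' (y i) + z i) % 2 ≠ 0).card) :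
    m + S.card + a ≤ 2 * ((Finset.range m).filter fun i => (new (u i) + new (v i)) % 2 ≠ 0).card +
      ((Finset.range m).filter fun i => (κ (u i) + κ (v i)) % 2 = 0).card := by
  classical
  have hSc : S = (Finset.range m).filter fun i => i ∈ S := by
    ext i
    simp only [Finset.mem_filter, Finset.mem_range]
    exact ⟨fun h => ⟨(hS i h).1, h⟩, fun h => h.2⟩
  have h1 : ∑ i ∈ Finset.range m, ((1 : ℤ) + (if i ∈ S then 1 else 0) +
      (if x i ≠ y i then (if (c (x i) + c (y i) + z i) % 2 = 0 then (1 : ℤ) else -1) else 0) +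
      (if x i ≠ y i ∧ (κ' (x i) + κ' (y i) + z i) % 2 ≠ 0 then 1 else 0)) ≤
      ∑ i ∈ Finset.range m, (2 * (if (new (u i) + new (v i)) % 2 ≠ 0 then (1 : ℤ) else 0) +
        (if (κ (u i) + κ (v i)) % 2 = 0 then 1 else 0)) := by
    refine Finset.sum_le_sum fun i hi => ?_
    rw [Finset.mem_range] at hi
    have g1 := hnew i hi
    have g2 := hκ' i hi
    by_cases hxy : x i = y i
    · rw [hxy] at g1 g2
      by_cases hiS : i ∈ S
      · have := (hS i hiS).2.2
        rw [if_pos hiS, if_neg (not_not_intro hxy), if_neg fun h => h.1 hxy, if_pos (by omega),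
          if_neg this]
        norm_num
      · rw [if_neg hiS, if_neg (not_not_intro hxy), if_neg fun h => h.1 hxy]
        by_cases hk : (κ (u i) + κ (v i)) % 2 = 0
        · rw [if_pos hk, if_neg (by omega)]; norm_num
        · rw [if_neg hk, if_pos (by omega)]; norm_num
    · rw [if_neg fun h => hxy (hS i h).2.1, if_pos hxy]
      by_cases hk : (κ (u i) + κ (v i)) % 2 = 0 <;>
      by_cases hc : (c (x i) + c (y i) + z i) % 2 = 0
      · rw [if_pos hk, if_pos hc, if_pos ⟨hxy, by omega⟩, if_pos (by omega)]; norm_num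
      · rw [if_pos hk, if_neg hc, if_pos ⟨hxy, by omega⟩, if_neg (by omega)]; norm_num
      · rw [if_neg hk, if_pos hc, if_neg (by omega), if_pos (by omega)]; norm_num
      · rw [if_neg hk, if_neg hc, if_neg (by omega), if_neg (by omega)]; norm_num
  simp only [Finset.sum_add_distrib, ← Finset.mul_sum, Finset.sum_boole, ← Finset.sum_filter,
    Finset.sum_const, Finset.card_range, nsmul_eq_mul, mul_one] at h1
  rw [← hSc] at h1
  rw [← Nat.cast_le (α := ℤ)]
  push_cast
  linarith

/-- The ends and the sign of an edge in the subgraph that is contracted: edges outside of the window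
of length `n + 1` that begins at `rLo`, and edge `rSkip`, become loops. -/
def windowEdge : Prog :=
  .seq (.branch (.add (.add (.lt (.reg rI) (.reg rLo)) (.lt (.add (.reg rLo) (.reg rN)) (.reg rI)))
      (.eq (.reg rI) (.reg rSkip)))
    (.seq (.assign rX (.const 0)) (.assign rY (.const 0)))
    (.seq (.assign rX (.get aU (.reg rI))) (.assign rY (.get aV (.reg rI)))))
  (.assign rZ (.const 1))

/-- The window of `n + 1` edges that begins at `lo`, without the edge `skip`. -/
def window (n m lo skip : ℕ) : Finset ℕ :=
  (Finset.range m).filter fun i => lo ≤ i ∧ i ≤ lo + n ∧ i ≠ skip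

/-- The ends and the sign of an edge in the contracted graph. -/
def contractedEdge : Prog :=
  .seq (.assign rX (.get aRep (.get aU (.reg rI))))
  (.seq (.assign rY (.get aRep (.get aV (.reg rI))))
    (.assign rZ (.eq (.get aSide (.get aU (.reg rI))) (.get aSide (.get aV (.reg rI))))))

/-- Record for every vertex its component and its colour. -/
def repProg : Prog :=
  .for rI rN
    (.seq (.store aRep (.reg rI) (.get aRoot (.sub (.get aPre (.reg rI)) (.const 1))))
      (.store aSide (.reg rI) (.get aTau (.sub (.get aPre (.reg rI)) (.const 1)))))

theorem repProg_spec {W M n : ℕ} (hM : 1 ≤ M) (hW : 20 * M < W) {s : State} (hs : Bdd M s)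
    (hn : s.reg rN = n) :
    ∃ s', Runs W M repProg s s' (50 * (n + 1)) ∧ ∀ v < n,
      s'.arr aRep v = s.arr aRoot (s.arr aPre v - 1) ∧
      s'.arr aSide v = s.arr aTau (s.arr aPre v - 1) := by
  obtain ⟨s', h, hI⟩ := Runs.for (s₀ := s) hM hW rI rN
    (P := .seq (.store aRep (.reg rI) (.get aRoot (.sub (.get aPre (.reg rI)) (.const 1))))
      (.store aSide (.reg rI) (.get aTau (.sub (.get aPre (.reg rI)) (.const 1)))))
    rfl (by decide) rfl rfl
    (fun k t => ∀ v < k, t.arr aRep v = s.arr aRoot (s.arr aPre v - 1) ∧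
      t.arr aSide v = s.arr aTau (s.arr aPre v - 1)) hn
    (by
      intro k hk t ht hf hx hI
      have h1 : t.arr aRoot = s.arr aRoot := hf.2 _ rfl
      have h2 : t.arr aPre = s.arr aPre := hf.2 _ rfl
      have h3 : t.arr aTau = s.arr aTau := hf.2 _ rfl
      refine ⟨by simp [Prog.Safe, Prog.run, Expr.eval]; exact ⟨ht.2 _ _, ht.2 _ _⟩, fun i hi => ?_⟩
      rcases Nat.lt_succ_iff_lt_or_eq.mp hi with hi | rfl
      · simpa [Prog.run, Expr.eval, hx, h1, h2, h3, hi.ne] using hI i hi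
      · simp [Prog.run, Expr.eval, hx, h1, h2, h3]) hs (by simp)
  exact ⟨s', h.mono (by simp only [Prog.time, Expr.cost]; omega), hI⟩

/-- Find the components of the window and a colouring that satisfies a spanning forest of it. -/
def contractProg : Prog := .seq (arcsProg windowEdge) (.seq dfsProg repProg)

theorem contractProg_spec {W M n m : ℕ} (hM : 1 ≤ M) (hW : 20 * M < W) {s : State} (hs : Bdd M s)
    (hn : s.reg rN = n) (hm : s.reg rM = m) (hn0 : 0 < n) (hmM : m + m ≤ M)
    (hu : ∀ i < m, s.arr aU i < n) (hv : ∀ i < m, s.arr aV i < n) :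
    ∃ s', Runs W M contractProg s s' (2000 * (n + m + 1)) ∧
      (∀ w < n, s'.arr aRep w < n) ∧ (∀ w < n, s'.arr aSide w ≤ 1) ∧
      (∀ i ∈ window n m (s.reg rLo) (s.reg rSkip),
        s'.arr aRep (s.arr aU i) = s'.arr aRep (s.arr aV i)) ∧
      (window n m (s.reg rLo) (s.reg rSkip) = ∅ →
        ((Finset.range n).image (s'.arr aRep)).card = n) ∧
      ∀ κ : ℕ → ℕ, (∀ i ∈ window n m (s.reg rLo) (s.reg rSkip),
          (κ (s.arr aU i) + κ (s.arr aV i)) % 2 ≠ 0) →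
        ∃ κ' : ℕ → ℕ, ∀ w < n, (κ w + s'.arr aSide w + κ' (s'.arr aRep w)) % 2 = 0 := by
  classical
  set S := window n m (s.reg rLo) (s.reg rSkip) with hS
  obtain ⟨s₁, r₁, ha⟩ := arcsProg_spec (P := windowEdge) hM hW hs hm rfl rfl rfl (fun _ => rfl)
    (fun i => if i ∈ S then s.arr aU i else 0) (fun i => if i ∈ S then s.arr aV i else 0)
    (fun _ => 1)
    (by
      intro i hi t ht hf hti
      have h0 : t.arr aU = s.arr aU := hf.2 _ rfl
      have h1 : t.arr aV = s.arr aV := hf.2 _ rfl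
      have h2 : t.reg rLo = s.reg rLo := hf.1 _ rfl
      have h3 : t.reg rSkip = s.reg rSkip := hf.1 _ rfl
      have h4 : t.reg rN = n := (hf.1 _ rfl).trans hn
      have hmem : i ∈ S ↔ ¬ i < s.reg rLo ∧ ¬ s.reg rLo + n < i ∧ ¬ i = s.reg rSkip := by
        simp only [hS, window, Finset.mem_filter, Finset.mem_range, not_lt]
        exact and_iff_right hi
      by_cases hiS : i ∈ S
      · obtain ⟨g1, g2, g3⟩ := hmem.mp hiS
        simp [windowEdge, Prog.Safe, Prog.run, Expr.eval, hti, h0, h1, h2, h3, h4, g1, g2, g3, hiS]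
        exact ⟨⟨h0 ▸ ht.2 _ _, h1 ▸ ht.2 _ _⟩, hM⟩
      · by_cases g1 : i < s.reg rLo
        · simp [windowEdge, Prog.Safe, Prog.run, Expr.eval, hti, h2, h3, h4, g1, hiS, hM]
        · by_cases g2 : s.reg rLo + n < i
          · simp [windowEdge, Prog.Safe, Prog.run, Expr.eval, hti, h2, h3, h4, g1, g2, hiS, hM]
          · have g3 : i = s.reg rSkip := by
              by_contra g3
              exact hiS (hmem.mpr ⟨g1, g2, g3⟩)
            simp [windowEdge, Prog.Safe, Prog.run, Expr.eval, hti, h2, h3, h4, ← g3, hiS, hM])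
  have hlt : ∀ w : ℕ → ℕ, (∀ i < m, w i < n) → ∀ i < m, (if i ∈ S then w i else 0) < n := by
    intro w hw i hi
    split_ifs
    exacts [hw i hi, hn0]
  have hx := hlt _ hu
  have hy := hlt _ hv
  obtain ⟨s₂, r₂, hd⟩ := dfsProg_spec (n := n) (m := m) hM hW r₁.bdd ((r₁.reg_eq rfl).trans hn)
    ((r₁.reg_eq rfl).trans hm) hmM ha hx hy (fun _ _ => le_rfl)
  obtain ⟨s₃, r₃, h₃⟩ := repProg_spec (n := n) hM hW r₂.bdd
    ((r₂.reg_eq rfl).trans ((r₁.reg_eq rfl).trans hn))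
  have hSm : ∀ i ∈ S, i < m := fun i hi => Finset.mem_range.mp (Finset.mem_filter.mp hi).1
  -- Every arc comes from an edge of the window or is a loop.
  have harc : ∀ q < m + m, ∃ i < m,
      (s₁.arr aSrc q = (if i ∈ S then s.arr aU i else 0) ∧
        s₁.arr aTgt q = (if i ∈ S then s.arr aV i else 0) ∨
      s₁.arr aSrc q = (if i ∈ S then s.arr aV i else 0) ∧
        s₁.arr aTgt q = (if i ∈ S then s.arr aU i else 0)) ∧ s₁.arr aSgn q = 1 := by
    intro q hq
    rcases lt_or_ge q m with h | h
    · obtain ⟨g1, g2, g3, -⟩ := ha q h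
      exact ⟨q, h, .inl ⟨g1, g2⟩, g3⟩
    · obtain ⟨-, -, -, g1, g2, g3⟩ := ha (q - m) (by omega)
      rw [Nat.add_sub_cancel' h] at g1 g2 g3
      exact ⟨q - m, by omega, .inr ⟨g1, g2⟩, g3⟩
  have hsrc : ∀ q < m + m, s₁.arr aSrc q < n := by
    intro q hq
    obtain ⟨i, hi, h | h, -⟩ := harc q hq
    · rw [h.1]; exact hx i hi
    · rw [h.1]; exact hy i hi
  have htgt : ∀ q < m + m, s₁.arr aTgt q < n := by
    intro q hq
    obtain ⟨i, hi, h | h, -⟩ := harc q hq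
    · rw [h.2]; exact hy i hi
    · rw [h.2]; exact hx i hi
  refine ⟨s₃, (r₁.seq (r₂.seq r₃)).mono ?_, ?_, ?_, ?_, ?_, ?_⟩
  · have : windowEdge.time ≤ 60 := by decide
    have := Nat.mul_le_mul_right (m + 1) (Nat.add_le_add_right this 40)
    omega
  · intro w hw
    rw [(h₃ w hw).1]
    have h1 := hd.pre_sub_one_lt hw
    exact (hd.rt_le _ h1).trans_lt h1
  · intro w hw
    rw [(h₃ w hw).2]
    exact hd.tau_le _ (hd.pre_sub_one_lt hw)
  · intro i hi
    have him := hSm i hi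
    have := hd.rt_eq hsrc htgt (q := i) (by omega)
    obtain ⟨g1, g2, -⟩ := ha i him
    rw [g1, g2] at this
    simp only [if_pos hi] at this
    rw [(h₃ _ (hu i him)).1, (h₃ _ (hv i him)).1, this]
  · intro hempty
    have hpp : ∀ k < n, s₂.arr aPar k = 0 := by
      intro k hk
      by_contra h0
      have hle := hd.pp_le k hk
      obtain ⟨-, q, hq, g1, g2, -⟩ := hd.tree k hk h0
      have g3 := hd.pre_ord k hk
      have g4 := hd.pre_ord (s₂.arr aPar k - 1) (by omega)
      rw [← g1] at g4
      rw [← g2] at g3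
      obtain ⟨i, hi, h, -⟩ := harc q hq
      simp only [hempty, Finset.notMem_empty, if_false] at h
      have : s₁.arr aSrc q = s₁.arr aTgt q := by omega
      rw [this] at g4
      omega
    rw [Finset.card_image_of_injOn, Finset.card_range]
    intro v hv w hw he
    simp only [Finset.coe_range, Set.mem_Iio] at hv hw
    have h1 := hd.pre_sub_one_lt hv
    have h2 := hd.pre_sub_one_lt hw
    rw [(h₃ v hv).1, (h₃ w hw).1, hd.root _ h1 (hpp _ h1), hd.root _ h2 (hpp _ h2)] at he
    exact hd.pre_inj hv hw he
  · intro κ hκ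
    have hτ := hd.tau_rt κ (by
      intro q hq hne
      obtain ⟨i, hi, h, g⟩ := harc q hq
      by_cases hiS : i ∈ S
      · simp only [if_pos hiS] at h
        have := hκ i hiS
        rcases h with ⟨h1, h2⟩ | ⟨h1, h2⟩ <;> rw [h1, h2, g] <;> omega
      · simp only [if_neg hiS] at h
        exact absurd (by omega) hne)
    refine ⟨fun k => κ (s₂.arr aOrd k) + s₂.arr aTau k, fun w hw => ?_⟩
    have h1 := hτ _ (hd.pre_sub_one_lt hw)
    rw [hd.ord_pre w hw] at h1
    rw [(h₃ w hw).1, (h₃ w hw).2]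
    dsimp only
    omega

/-! ### One window of edges -/

/-- Colour the contracted graph. -/
def solveProg : Prog :=
  .seq (arcsProg contractedEdge) (.seq dfsProg (.seq forestProg colorProg))

theorem solveProg_spec {W M n m : ℕ} (hM : 1 ≤ M) (hW : 20 * M < W) {s : State} (hs : Bdd M s)
    (hn : s.reg rN = n) (hm : s.reg rM = m) (hmM : m + m ≤ M)
    (hu : ∀ i < m, s.arr aU i < n) (hv : ∀ i < m, s.arr aV i < n)
    (hrep : ∀ w < n, s.arr aRep w < n)
    (hconn : ∀ f : ℕ → ℕ, (∀ i < m, f (s.arr aU i) = f (s.arr aV i)) →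
      ∀ a < n, ∀ b < n, f a = f b) :
    ∃ s', Runs W M solveProg s s' (5000 * (n + m + 1)) ∧ ∃ c : ℕ → ℕ,
      (∀ w < n, s'.arr aCol (s'.arr aPre w - 1) = c w ∧ c w ≤ 1) ∧ ∀ κ : ℕ → ℕ,
      ((((Finset.range n).image (s.arr aRep)).card - 1 : ℕ) : ℤ) ≤
      (∑ i ∈ (Finset.range m).filter fun i => s.arr aRep (s.arr aU i) ≠ s.arr aRep (s.arr aV i),
        if (c (s.arr aRep (s.arr aU i)) + c (s.arr aRep (s.arr aV i)) +
          (if s.arr aSide (s.arr aU i) = s.arr aSide (s.arr aV i) then 1 else 0)) % 2 = 0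
        then (1 : ℤ) else -1) +
      ((Finset.range m).filter fun i => s.arr aRep (s.arr aU i) ≠ s.arr aRep (s.arr aV i) ∧
        (κ (s.arr aRep (s.arr aU i)) + κ (s.arr aRep (s.arr aV i)) +
          (if s.arr aSide (s.arr aU i) = s.arr aSide (s.arr aV i) then 1 else 0)) % 2 ≠ 0).card := by
  obtain ⟨s₁, r₁, ha⟩ := arcsProg_spec (P := contractedEdge) hM hW hs hm rfl rfl rfl (fun _ => rfl)
    (fun i => s.arr aRep (s.arr aU i)) (fun i => s.arr aRep (s.arr aV i))
    (fun i => if s.arr aSide (s.arr aU i) = s.arr aSide (s.arr aV i) then 1 else 0)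
    (by
      intro i hi t ht hf hti
      have h0 : t.arr aU = s.arr aU := hf.2 _ rfl
      have h1 : t.arr aV = s.arr aV := hf.2 _ rfl
      have h2 : t.arr aRep = s.arr aRep := hf.2 _ rfl
      have h3 : t.arr aSide = s.arr aSide := hf.2 _ rfl
      simp [contractedEdge, Prog.Safe, Prog.run, Expr.eval, hti, h0, h1, h2, h3]
      exact ⟨hs.2 _ _, hs.2 _ _, (ite_le_one _).trans hM⟩)
  have hx : ∀ i < m, s.arr aRep (s.arr aU i) < n := fun i hi => hrep _ (hu i hi)
  have hy : ∀ i < m, s.arr aRep (s.arr aV i) < n := fun i hi => hrep _ (hv i hi)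
  have e1n : s₁.reg rN = n := (r₁.reg_eq rfl).trans hn
  have e1m : s₁.reg rM = m := (r₁.reg_eq rfl).trans hm
  obtain ⟨s₂, r₂, hd⟩ := dfsProg_spec (n := n) (m := m) hM hW r₁.bdd e1n e1m hmM ha hx hy
    (fun i _ => ite_le_one _)
  have e2n : s₂.reg rN = n := (r₂.reg_eq rfl).trans e1n
  have e2m : s₂.reg rM = m := (r₂.reg_eq rfl).trans e1m
  have e2src : s₂.arr aSrc = s₁.arr aSrc := r₂.arr_eq rfl
  have e2tgt : s₂.arr aTgt = s₁.arr aTgt := r₂.arr_eq rfl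
  have e2sgn : s₂.arr aSgn = s₁.arr aSgn := r₂.arr_eq rfl
  obtain ⟨s₃, r₃, hf, hz, he⟩ := forestProg_spec (n := n) (m := m) hM hW r₂.bdd e2n e2m
    (by rw [e2src, e2tgt, e2sgn]; exact ha) hx hy (fun i _ => ite_le_one _)
    (by rw [e2src, e2tgt, e2sgn]; exact hd)
  have e3sgn : s₃.arr aSgn = s₂.arr aSgn := r₃.arr_eq rfl
  have e3tau : s₃.arr aTau = s₂.arr aTau := r₃.arr_eq rfl
  have hsgn : ∀ i < m, s₂.arr aSgn i =
      if s.arr aSide (s.arr aU i) = s.arr aSide (s.arr aV i) then 1 else 0 := by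
    intro i hi
    rw [e2sgn]
    exact (ha i hi).2.2.1
  obtain ⟨s₄, r₄, hc, hcol, hphi⟩ := colorProg_spec (n := n) (m := m) (pp := s₂.arr aPar)
    (hi := s₃.arr aHi) (cp := s₃.arr aCut) hM hW r₃.bdd ((r₃.reg_eq rfl).trans e2n)
    ((r₃.reg_eq rfl).trans e2m) (by rw [e3sgn, e3tau]; exact hf)
    (by rw [e3sgn]; exact fun i hi => hsgn i hi ▸ ite_le_one _)
    (by rw [e3tau]; exact hd.tau_le) hz
  rw [e3tau] at hcol
  rw [e3sgn, e3tau] at hphi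
  have e4pre : s₄.arr aPre = s₂.arr aPre := (r₄.arr_eq rfl).trans (r₃.arr_eq rfl)
  refine ⟨s₄, (r₁.seq (r₂.seq (r₃.seq r₄))).mono ?_,
    fun w => s₄.arr aCol (s₂.arr aPre w - 1), ?_, fun κ => ?_⟩
  · have : contractedEdge.time ≤ 60 := by decide
    have := Nat.mul_le_mul_right (m + 1) (Nat.add_le_add_right this 40)
    omega
  · intro w hw
    rw [e4pre]
    exact ⟨rfl, hc _ (hd.pre_sub_one_lt hw)⟩
  · have key := hf.card_nonroot_le (s₄.arr aCol) (s₄.arr aFlip) (fun k => κ (s₂.arr aOrd k)) hcol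
      hphi
    have hrank : ((Finset.range n).image (s.arr aRep)).card - 1 ≤
        ((Finset.range n).filter fun k => s₂.arr aPar k ≠ 0).card := by
      rcases Nat.eq_zero_or_pos n with rfl | hn0
      · simp
      refine Nat.sub_le_of_le_add (hd.card_le_nonroot (R := (Finset.range n).image (s.arr aRep))
        (ρ := s₂.arr aRoot (s₂.arr aPre (s.arr aRep 0) - 1)) ?_ ?_)
      · intro v hv
        simp only [Finset.mem_image, Finset.mem_range] at hv
        obtain ⟨w, hw, rfl⟩ := hv
        exact hrep w hw
      · intro v hv
        simp only [Finset.mem_image, Finset.mem_range] at hv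
        obtain ⟨w, hw, rfl⟩ := hv
        refine hconn (fun w => s₂.arr aRoot (s₂.arr aPre (s.arr aRep w) - 1)) ?_ w hw 0 hn0
        intro i hi
        have := hd.rt_eq (q := i) ?_ ?_ (by omega)
        · rwa [(ha i hi).1, (ha i hi).2.1] at this
        · intro q hq
          rcases lt_or_ge q m with h | h
          · rw [(ha q h).1]; exact hx q h
          · have := (ha (q - m) (by omega)).2.2.2.1
            rw [Nat.add_sub_cancel' h] at this
            rw [this]; exact hy _ (by omega)
        · intro q hq
          rcases lt_or_ge q m with h | h
          · rw [(ha q h).2.1]; exact hy q h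
          · have := (ha (q - m) (by omega)).2.2.2.2.1
            rw [Nat.add_sub_cancel' h] at this
            rw [this]; exact hx _ (by omega)
    have hne : ∀ i < m, (s₃.arr aUp i < s₃.arr aLow i ↔
        s.arr aRep (s.arr aU i) ≠ s.arr aRep (s.arr aV i)) := by
      intro i hi
      obtain ⟨h1, h2⟩ := he i hi
      constructor
      · intro hlt heq
        rw [h1, h2, heq] at hlt
        omega
      · intro hne
        have : s₂.arr aPre (s.arr aRep (s.arr aU i)) - 1 ≠
            s₂.arr aPre (s.arr aRep (s.arr aV i)) - 1 :=
          fun h => hne (hd.pre_inj (hx i hi) (hy i hi) h)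
        omega
    have hsum : ∀ f : ℕ → ℕ, ∀ i < m, f (s₃.arr aLow i) + f (s₃.arr aUp i) =
        f (s₂.arr aPre (s.arr aRep (s.arr aU i)) - 1) +
          f (s₂.arr aPre (s.arr aRep (s.arr aV i)) - 1) := by
      intro f i hi
      obtain ⟨h1, h2⟩ := he i hi
      rw [h1, h2]
      rcases le_total (s₂.arr aPre (s.arr aRep (s.arr aU i)) - 1)
        (s₂.arr aPre (s.arr aRep (s.arr aV i)) - 1) with h | h
      · rw [max_eq_right h, min_eq_left h, add_comm]
      · rw [max_eq_left h, min_eq_right h]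
    refine le_trans (Int.ofNat_le.mpr hrank) (key.trans_eq ?_)
    congr 1
    · refine Finset.sum_congr ?_ ?_
      · exact Finset.filter_congr fun i hi => hne i (Finset.mem_range.mp hi)
      · intro i hi
        have him := Finset.mem_range.mp (Finset.mem_filter.mp hi).1
        rw [hsum _ i him, hsgn i him]
    · congr 2
      refine Finset.filter_congr fun i hi => ?_
      have him := Finset.mem_range.mp hi
      rw [hne i him, hsum (fun k => κ (s₂.arr aOrd k)) i him, hsgn i him, hd.ord_pre _ (hx i him),
        hd.ord_pre _ (hy i him)]

/-- The number of edges whose ends get different colours. -/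
def cutCount (m : ℕ) (u v c : ℕ → ℕ) : ℕ :=
  ((Finset.range m).filter fun i => c (u i) ≠ c (v i)).card

theorem cutCount_congr {m n : ℕ} {u v c c' : ℕ → ℕ} (hu : ∀ i < m, u i < n) (hv : ∀ i < m, v i < n)
    (h : ∀ w < n, c w = c' w) : cutCount m u v c = cutCount m u v c' := by
  unfold cutCount
  congr 1
  refine Finset.filter_congr fun i hi => ?_
  rw [Finset.mem_range] at hi
  rw [h _ (hu i hi), h _ (hv i hi)]

/-- The colouring of the given graph. -/
def combineProg : Prog :=
  .for rI rN (.store aNew (.reg rI)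
    (addMod (.get aSide (.reg rI)) (.get aCol (.sub (.get aPre (.get aRep (.reg rI))) (.const 1)))))

theorem combineProg_spec {W M n : ℕ} (hM : 1 ≤ M) (hW : 20 * M < W) {s : State} (hs : Bdd M s)
    (hn : s.reg rN = n) :
    ∃ s', Runs W M combineProg s s' (50 * (n + 1)) ∧ ∀ w < n, s'.arr aNew w =
      1 - if s.arr aSide w = s.arr aCol (s.arr aPre (s.arr aRep w) - 1) then 1 else 0 := by
  obtain ⟨s', h, hI⟩ := Runs.for (s₀ := s) hM hW rI rN
    (P := .store aNew (.reg rI)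
      (addMod (.get aSide (.reg rI))
        (.get aCol (.sub (.get aPre (.get aRep (.reg rI))) (.const 1)))))
    rfl (by decide) rfl rfl
    (fun k t => ∀ w < k, t.arr aNew w =
      1 - if s.arr aSide w = s.arr aCol (s.arr aPre (s.arr aRep w) - 1) then 1 else 0) hn
    (by
      intro k hk t ht hf hx hI
      have h1 : t.arr aSide = s.arr aSide := hf.2 _ rfl
      have h2 : t.arr aCol = s.arr aCol := hf.2 _ rfl
      have h3 : t.arr aPre = s.arr aPre := hf.2 _ rfl
      have h4 : t.arr aRep = s.arr aRep := hf.2 _ rfl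
      refine ⟨?_, fun i hi => ?_⟩
      · simp [addMod, Prog.Safe, Expr.eval]
        omega
      rcases Nat.lt_succ_iff_lt_or_eq.mp hi with hi | rfl
      · simpa [addMod, Prog.run, Expr.eval, hx, h1, h2, h3, h4, hi.ne] using hI i hi
      · simp [addMod, Prog.run, Expr.eval, hx, h1, h2, h3, h4]) hs (by simp)
  exact ⟨s', h.mono (by simp only [Prog.time, addMod, Expr.cost]; omega), hI⟩

/-- Count the cut edges. -/
def countProg : Prog :=
  .seq (.assign rCnt (.const 0))
    (.for rI rM (.branch (.eq (.get aNew (.get aU (.reg rI))) (.get aNew (.get aV (.reg rI)))) .skip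
      (.assign rCnt (.add (.reg rCnt) (.const 1)))))

theorem countProg_spec {W M m : ℕ} (hM : 1 ≤ M) (hW : 20 * M < W) {s : State} (hs : Bdd M s)
    (hm : s.reg rM = m) :
    ∃ s', Runs W M countProg s s' (50 * (m + 1)) ∧
      s'.reg rCnt = cutCount m (s.arr aU) (s.arr aV) (s.arr aNew) := by
  have hmM : m ≤ M := hm ▸ hs.1 _
  have r₁ : Runs W M (.assign rCnt (.const 0)) s (s.setReg rCnt 0) 2 :=
    Runs.of_safe hM hW (.assign rCnt (.const 0)) rfl hs (Nat.zero_le _)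
  obtain ⟨s', r₂, hI⟩ := Runs.for (s₀ := s.setReg rCnt 0) hM hW rI rM
    (P := .branch (.eq (.get aNew (.get aU (.reg rI))) (.get aNew (.get aV (.reg rI)))) .skip
      (.assign rCnt (.add (.reg rCnt) (.const 1))))
    rfl (by decide) rfl rfl
    (fun k t => t.reg rCnt = cutCount k (s.arr aU) (s.arr aV) (s.arr aNew)) hm
    (by
      intro k hk t ht hf hx hI
      have h1 : t.arr aU = s.arr aU := hf.2 _ rfl
      have h2 : t.arr aV = s.arr aV := hf.2 _ rfl
      have h3 : t.arr aNew = s.arr aNew := hf.2 _ rfl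
      have hle : cutCount k (s.arr aU) (s.arr aV) (s.arr aNew) ≤ k :=
        (Finset.card_filter_le _ _).trans_eq (Finset.card_range _)
      by_cases hc : s.arr aNew (s.arr aU k) = s.arr aNew (s.arr aV k)
      · refine ⟨?_, ?_⟩
        · simp [Prog.Safe, Expr.eval, hx, h1, h2, h3, hc]
        · simp [Prog.run, Expr.eval, hx, h1, h2, h3, hc, hI, cutCount, Finset.range_add_one,
            Finset.filter_insert]
      · refine ⟨?_, ?_⟩
        · simp [Prog.Safe, Expr.eval, hx, h1, h2, h3, hc, hI]
          omega
        · simp [Prog.run, Expr.eval, hx, h1, h2, h3, hc, hI, cutCount, Finset.range_add_one,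
            Finset.filter_insert]) r₁.bdd
    (by simp [cutCount])
  exact ⟨s', (r₁.seq r₂).mono (by simp only [Prog.time, Expr.cost]; omega), hI⟩

/-- Keep the new colouring if it cuts more edges than the best colouring so far. -/
def keepProg : Prog :=
  .seq (.assign rX (.lt (.reg rBest) (.reg rCnt)))
  (.seq (.for rI rN (.branch (.reg rX) (.store aOut (.reg rI) (.get aNew (.reg rI))) .skip))
    (.branch (.reg rX) (.assign rBest (.reg rCnt)) .skip))

theorem keepProg_spec {W M n : ℕ} (hM : 1 ≤ M) (hW : 20 * M < W) {s : State} (hs : Bdd M s)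
    (hn : s.reg rN = n) :
    ∃ s', Runs W M keepProg s s' (50 * (n + 1)) ∧
      s'.reg rBest = max (s.reg rBest) (s.reg rCnt) ∧ ∀ w < n, s'.arr aOut w =
        if s.reg rBest < s.reg rCnt then s.arr aNew w else s.arr aOut w := by
  have r₁ : Runs W M (.assign rX (.lt (.reg rBest) (.reg rCnt))) s _ _ :=
    Runs.of_safe hM hW (.assign rX (.lt (.reg rBest) (.reg rCnt))) rfl hs ((ite_le_one _).trans hM)
  set s₁ := (Prog.assign rX (.lt (.reg rBest) (.reg rCnt))).run s with hs₁
  have h1x : s₁.reg rX = if s.reg rBest < s.reg rCnt then 1 else 0 := rfl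
  obtain ⟨s₂, r₂, hI⟩ := Runs.for (s₀ := s₁) hM hW rI rN
    (P := .branch (.reg rX) (.store aOut (.reg rI) (.get aNew (.reg rI))) .skip)
    rfl (by decide) rfl rfl
    (fun k t => (∀ w < k, t.arr aOut w =
        if s.reg rBest < s.reg rCnt then s.arr aNew w else s.arr aOut w) ∧
      ∀ w, k ≤ w → t.arr aOut w = s.arr aOut w) ((r₁.reg_eq rfl).trans hn)
    (by
      intro k hk t ht hf hx ⟨hI, hI'⟩
      have h1 : t.arr aNew = s.arr aNew := hf.2 _ rfl
      have h2 : t.reg rX = _ := (hf.1 _ rfl).trans h1x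
      have hb := ht.2 aNew k
      by_cases hlt : s.reg rBest < s.reg rCnt
      · rw [if_pos hlt] at h2
        simp only [if_pos hlt] at hI ⊢
        refine ⟨by simpa [Prog.Safe, Expr.eval, hx, h2] using hb, fun i hi => ?_, fun i hi => ?_⟩
        · rcases Nat.lt_succ_iff_lt_or_eq.mp hi with hi | rfl
          · simpa [Prog.run, Expr.eval, hx, h2, hi.ne] using hI i hi
          · simp [Prog.run, Expr.eval, hx, h2, h1]
        · have : i ≠ k := by omega
          simpa [Prog.run, Expr.eval, hx, h2, this] using hI' i (by omega)
      · rw [if_neg hlt] at h2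
        simp only [if_neg hlt] at hI ⊢
        refine ⟨by simp [Prog.Safe, Expr.eval, h2], fun i hi => ?_, fun i hi => ?_⟩
        · rcases Nat.lt_succ_iff_lt_or_eq.mp hi with hi | rfl
          · simpa [Prog.run, Expr.eval, hx, h2] using hI i hi
          · simpa [Prog.run, Expr.eval, hx, h2] using hI' i le_rfl
        · simpa [Prog.run, Expr.eval, hx, h2] using hI' i (by omega)) r₁.bdd
    ⟨by simp, fun _ _ => rfl⟩
  have h2x : s₂.reg rX = if s.reg rBest < s.reg rCnt then 1 else 0 := (r₂.reg_eq rfl).trans h1x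
  have h2b : s₂.reg rBest = s.reg rBest := (r₂.reg_eq rfl).trans (r₁.reg_eq rfl)
  have h2c : s₂.reg rCnt = s.reg rCnt := (r₂.reg_eq rfl).trans (r₁.reg_eq rfl)
  have r₃ : Runs W M (.branch (.reg rX) (.assign rBest (.reg rCnt)) .skip) s₂ _ _ :=
    Runs.of_safe hM hW (.branch (.reg rX) (.assign rBest (.reg rCnt)) .skip) rfl r₂.bdd
      ⟨fun _ => r₂.bdd.1 _, fun _ => trivial⟩
  refine ⟨_, (r₁.seq (r₂.seq r₃)).mono (by simp only [Prog.time, Expr.cost]; omega), ?_, ?_⟩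
  · by_cases hlt : s.reg rBest < s.reg rCnt
    · simp [Prog.run, Expr.eval, h2x, hlt, h2c, hlt.le]
    · simp [Prog.run, Expr.eval, h2x, hlt, h2b, not_lt.mp hlt]
  · intro w hw
    rw [r₃.arr_eq rfl]
    exact hI.1 w hw

/-- Treat one window: contract its components, colour the contracted graph, and keep the resulting
cut if it is the best one so far. -/
def windowProg : Prog :=
  .seq contractProg (.seq solveProg (.seq combineProg (.seq countProg keepProg)))

/-- The register `rBest` holds the number of edges cut by the colouring in the output array. -/
def BestInv (n m : ℕ) (s : State) : Prop :=
  (∀ w < n, s.arr aOut w ≤ 1) ∧ s.reg rBest = cutCount m (s.arr aU) (s.arr aV) (s.arr aOut)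

theorem windowProg_spec {W M n m : ℕ} (hM : 1 ≤ M) (hW : 20 * M < W) {s : State} (hs : Bdd M s)
    (hn : s.reg rN = n) (hm : s.reg rM = m) (hn0 : 0 < n) (hmM : m + m ≤ M)
    (hu : ∀ i < m, s.arr aU i < n) (hv : ∀ i < m, s.arr aV i < n)
    (hconn : ∀ f : ℕ → ℕ, (∀ i < m, f (s.arr aU i) = f (s.arr aV i)) →
      ∀ a < n, ∀ b < n, f a = f b) (hbest : BestInv n m s) :
    ∃ s', Runs W M windowProg s s' (8000 * (n + m + 1)) ∧ BestInv n m s' ∧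
      s.reg rBest ≤ s'.reg rBest ∧ ∀ κ : ℕ → ℕ,
        (∀ i ∈ window n m (s.reg rLo) (s.reg rSkip),
          (κ (s.arr aU i) + κ (s.arr aV i)) % 2 ≠ 0) →
        m + (window n m (s.reg rLo) (s.reg rSkip)).card ≤ 2 * s'.reg rBest +
          ((Finset.range m).filter fun i => (κ (s.arr aU i) + κ (s.arr aV i)) % 2 = 0).card ∧
        (window n m (s.reg rLo) (s.reg rSkip) = ∅ → m + (n - 1) ≤ 2 * s'.reg rBest +
          ((Finset.range m).filter fun i => (κ (s.arr aU i) + κ (s.arr aV i)) % 2 = 0).card) := by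
  obtain ⟨s₁, r₁, hrep, hside, hsame, hempty, hκ'⟩ :=
    contractProg_spec hM hW hs hn hm hn0 hmM hu hv
  have e1u : s₁.arr aU = s.arr aU := r₁.arr_eq rfl
  have e1v : s₁.arr aV = s.arr aV := r₁.arr_eq rfl
  have e1n : s₁.reg rN = n := (r₁.reg_eq rfl).trans hn
  have e1m : s₁.reg rM = m := (r₁.reg_eq rfl).trans hm
  obtain ⟨s₂, r₂, c, hc, hsol⟩ := solveProg_spec (n := n) (m := m) hM hW r₁.bdd e1n e1m hmM
    (by rw [e1u]; exact hu) (by rw [e1v]; exact hv) hrep (by rw [e1u, e1v]; exact hconn)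
  rw [e1u, e1v] at hsol
  have e2n : s₂.reg rN = n := (r₂.reg_eq rfl).trans e1n
  have e2m : s₂.reg rM = m := (r₂.reg_eq rfl).trans e1m
  have e2rep : s₂.arr aRep = s₁.arr aRep := r₂.arr_eq rfl
  have e2side : s₂.arr aSide = s₁.arr aSide := r₂.arr_eq rfl
  obtain ⟨s₃, r₃, h₃⟩ := combineProg_spec (n := n) hM hW r₂.bdd e2n
  rw [e2rep, e2side] at h₃
  have hnew : ∀ w < n, (s₃.arr aNew w + s₁.arr aSide w + c (s₁.arr aRep w)) % 2 = 0 ∧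
      s₃.arr aNew w ≤ 1 := by
    intro w hw
    obtain ⟨h1, h2⟩ := hc _ (hrep w hw)
    have h3 := hside w hw
    rw [h₃ w hw, h1]
    split_ifs <;> omega
  have e3u : s₃.arr aU = s.arr aU := (r₃.arr_eq rfl).trans ((r₂.arr_eq rfl).trans e1u)
  have e3v : s₃.arr aV = s.arr aV := (r₃.arr_eq rfl).trans ((r₂.arr_eq rfl).trans e1v)
  have e3o : s₃.arr aOut = s.arr aOut :=
    (r₃.arr_eq rfl).trans ((r₂.arr_eq rfl).trans (r₁.arr_eq rfl))
  have e3b : s₃.reg rBest = s.reg rBest :=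
    (r₃.reg_eq rfl).trans ((r₂.reg_eq rfl).trans (r₁.reg_eq rfl))
  obtain ⟨s₄, r₄, h₄⟩ := countProg_spec (m := m) hM hW r₃.bdd ((r₃.reg_eq rfl).trans e2m)
  rw [e3u, e3v] at h₄
  obtain ⟨s₅, r₅, h₅, h₅'⟩ := keepProg_spec (n := n) hM hW r₄.bdd
    ((r₄.reg_eq rfl).trans ((r₃.reg_eq rfl).trans e2n))
  have e4b : s₄.reg rBest = s.reg rBest := (r₄.reg_eq rfl).trans e3b
  have e4new : s₄.arr aNew = s₃.arr aNew := r₄.arr_eq rfl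
  have e4o : s₄.arr aOut = s.arr aOut := (r₄.arr_eq rfl).trans e3o
  rw [h₄, e4b] at h₅
  rw [h₄, e4b, e4new, e4o] at h₅'
  have e5u : s₅.arr aU = s.arr aU := (r₅.arr_eq rfl).trans ((r₄.arr_eq rfl).trans e3u)
  have e5v : s₅.arr aV = s.arr aV := (r₅.arr_eq rfl).trans ((r₄.arr_eq rfl).trans e3v)
  refine ⟨s₅, (r₁.seq (r₂.seq (r₃.seq (r₄.seq r₅)))).mono (by omega), ⟨?_, ?_⟩, ?_, ?_⟩
  · intro w hw
    rw [h₅' w hw]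
    split_ifs
    exacts [(hnew w hw).2, hbest.1 w hw]
  · rw [e5u, e5v, h₅]
    split_ifs at h₅' with hlt
    · rw [max_eq_right hlt.le]
      exact (cutCount_congr hu hv h₅').symm
    · rw [max_eq_left (not_lt.mp hlt), hbest.2]
      exact (cutCount_congr hu hv h₅').symm
  · rw [h₅]
    exact le_max_left _ _
  · intro κ hκ
    obtain ⟨κ', hκ''⟩ := hκ' κ hκ
    have key := card_le_of_contract (S := window n m (s.reg rLo) (s.reg rSkip))
      (x := fun i => s₁.arr aRep (s.arr aU i)) (y := fun i => s₁.arr aRep (s.arr aV i))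
      (z := fun i => if s₁.arr aSide (s.arr aU i) = s₁.arr aSide (s.arr aV i) then 1 else 0)
      (new := s₃.arr aNew) (κ := κ)
      (fun i hi => ⟨Finset.mem_range.mp (Finset.mem_filter.mp hi).1, hsame i hi, hκ i hi⟩)
      (fun i hi => by
        have h1 := (hnew _ (hu i hi)).1
        have h2 := (hnew _ (hv i hi)).1
        have h3 := hside _ (hu i hi)
        have h4 := hside _ (hv i hi)
        split_ifs <;> omega)
      (fun i hi => by
        have h1 := hκ'' _ (hu i hi)
        have h2 := hκ'' _ (hv i hi)
        have h3 := hside _ (hu i hi)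
        have h4 := hside _ (hv i hi)
        split_ifs <;> omega) (hsol κ')
    have hcnt : ((Finset.range m).filter fun i =>
        (s₃.arr aNew (s.arr aU i) + s₃.arr aNew (s.arr aV i)) % 2 ≠ 0).card =
        cutCount m (s.arr aU) (s.arr aV) (s₃.arr aNew) := by
      unfold cutCount
      congr 1
      refine Finset.filter_congr fun i hi => ?_
      rw [Finset.mem_range] at hi
      have h1 := (hnew _ (hu i hi)).2
      have h2 := (hnew _ (hv i hi)).2
      omega
    rw [hcnt] at key
    have hle : cutCount m (s.arr aU) (s.arr aV) (s₃.arr aNew) ≤ s₅.reg rBest := by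
      rw [h₅]
      exact le_max_right _ _
    refine ⟨by omega, fun he => ?_⟩
    rw [he, hempty he, Finset.card_empty] at key
    omega

/-! ### All windows -/

/-- `Gain n m u v B lo skip`: the value `B` reaches the bound that the window given by `lo` and
`skip` yields for every colouring `κ` that cuts all edges of this window. -/
def Gain (n m : ℕ) (u v : ℕ → ℕ) (B lo skip : ℕ) : Prop :=
  ∀ κ : ℕ → ℕ, (∀ i ∈ window n m lo skip, (κ (u i) + κ (v i)) % 2 ≠ 0) →
    m + (window n m lo skip).card ≤ 2 * B +
      ((Finset.range m).filter fun i => (κ (u i) + κ (v i)) % 2 = 0).card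

/-- The bound that the empty window yields. -/
def BaseGain (n m : ℕ) (u v : ℕ → ℕ) (B : ℕ) : Prop :=
  ∀ κ : ℕ → ℕ, m + (n - 1) ≤ 2 * B +
    ((Finset.range m).filter fun i => (κ (u i) + κ (v i)) % 2 = 0).card

theorem Gain.mono {n m : ℕ} {u v : ℕ → ℕ} {B B' lo skip : ℕ} (h : Gain n m u v B lo skip)
    (hB : B ≤ B') : Gain n m u v B' lo skip := fun κ hκ => (h κ hκ).trans (by omega)

theorem BaseGain.mono {n m : ℕ} {u v : ℕ → ℕ} {B B' : ℕ} (h : BaseGain n m u v B)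
    (hB : B ≤ B') : BaseGain n m u v B' := fun κ => (h κ).trans (by omega)

theorem window_self (n m : ℕ) : window n m m m = ∅ := by
  ext i
  simp only [window, Finset.mem_filter, Finset.mem_range, Finset.notMem_empty, iff_false]
  omega

theorem card_window {n m lo skip : ℕ} (hlo : lo + n < m) (h₁ : lo ≤ skip) (h₂ : skip ≤ lo + n) :
    (window n m lo skip).card = n := by
  have : window n m lo skip = (Finset.Icc lo (lo + n)).erase skip := by
    ext i
    simp only [window, Finset.mem_filter, Finset.mem_range, Finset.mem_erase, Finset.mem_Icc]
    omega
  rw [this, Finset.card_erase_of_mem (Finset.mem_Icc.mpr ⟨h₁, h₂⟩), Nat.card_Icc]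
  omega

/-- Try the empty window, then the disjoint windows of length `n`, then all windows that arise from
the last `n + 1` edges by omitting one of them. -/
def mainProg : Prog :=
  .seq (.seq (.assign rLo (.reg rM)) (.assign rSkip (.reg rM)))
  (.seq windowProg
  (.seq (.assign rLo (.const 0))
  (.seq (.loop (.lt (.add (.reg rLo) (.reg rN)) (.reg rM))
      (.seq (.assign rSkip (.add (.reg rLo) (.reg rN)))
        (.seq windowProg (.assign rLo (.add (.reg rLo) (.reg rN))))))
  (.seq (.seq (.assign rLo (.sub (.sub (.reg rM) (.reg rN)) (.const 1)))
      (.assign rSkip (.reg rLo)))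
    (.loop (.lt (.reg rSkip) (.reg rM))
      (.seq windowProg (.assign rSkip (.add (.reg rSkip) (.const 1)))))))))

theorem mainProg_spec {W M n m : ℕ} {u v : ℕ → ℕ} (hM : 1 ≤ M) (hW : 20 * M < W) {s : State}
    (hs : Bdd M s) (hn : s.reg rN = n) (hm : s.reg rM = m) (hn0 : 0 < n) (hmM : m + m ≤ M)
    (hmn : m ≤ n * n) (hu' : s.arr aU = u) (hv' : s.arr aV = v)
    (hu : ∀ i < m, u i < n) (hv : ∀ i < m, v i < n)
    (hconn : ∀ f : ℕ → ℕ, (∀ i < m, f (u i) = f (v i)) → ∀ a < n, ∀ b < n, f a = f b)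
    (hbest : BestInv n m s) :
    ∃ s', Runs W M mainProg s s' (30000 * ((n + 2) * (n + m + 1))) ∧ BestInv n m s' ∧
      BaseGain n m u v (s'.reg rBest) ∧
      (∀ j, j * n + n < m → Gain n m u v (s'.reg rBest) (j * n) (j * n + n)) ∧
      ∀ g, m - n - 1 ≤ g → g < m → Gain n m u v (s'.reg rBest) (m - n - 1) g := by
  have key : ∀ t : State, Bdd M t → t.reg rN = n → t.reg rM = m → t.arr aU = u → t.arr aV = v →
      BestInv n m t → ∃ t', Runs W M windowProg t t' (8000 * (n + m + 1)) ∧ BestInv n m t' ∧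
        t.reg rBest ≤ t'.reg rBest ∧ Gain n m u v (t'.reg rBest) (t.reg rLo) (t.reg rSkip) ∧
        (window n m (t.reg rLo) (t.reg rSkip) = ∅ → BaseGain n m u v (t'.reg rBest)) := by
    intro t ht htn htm htu htv hb
    obtain ⟨t', h1, h2, h3, h4⟩ := windowProg_spec hM hW ht htn htm hn0 hmM
      (by rw [htu]; exact hu) (by rw [htv]; exact hv) (by rw [htu, htv]; exact hconn) hb
    rw [htu, htv] at h4
    exact ⟨t', h1, h2, h3, fun κ hκ => (h4 κ hκ).1, fun he κ => (h4 κ (by simp [he])).2 he⟩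
  have r₁ : Runs W M (.seq (.assign rLo (.reg rM)) (.assign rSkip (.reg rM))) s _ _ :=
    Runs.of_safe hM hW (.seq (.assign rLo (.reg rM)) (.assign rSkip (.reg rM))) rfl hs
      ⟨hs.1 _, hs.1 _⟩
  set s₁ := (Prog.seq (.assign rLo (.reg rM)) (.assign rSkip (.reg rM))).run s with hs₁
  obtain ⟨s₂, r₂, hb₂, -, -, hbase⟩ := key s₁ r₁.bdd hn hm hu' hv' hbest
  replace hbase := hbase (by
    have h1 : s₁.reg rLo = m := hm
    have h2 : s₁.reg rSkip = m := hm
    rw [h1, h2]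
    exact window_self n m)
  have r₃ : Runs W M (.assign rLo (.const 0)) s₂ (s₂.setReg rLo 0) 2 :=
    Runs.of_safe hM hW (.assign rLo (.const 0)) rfl r₂.bdd (Nat.zero_le _)
  have e3n : (s₂.setReg rLo 0).reg rN = n := (r₂.reg_eq rfl).trans hn
  have e3m : (s₂.setReg rLo 0).reg rM = m := (r₂.reg_eq rfl).trans hm
  have e3u : (s₂.setReg rLo 0).arr aU = u := (r₂.arr_eq rfl).trans hu'
  have e3v : (s₂.setReg rLo 0).arr aV = v := (r₂.arr_eq rfl).trans hv'
  obtain ⟨s₄, r₄, ⟨hb₄, hbase₄, j₀, hj₀, hgain₄⟩, hend⟩ := Runs.loop_of_body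
    (s₀ := s₂.setReg rLo 0) hM hW (b := .lt (.add (.reg rLo) (.reg rN)) (.reg rM))
    (P := .seq (.assign rSkip (.add (.reg rLo) (.reg rN)))
        (.seq windowProg (.assign rLo (.add (.reg rLo) (.reg rN))))) rfl
    (fun t => BestInv n m t ∧ BaseGain n m u v (t.reg rBest) ∧ ∃ j, t.reg rLo = j * n ∧
      ∀ j' < j, Gain n m u v (t.reg rBest) (j' * n) (j' * n + n))
    (fun t => (m - t.reg rLo) / n) (8000 * (n + m + 1) + 20)
    (by
      rintro t ht hf ⟨hbt, hbase, j, hj, hg⟩ hgo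
      have htn : t.reg rN = n := (hf.1 _ rfl).trans e3n
      have htm : t.reg rM = m := (hf.1 _ rfl).trans e3m
      have hlt : j * n + n < m := by
        simp only [Expr.eval, htn, htm, hj] at hgo
        by_contra h
        exact hgo (if_neg h)
      have q₁ : Runs W M (.assign rSkip (.add (.reg rLo) (.reg rN))) t
          (t.setReg rSkip (j * n + n)) 4 := by
        have := Runs.of_safe hM hW (.assign rSkip (.add (.reg rLo) (.reg rN))) rfl ht
          (by simp only [Prog.Safe, Expr.eval, hj, htn]; omega)
        simpa only [Prog.run, Expr.eval, hj, htn, Prog.time, Expr.cost] using this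
      obtain ⟨t₂, q₂, hb₂, hle, hgain, -⟩ := key _ q₁.bdd htn htm ((hf.2 _ rfl).trans e3u)
        ((hf.2 _ rfl).trans e3v) hbt
      have hle : t.reg rBest ≤ t₂.reg rBest := hle
      have h2lo : t₂.reg rLo = j * n := (q₂.reg_eq rfl).trans hj
      have h2n : t₂.reg rN = n := (q₂.reg_eq rfl).trans htn
      have q₃ : Runs W M (.assign rLo (.add (.reg rLo) (.reg rN))) t₂
          (t₂.setReg rLo (j * n + n)) 4 := by
        have := Runs.of_safe hM hW (.assign rLo (.add (.reg rLo) (.reg rN))) rfl q₂.bdd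
          (by simp only [Prog.Safe, Expr.eval, h2lo, h2n]; omega)
        simpa only [Prog.run, Expr.eval, h2lo, h2n, Prog.time, Expr.cost] using this
      refine ⟨_, (q₁.seq (q₂.seq q₃)).mono (by omega), ⟨hb₂, hbase.mono hle, j + 1, ?_, ?_⟩, ?_⟩
      · simp [add_mul]
      · intro j' hj'
        rcases Nat.lt_succ_iff_lt_or_eq.mp hj' with hj' | rfl
        · exact (hg j' hj').mono hle
        · have h1 : (t.setReg rSkip (j' * n + n)).reg rLo = j' * n := hj
          rw [h1] at hgain
          exact hgain
      · simp only [State.setReg_reg, if_true, hj]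
        rw [show m - j * n = (m - (j * n + n)) + n by omega, Nat.add_div_right _ hn0]
        exact Nat.lt_succ_self _) r₃.bdd
    ⟨hb₂, hbase, 0, by simp, by simp⟩
  have e4n : s₄.reg rN = n := (r₄.reg_eq rfl).trans e3n
  have e4m : s₄.reg rM = m := (r₄.reg_eq rfl).trans e3m
  replace hgain₄ : ∀ j, j * n + n < m → Gain n m u v (s₄.reg rBest) (j * n) (j * n + n) := by
    intro j hj
    refine hgain₄ j ?_
    have hge : m ≤ j₀ * n + n := by
      simp only [Expr.eval, e4n, e4m, hj₀] at hend
      by_contra h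
      rw [if_pos (by omega)] at hend
      omega
    exact lt_of_mul_lt_mul_right (by omega) (Nat.zero_le n)
  have r₅ : Runs W M (.seq (.assign rLo (.sub (.sub (.reg rM) (.reg rN)) (.const 1)))
      (.assign rSkip (.reg rLo))) s₄ _ _ :=
    Runs.of_safe hM hW (.seq (.assign rLo (.sub (.sub (.reg rM) (.reg rN)) (.const 1)))
      (.assign rSkip (.reg rLo))) rfl r₄.bdd
      (by simp [Prog.Safe, Prog.run, Expr.eval, e4m]; omega)
  set s₅ := (Prog.seq (.assign rLo (.sub (.sub (.reg rM) (.reg rN)) (.const 1)))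
      (.assign rSkip (.reg rLo))).run s₄ with hs₅
  have e5lo : s₅.reg rLo = m - n - 1 := by simp [hs₅, Prog.run, Expr.eval, e4m, e4n]
  have e5skip : s₅.reg rSkip = m - n - 1 := by simp [hs₅, Prog.run, Expr.eval, e4m, e4n]
  have e5n : s₅.reg rN = n := e4n
  have e5m : s₅.reg rM = m := e4m
  have e5u : s₅.arr aU = u := (r₅.arr_eq rfl).trans ((r₄.arr_eq rfl).trans e3u)
  have e5v : s₅.arr aV = v := (r₅.arr_eq rfl).trans ((r₄.arr_eq rfl).trans e3v)
  obtain ⟨s₆, r₆, ⟨hb₆, hbase₆, hgain₆, -, hlast⟩, hend₆⟩ := Runs.loop_of_body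
    (s₀ := s₅) hM hW (b := .lt (.reg rSkip) (.reg rM))
    (P := .seq windowProg (.assign rSkip (.add (.reg rSkip) (.const 1)))) rfl
    (fun t => BestInv n m t ∧ BaseGain n m u v (t.reg rBest) ∧
      (∀ j, j * n + n < m → Gain n m u v (t.reg rBest) (j * n) (j * n + n)) ∧
      m - n - 1 ≤ t.reg rSkip ∧
      ∀ g, m - n - 1 ≤ g → g < t.reg rSkip → Gain n m u v (t.reg rBest) (m - n - 1) g)
    (fun t => m - t.reg rSkip) (8000 * (n + m + 1) + 20)
    (by
      rintro t ht hf ⟨hbt, hbase, hg, hge, hg'⟩ hgo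
      have htn : t.reg rN = n := (hf.1 _ rfl).trans e5n
      have htm : t.reg rM = m := (hf.1 _ rfl).trans e5m
      have htlo : t.reg rLo = m - n - 1 := (hf.1 _ rfl).trans e5lo
      have hlt : t.reg rSkip < m := by
        simp only [Expr.eval, htm] at hgo
        by_contra h
        exact hgo (if_neg h)
      obtain ⟨t₁, q₁, hb₁, hle, hgain, -⟩ := key _ ht htn htm ((hf.2 _ rfl).trans e5u)
        ((hf.2 _ rfl).trans e5v) hbt
      rw [htlo] at hgain
      have h1s : t₁.reg rSkip = t.reg rSkip := q₁.reg_eq rfl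
      have q₂ : Runs W M (.assign rSkip (.add (.reg rSkip) (.const 1))) t₁
          (t₁.setReg rSkip (t.reg rSkip + 1)) 4 := by
        have := Runs.of_safe hM hW (.assign rSkip (.add (.reg rSkip) (.const 1))) rfl q₁.bdd
          (by simp only [Prog.Safe, Expr.eval, h1s]; omega)
        simpa only [Prog.run, Expr.eval, h1s, Prog.time, Expr.cost] using this
      refine ⟨_, (q₁.seq q₂).mono (by omega), ⟨hb₁, hbase.mono hle, fun j hj => (hg j hj).mono hle,
        ?_, ?_⟩, ?_⟩
      · simp only [State.setReg_reg, if_true]; omega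
      · intro g h1 h2
        simp only [State.setReg_reg, if_true] at h2
        rcases Nat.lt_succ_iff_lt_or_eq.mp h2 with h2 | rfl
        · exact (hg' g h1 h2).mono hle
        · exact hgain
      · simp only [State.setReg_reg, if_true]; omega) r₅.bdd
    ⟨hb₄, hbase₄, hgain₄, e5skip.ge, fun g h1 h2 => absurd h2 (by omega)⟩
  have h6s : m ≤ s₆.reg rSkip := by
    simp only [Expr.eval, (r₆.reg_eq rfl).trans e5m] at hend₆
    by_contra h
    rw [if_pos (by omega)] at hend₆
    omega
  have h1 : (m - (s₂.setReg rLo 0).reg rLo) / n ≤ n := by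
    simp only [State.setReg_reg, if_true, Nat.sub_zero]
    exact Nat.div_le_of_le_mul hmn
  have h2 : m - s₅.reg rSkip ≤ n + 1 := by omega
  have h3 : ∀ c x : ℕ, c ≤ 8100 * (n + m + 1) → x ≤ n + 2 →
      c * x ≤ 8100 * ((n + 2) * (n + m + 1)) := by
    intro c x hc hx
    calc c * x ≤ (8100 * (n + m + 1)) * (n + 2) := Nat.mul_le_mul hc hx
      _ = _ := by ring
  have h6 : n + m + 1 ≤ (n + 2) * (n + m + 1) := Nat.le_mul_of_pos_left _ (by omega)
  replace r₄ := r₄.mono (h3 _ _ (by simp only [Expr.cost]; omega) (by omega))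
  replace r₆ := r₆.mono (h3 _ _ (by simp only [Expr.cost]; omega) (by omega))
  refine ⟨s₆, (r₁.seq (r₂.seq (r₃.seq (r₄.seq (r₅.seq r₆))))).mono ?_, hb₆, hbase₆, hgain₆,
    fun g h1 h2 => hlast g h1 (by omega)⟩
  simp only [Prog.time, Expr.cost]
  omega

/-- If fewer than `m / n` of the `m` edges are bad, then one of the windows contains no bad edge. -/
theorem exists_window {n m : ℕ} (hn : 0 < n) (hm : n + 1 ≤ m) {D : Finset ℕ} (hD : ∀ i ∈ D, i < m)
    (hc : n * D.card < m) :
    (∃ j, j * n + n < m ∧ ∀ i ∈ window n m (j * n) (j * n + n), i ∉ D) ∨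
      ∃ g, m - n - 1 ≤ g ∧ g < m ∧ ∀ i ∈ window n m (m - n - 1) g, i ∉ D := by
  by_contra hcon
  push Not at hcon
  obtain ⟨h1, h2⟩ := hcon
  obtain ⟨k, hk⟩ : ∃ k, (m - 1) / n = k + 1 :=
    ⟨(m - 1) / n - 1, (Nat.sub_add_cancel (Nat.div_pos (by omega) hn)).symm⟩
  have hk1 : (k + 1) * n ≤ m - 1 := hk ▸ Nat.div_mul_le_self _ _
  have hDk : D.card ≤ k + 1 := by
    rw [← hk, Nat.le_div_iff_mul_le hn, mul_comm]
    omega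
  rw [add_mul, one_mul] at hk1
  -- The first `k` disjoint windows use up all bad edges but one.
  have h3 : k ≤ (D.filter fun i => i < k * n).card := by
    calc k = (Finset.range k).card := (Finset.card_range k).symm
      _ ≤ ((D.filter fun i => i < k * n).image fun i => i / n).card := by
        refine Finset.card_le_card fun j hj => ?_
        rw [Finset.mem_range] at hj
        have hle : (j + 1) * n ≤ k * n := Nat.mul_le_mul_right n hj
        rw [add_mul, one_mul] at hle
        obtain ⟨i, hi, hiD⟩ := h1 j (by omega)
        simp only [window, Finset.mem_filter, Finset.mem_range] at hi
        simp only [Finset.mem_image, Finset.mem_filter]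
        refine ⟨i, ⟨hiD, by omega⟩, ?_⟩
        rw [Nat.div_eq_iff hn]
        omega
      _ ≤ _ := Finset.card_image_le
  have h4 : (D.filter fun i => ¬ i < k * n).card ≤ 1 := by
    have := Finset.card_filter_add_card_filter_not (s := D) (fun i => i < k * n)
    omega
  rw [Finset.card_le_one] at h4
  have h5 : ∀ g, m - n - 1 ≤ g → g < m → ∃ i ∈ D, m - n - 1 ≤ i ∧ i ≠ g := by
    intro g hg hgm
    obtain ⟨i, hi, hiD⟩ := h2 g hg hgm
    simp only [window, Finset.mem_filter] at hi
    exact ⟨i, hiD, hi.2.1, hi.2.2.2⟩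
  obtain ⟨a, haD, ha, -⟩ := h5 (m - 1) (by omega) (by omega)
  obtain ⟨b, hbD, hb, hne⟩ := h5 a ha (hD a haD)
  exact hne (h4 b (Finset.mem_filter.mpr ⟨hbD, by omega⟩) a (Finset.mem_filter.mpr ⟨haD, by omega⟩))

/-- The bound on the best cut in terms of the number `β` of edges that a colouring does not cut. -/
theorem bound_of_gain {n m B β : ℕ} {u v κ : ℕ → ℕ} (hn : 0 < n) (hm : 0 < m) (hnm : n ≤ m + 1)
    (hβ : ((Finset.range m).filter fun i => (κ (u i) + κ (v i)) % 2 = 0).card = β)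
    (hB : B ≤ m) (hβm : β ≤ m)
    (h₀ : BaseGain n m u v B) (h₁ : ∀ j, j * n + n < m → Gain n m u v B (j * n) (j * n + n))
    (h₂ : ∀ g, m - n - 1 ≤ g → g < m → Gain n m u v B (m - n - 1) g) :
    min 1 (1 / 2 + (n : ℝ) / (2 * (m : ℝ))) * ((m - β : ℕ) : ℝ) ≤ (B : ℝ) := by
  have hmR : (0 : ℝ) < m := Nat.cast_pos.mpr hm
  have hle : ∀ x : ℝ, x * ((m - β : ℕ) : ℝ) ≤ B →
      x = 1 ∨ x = 1 / 2 + (n : ℝ) / (2 * (m : ℝ)) →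
      min 1 (1 / 2 + (n : ℝ) / (2 * (m : ℝ))) * ((m - β : ℕ) : ℝ) ≤ (B : ℝ) := by
    rintro x hx hx'
    refine le_trans (mul_le_mul_of_nonneg_right ?_ (Nat.cast_nonneg _)) hx
    rcases hx' with rfl | rfl
    exacts [min_le_left _ _, min_le_right _ _]
  have hreal : (m + n) * (m - β) ≤ 2 * m * B →
      min 1 (1 / 2 + (n : ℝ) / (2 * (m : ℝ))) * ((m - β : ℕ) : ℝ) ≤ (B : ℝ) := by
    intro h
    refine hle _ ?_ (.inr rfl)
    have h' : ((m : ℝ) + n) * ((m - β : ℕ) : ℝ) ≤ 2 * m * B := by exact_mod_cast h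
    rw [show (1 / 2 + (n : ℝ) / (2 * (m : ℝ))) = ((m : ℝ) + n) / (2 * m) by field_simp,
      div_mul_eq_mul_div, div_le_iff₀ (by positivity)]
    linarith
  have h₀' := h₀ κ
  rw [hβ] at h₀'
  obtain ⟨d, rfl⟩ : ∃ d, m = β + d := ⟨m - β, by omega⟩
  rw [Nat.add_sub_cancel_left] at hreal hle ⊢
  rcases le_or_gt (β + d) (n * β) with hlarge | hsmall
  · refine hreal ?_
    obtain ⟨k, rfl⟩ : ∃ k, n = k + 1 := ⟨n - 1, by omega⟩
    have h3 : d + k ≤ 2 * B := by omega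
    have h4 := Nat.mul_le_mul_left (β + d) h3
    linarith
  rcases le_or_gt (β + d) n with hmn | hmn
  -- Here the ratio is `1`, and the bound `2 * B ≥ m + n - 1` suffices because `B` is an integer.
  · have hβ0 : β = 0 := by
      by_contra h
      have : n * 1 ≤ n * β := Nat.mul_le_mul_left n (by omega)
      omega
    refine hle 1 ?_ (.inl rfl)
    rw [one_mul, Nat.cast_le]
    omega
  · have hgain : β + d + n ≤ 2 * B + β := by
      have hwin := exists_window hn hmn
        (D := (Finset.range (β + d)).filter fun i => (κ (u i) + κ (v i)) % 2 = 0)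
        (fun i hi => Finset.mem_range.mp (Finset.mem_filter.mp hi).1) (by rw [hβ]; exact hsmall)
      have hgood : ∀ lo skip, (∀ i ∈ window n (β + d) lo skip,
          i ∉ (Finset.range (β + d)).filter fun i => (κ (u i) + κ (v i)) % 2 = 0) →
          ∀ i ∈ window n (β + d) lo skip, (κ (u i) + κ (v i)) % 2 ≠ 0 :=
        fun lo skip h i hi h0 => h i hi
          (Finset.mem_filter.mpr ⟨(Finset.mem_filter.mp hi).1, h0⟩)
      rcases hwin with ⟨j, hj, hD⟩ | ⟨g, hg, hgm, hD⟩
      · have := h₁ j hj κ (hgood _ _ hD)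
        rwa [hβ, card_window hj (by omega) (by omega)] at this
      · have := h₂ g hg hgm κ (hgood _ _ hD)
        rwa [hβ, card_window (by omega) hg (by omega)] at this
    refine hreal ?_
    nlinarith

end MaxCut

/-! ### Cuts of a graph given by its list of edges -/

namespace MaxCut

section EdgeList

variable {n m : ℕ} {G : SimpleGraph (Fin n)} {e : Fin m → Fin n × Fin n}

theorem inputState_ends (e : Fin m → Fin n × Fin n) (i : Fin m) :
    (inputState e).arr 0 i = (e i).1 ∧ (inputState e).arr 1 i = (e i).2 := by
  simp [inputState]

theorem IsEdgeList.adj (he : IsEdgeList G e) (i : Fin m) : G.Adj (e i).1 (e i).2 := by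
  have : s((e i).1, (e i).2) ∈ G.edgeSet := he.2 ▸ Set.mem_range_self i
  exact this

/-- The size of a cut, counted along the list of edges. -/
theorem cutSize_eq (he : IsEdgeList G e) {c : ℕ → ℕ} (hc : ∀ w < n, c w ≤ 1) :
    cutSize G {v : Fin n | c v ≠ 0} =
      cutCount m ((inputState e).arr 0) ((inputState e).arr 1) c := by
  have hset : edgesBetween G {v : Fin n | c v ≠ 0} {v : Fin n | c v ≠ 0}ᶜ =
      (fun i => s((e i).1, (e i).2)) ''
        (Finset.univ.filter fun i : Fin m => c (e i).1 ≠ c (e i).2 : Finset (Fin m)) := by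
    ext x
    simp only [edgesBetween, Set.mem_ofPred_eq, Set.mem_compl_iff, Set.mem_image, Finset.mem_coe,
      Finset.mem_filter, Finset.mem_univ, true_and, not_not]
    constructor
    · rintro ⟨a, ha, b, hb, hab, rfl⟩
      obtain ⟨i, hi⟩ : s(a, b) ∈ Set.range fun i => s((e i).1, (e i).2) := by
        rw [he.2]; exact hab
      refine ⟨i, ?_, hi⟩
      dsimp only at hi
      rcases Sym2.eq_iff.mp hi with ⟨h1, h2⟩ | ⟨h1, h2⟩ <;> rw [h1, h2] <;> omega
    · rintro ⟨i, hne, rfl⟩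
      have h1 := hc _ (e i).1.isLt
      have h2 := hc _ (e i).2.isLt
      by_cases h0 : c (e i).1 = 0
      · exact ⟨(e i).2, by omega, (e i).1, h0, (he.adj i).symm, Sym2.eq_swap⟩
      · exact ⟨(e i).1, h0, (e i).2, by omega, he.adj i, rfl⟩
  rw [cutSize, hset, Set.ncard_image_of_injective _ he.1, Set.ncard_coe_finset, cutCount,
    Finset.card_filter, Finset.card_filter, Finset.sum_range]
  refine Finset.sum_congr rfl fun i _ => ?_
  rw [(inputState_ends e i).1, (inputState_ends e i).2]

/-- A maximum cut, as a colouring. -/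
theorem exists_maxCut (he : IsEdgeList G e) : ∃ κ : ℕ → ℕ, (∀ w, κ w ≤ 1) ∧
    maxCut G = cutCount m ((inputState e).arr 0) ((inputState e).arr 1) κ := by
  classical
  obtain ⟨A, -, hA⟩ := Finset.exists_mem_eq_sup (Finset.univ : Finset (Finset (Fin n)))
    Finset.univ_nonempty fun A => cutSize G (A : Set (Fin n))
  refine ⟨fun w => if ∃ h : w < n, (⟨w, h⟩ : Fin n) ∈ A then 1 else 0, fun w => ite_le_one _, ?_⟩
  rw [← cutSize_eq he fun w _ => ite_le_one _, maxCut, hA]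
  congr 1
  ext v
  simp

theorem cutCount_add_card {κ u v : ℕ → ℕ} (hκ : ∀ w, κ w ≤ 1) :
    cutCount m u v κ + ((Finset.range m).filter fun i => (κ (u i) + κ (v i)) % 2 = 0).card = m := by
  have h := Finset.card_filter_add_card_filter_not (s := Finset.range m)
    (p := fun i => κ (u i) ≠ κ (v i))
  rw [Finset.card_range] at h
  rw [cutCount, Finset.filter_congr (p := fun i => (κ (u i) + κ (v i)) % 2 = 0)
    (q := fun i => ¬ κ (u i) ≠ κ (v i)) fun i _ => ?_]
  · exact h
  · have h1 := hκ (u i)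
    have h2 := hκ (v i)
    omega

theorem IsEdgeList.eq_of_connected (he : IsEdgeList G e) (hG : G.Connected) {f : ℕ → ℕ}
    (hf : ∀ i < m, f ((inputState e).arr 0 i) = f ((inputState e).arr 1 i)) :
    ∀ a < n, ∀ b < n, f a = f b := by
  have hadj : ∀ a b : Fin n, G.Adj a b → f a = f b := by
    intro a b hab
    obtain ⟨i, hi⟩ : s(a, b) ∈ Set.range fun i => s((e i).1, (e i).2) := by
      rw [he.2]; exact hab
    have := hf i i.isLt
    rw [(inputState_ends e i).1, (inputState_ends e i).2] at this
    rcases Sym2.eq_iff.mp hi with ⟨h1, h2⟩ | ⟨h1, h2⟩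
    · rw [← h1, ← h2, this]
    · rw [← h1, ← h2, this]
  have hwalk : ∀ a b : Fin n, G.Walk a b → f a = f b := by
    intro a b p
    induction p with
    | nil => rfl
    | cons h _ ih => exact (hadj _ _ h).trans ih
  intro a ha b hb
  obtain ⟨p⟩ := hG.preconnected ⟨a, ha⟩ ⟨b, hb⟩
  exact hwalk _ _ p

theorem IsEdgeList.le_mul (he : IsEdgeList G e) : m ≤ n * n := by
  have hinj : Function.Injective e := fun i j hij => he.1 (by simp only [hij])
  simpa using Fintype.card_le_of_injective e hinj

theorem IsEdgeList.le_add_one (he : IsEdgeList G e) (hG : G.Connected) : n ≤ m + 1 := by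
  have h := hG.card_vert_le_card_edgeSet_add_one
  have hm : Nat.card G.edgeSet = m := by
    rw [Nat.card_coe_set_eq, ← he.2, Set.ncard_range_of_injective he.1, Nat.card_fin]
  rwa [Nat.card_fin, hm] at h

end EdgeList

end MaxCut

theorem theorem2 :
    ∃ (P : RAM.Prog) (C k : ℕ),
      ∀ (n m : ℕ) (G : SimpleGraph (Fin n)) (e : Fin m → Fin n × Fin n),
        G.Connected → 0 < m → MaxCut.IsEdgeList G e →
          ∃ (s : RAM.State) (t : ℕ),
            RAM.Exec ((n + m + 2) ^ k) P (MaxCut.inputState e) s t ∧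
            t ≤ C * (n * m) ∧
            min 1 (1 / 2 + (n : ℝ) / (2 * (m : ℝ))) * (MaxCut.maxCut G : ℝ) ≤
              (MaxCut.cutSize G (MaxCut.outputSide n s) : ℝ) := by
  refine ⟨MaxCut.mainProg, 360000, 4, fun n m G e hG hm he => ?_⟩
  have hn : 0 < n := (Nat.zero_le _).trans_lt (e ⟨0, hm⟩).1.isLt
  have hnm := he.le_add_one hG
  have hu : ∀ i < m, (MaxCut.inputState e).arr 0 i < n := fun i hi => by
    rw [(MaxCut.inputState_ends e ⟨i, hi⟩).1]; exact Fin.isLt _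
  have hv : ∀ i < m, (MaxCut.inputState e).arr 1 i < n := fun i hi => by
    rw [(MaxCut.inputState_ends e ⟨i, hi⟩).2]; exact Fin.isLt _
  have hbdd : RAM.Bdd (2 * (n + m + 2)) (MaxCut.inputState e) := by
    refine ⟨fun x => ?_, fun a i => ?_⟩
    · simp only [MaxCut.inputState]
      split_ifs <;> omega
    · by_cases hi : i < m
      · have h1 := (e ⟨i, hi⟩).1.isLt
        have h2 := (e ⟨i, hi⟩).2.isLt
        simp only [MaxCut.inputState, dif_pos hi]
        split_ifs <;> omega
      · simp only [MaxCut.inputState, dif_neg hi]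
        omega
  have hW : 20 * (2 * (n + m + 2)) < (n + m + 2) ^ 4 := by
    obtain ⟨N, hN⟩ : ∃ N, n + m + 2 = N + 4 := ⟨n + m - 2, by omega⟩
    rw [hN]
    have h3 : 41 ≤ (N + 4) ^ 3 :=
      le_trans (by norm_num) (Nat.pow_le_pow_left (Nat.le_add_left 4 N) 3)
    calc 20 * (2 * (N + 4)) < 41 * (N + 4) := by omega
      _ ≤ (N + 4) ^ 3 * (N + 4) := Nat.mul_le_mul_right _ h3
      _ = (N + 4) ^ 4 := (pow_succ _ _).symm
  have hout : ∀ i, (MaxCut.inputState e).arr 2 i = 0 := fun i => by simp [MaxCut.inputState]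
  obtain ⟨s, ⟨t, ht, hexec, -⟩, hbest, h₀, h₁, h₂⟩ := MaxCut.mainProg_spec (by omega) hW hbdd
    (n := n) (m := m) (by simp [MaxCut.inputState]) (by simp [MaxCut.inputState]) hn (by omega)
    he.le_mul rfl rfl hu hv (fun f => he.eq_of_connected hG)
    ⟨fun w _ => by rw [hout]; exact Nat.zero_le 1,
      by simp [MaxCut.cutCount, MaxCut.inputState]⟩
  refine ⟨s, t, hexec, ht.trans ?_, ?_⟩
  · have h3 : n + 2 ≤ 3 * n := by omega
    have h4 : n + m + 1 ≤ 4 * m := by omega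
    calc 30000 * ((n + 2) * (n + m + 1)) ≤ 30000 * ((3 * n) * (4 * m)) :=
          Nat.mul_le_mul_left _ (Nat.mul_le_mul h3 h4)
      _ = 360000 * (n * m) := by ring
  · obtain ⟨κ, hκ, hmax⟩ := MaxCut.exists_maxCut he
    have hcard := MaxCut.cutCount_add_card (m := m) (u := (MaxCut.inputState e).arr 0)
      (v := (MaxCut.inputState e).arr 1) hκ
    have e0 : s.arr 0 = (MaxCut.inputState e).arr 0 := hexec.arr_eq rfl
    have e1 : s.arr 1 = (MaxCut.inputState e).arr 1 := hexec.arr_eq rfl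
    have hcut : MaxCut.cutSize G (MaxCut.outputSide n s) = s.reg 4 := by
      rw [hbest.2, e0, e1]
      exact MaxCut.cutSize_eq he hbest.1
    have hle : s.reg 4 ≤ m := by
      rw [hbest.2]
      exact (Finset.card_filter_le _ _).trans_eq (Finset.card_range _)
    rw [hcut, hmax, show MaxCut.cutCount m ((MaxCut.inputState e).arr 0)
      ((MaxCut.inputState e).arr 1) κ = m - ((Finset.range m).filter fun i =>
        (κ ((MaxCut.inputState e).arr 0 i) + κ ((MaxCut.inputState e).arr 1 i)) % 2 = 0).card by
      omega]
    exact MaxCut.bound_of_gain (κ := κ) hn hm hnm rfl hle (by omega) h₀ h₁ h₂
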